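/- For $s\ge 1$ let $\sigma_s(x)=e^{sx}/(1+e^{sx})$ be the sigmoid unit of sharpness $s$. For $m\in\mathbb N$ let $$\phi_m(x)=-(2m+1)+\sum_{k=-m}^{m}\Big[\sigma_s\Big(x-\frac{4k-1}{s}\Big)+\sigma_s\Big(\frac{4k+1}{s}-x\Big)\Big],$$ and for $S\subseteq\{1,\dots,n\}$ let $f_{m,S}(x)=\phi_m\big(\sum_{i\in S}x_i\big)$, $x\in\mathbb R^n$ (the $s$-wave functions). The function $f_{m,S}$ is computed by a network with one hidden layer of $2(2m+1)$ sigmoid units of sharpness $s$ and a sum output gate (with an additive constant); let $W_{m,S}\in\mathbb R^{2(2m+1)\times n}$ be its weight matrix, whose rows are $\pm\mathbf 1_S$. For a matrix $W$ of the same size let $f_{m,W}$ be the function computed by the network with the same biases and output constant but with weight matrix $W$, so that $f_{m,W_{m,S}}=f_{m,S}$. The condition number of a matrix with $N$ rows and $n$ columns is the ratio of the largest to the smallest of its $\min(N,n)$ singular values ($\infty$ if the smallest is $0$). Statistical query (SQ) algorithms: for a distribution $P$ on $\mathbb R^n$ and a target $f$, a $\mathrm{VSTAT}(t)$ oracle answers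 a query $h:\mathbb R^n\times\mathbb R\to[0,1]$ with a value $v$ such that $|p-v|\le\max\{1/t,\sqrt{p(1-p)/t}\}$, where $p=\mathbb E_{x\sim P}\,h(x,f(x))$. A query is $\lambda$-Lipschitz if it is $\lambda$-Lipschitz in its last argument (the label) for each fixed $x$. An SQ algorithm is randomized and adaptive, accesses the examples only through the oracle, and outputs a function $g:\mathbb R^n\to\mathbb R$. It weakly learns a family $\mathcal F$ over $P$ if for every $f\in\mathcal F$ and every such oracle for $f$, with probability at least $1/2$, $$\mathbb E_P(g-f)^2\le \mathbb E_P(a-f)^2-\frac1{\sqrt t}\quad\text{for all constants }a\in\mathbb R .$$ **Theorem 1.** There are absolute constants $c,C>0$ and $K,n_0\in\mathbb N$ such that for all $n\ge n_0$ and all real $\lambda,s\ge1$ there are $m,t\in\mathbb N$ and $\eta$ with $\frac1{C(ns\lambda)^K}\le\eta\le\frac1{ns\lambda}$ for which the following hold. 1. The number of units satisfies $2(2m+1)\le C\,s\sqrt n\,\log(\lambda sn)$, and $t\ge c\,s^2n$. 2. Every $f_{m,S}$ maps $\mathbb R^n$ to $[-1,1]$ and is computed by the network with weight matrix $W_{m,S}$.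 3. For every $S$ with $|S|=\lfloor n/2\rfloor$ there is a matrix $W_S$, differing from $W_{m,S}$ by at most $\eta$ in each entry, whose condition number is at most $C(ns\lambda)^K$. 4. Let $(W_S)_{|S|=\lfloor n/2\rfloor}$ be any matrices such that $W_S$ differs from $W_{m,S}$ by at most $\eta$ in each entry (for example $W_S=W_{m,S}$, or the well-conditioned matrices of part 3). Then $f_{m,W_S}(x)\in[-1,1]$ for all $S$ and all $x$ with $\max_i|x_i|\le ns\lambda$. Moreover, let $D$ be any logconcave distribution on $\mathbb R$ with unit variance, let $\mu$ be its mean, and let $\mathcal C_\mu$ be the family of the functions $x\mapsto f_{m,W_S}(x_1-\mu,\dots,x_n-\mu)$, $|S|=\lfloor n/2\rfloor$ (networks with the same weight matrices and shifted biases). Then every $f\in\mathcal C_\mu$ has variance at least $c$ under $D^n$, and every randomized SQ algorithm that uses at most $q$ $\lambda$-Lipschitz queries to $\mathrm{VSTAT}(t)$ and weakly learns $\mathcal C_\mu$ over $D^n$ satisfies $$q\ \ge\ \Big\lfloor \frac{2^{cn}}{\lambda s^2}\Big\rfloor .$$ -/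

import Mathlib

open MeasureTheory ProbabilityTheory
open scoped ENNReal

noncomputable section

namespace SQWave

/-! ### Networks with one hidden layer of sigmoid units and a sum output gate -/

/-- The sigmoid unit of sharpness `s`. -/
def sigmoidUnit (s x : ℝ) : ℝ := Real.exp (s * x) / (1 + Real.exp (s * x))

/-- The network with one hidden layer of sigmoid units of sharpness `s` indexed by `ι`, weight
matrix `W` and biases `b`, whose output gate adds the constant `c` and the values of all units. -/
def oneHidden {ι : Type} [Fintype ι] {n : ℕ} (s : ℝ) (W : Matrix ι (Fin n) ℝ) (b : ι → ℝ) (c : ℝ)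
    (x : Fin n → ℝ) : ℝ :=
  c + ∑ j, sigmoidUnit s (W.mulVec x j + b j)

/-- The condition number of a rectangular matrix: the ratio of the largest to the smallest of its
`min (#rows) (#columns)` singular values; it is `∞` unless the matrix has full rank. -/
def condNumber {ι : Type} [Fintype ι] [DecidableEq ι] {n : ℕ} (W : Matrix ι (Fin n) ℝ) : ℝ≥0∞ :=
  let σ := (Matrix.toEuclideanLin W).singularValues
  let r := min (Fintype.card ι) n - 1
  if σ r = 0 then ∞ else ENNReal.ofReal (σ 0 / σ r)

/-! ### The wave functions -/

/-- The one-dimensional wave function `φ_m` of sharpness `s`. -/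
def wave (s : ℝ) (m : ℕ) (x : ℝ) : ℝ :=
  -(2 * m + 1) + ∑ k ∈ Finset.Icc (-(m : ℤ)) (m : ℤ),
    (sigmoidUnit s (x - (4 * k - 1) / s) + sigmoidUnit s ((4 * k + 1) / s - x))

/-- The wave function `f_{m,S}` on `ℝⁿ`. -/
def sWave {n : ℕ} (s : ℝ) (m : ℕ) (S : Finset (Fin n)) (x : Fin n → ℝ) : ℝ :=
  wave s m (∑ i ∈ S, x i)

/-- The hidden units of the network for `f_{m,S}`: two for each integer `k` with `|k| ≤ m`. -/
abbrev WaveUnit (m : ℕ) : Type := ↥(Finset.Icc (-(m : ℤ)) (m : ℤ)) × Bool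

/-- The weight matrix of the network for `f_{m,S}`: its rows are plus and minus the indicator
vector of `S`. -/
def waveWeights {n : ℕ} (m : ℕ) (S : Finset (Fin n)) : Matrix (WaveUnit m) (Fin n) ℝ :=
  Matrix.of fun j i => if i ∈ S then (if j.2 then 1 else -1) else 0

/-- The biases of the hidden units in the network for `f_{m,S}`. -/
def waveBias (s : ℝ) (m : ℕ) : WaveUnit m → ℝ := fun j =>
  if j.2 then -((4 * ((j.1 : ℤ) : ℝ) - 1) / s) else (4 * ((j.1 : ℤ) : ℝ) + 1) / s

/-- The network with the biases and the output constant of the wave functions, and with an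
arbitrary weight matrix `W`. -/
def waveNet {n : ℕ} (s : ℝ) (m : ℕ) (W : Matrix (WaveUnit m) (Fin n) ℝ) (x : Fin n → ℝ) : ℝ :=
  oneHidden s W (waveBias s m) (-(2 * m + 1)) x

/-- `W` assigns to every `⌊n/2⌋`-element set `S` a weight matrix which differs in each entry by at
most `η` from that of `f_{m,S}`. -/
def IsPerturbation {n : ℕ} (m : ℕ) (η : ℝ)
    (W : Finset (Fin n) → Matrix (WaveUnit m) (Fin n) ℝ) : Prop :=
  ∀ S : Finset (Fin n), S.card = n / 2 → ∀ j i, |W S j i - waveWeights m S j i| ≤ η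

/-- The family of functions computed by the networks with weight matrices `W S`, `#S = ⌊n/2⌋`,
translated by `μ` in every coordinate (that is, with biases adapted to inputs of mean `μ`). -/
def waveFamily {n : ℕ} (s : ℝ) (m : ℕ) (W : Finset (Fin n) → Matrix (WaveUnit m) (Fin n) ℝ)
    (μ : ℝ) : Set ((Fin n → ℝ) → ℝ) :=
  {f | ∃ S : Finset (Fin n), S.card = n / 2 ∧ f = fun x => waveNet s m (W S) (fun i => x i - μ)}

/-! ### Statistical query algorithms -/

/-- A query: a measurable function of labelled examples `(x, y)` with values in `[0,1]`, which is
`L`-Lipschitz in the label `y` for every fixed `x`. -/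
structure Query (n : ℕ) (L : ℝ) where
  toFun : (Fin n → ℝ) → ℝ → ℝ
  measurable_toFun : Measurable (Function.uncurry toFun)
  mem_Icc : ∀ x y, toFun x y ∈ Set.Icc (0 : ℝ) 1
  lipschitz : ∀ x y y', |toFun x y - toFun x y'| ≤ L * |y - y'|

/-- A deterministic adaptive algorithm: it either stops with a hypothesis, or asks a query and
continues in a way that depends on the answer. -/
inductive Algo (n : ℕ) (L : ℝ) : Type
  | output (g : (Fin n → ℝ) → ℝ) (hg : Measurable g) : Algo n L
  | query (h : Query n L) (next : ℝ → Algo n L) : Algo n L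

/-- The hypothesis returned when queries are answered by `O`. -/
def Algo.run {n : ℕ} {L : ℝ} (O : Query n L → ℝ) : Algo n L → ((Fin n → ℝ) → ℝ)
  | .output g _ => g
  | .query h next => (next (O h)).run O

/-- The number of queries asked when queries are answered by `O`. -/
def Algo.numQueries {n : ℕ} {L : ℝ} (O : Query n L → ℝ) : Algo n L → ℕ
  | .output _ _ => 0
  | .query h next => (next (O h)).numQueries O + 1

/-- `O` is a `VSTAT(t)` oracle for the labelled examples `(x, f x)`, `x ∼ P`. -/
def IsVSTAT {n : ℕ} {L : ℝ} (P : Measure (Fin n → ℝ)) (f : (Fin n → ℝ) → ℝ) (t : ℕ)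
    (O : Query n L → ℝ) : Prop :=
  ∀ h : Query n L,
    let p := ∫ x, h.toFun x (f x) ∂P
    |p - O h| ≤ max (1 / (t : ℝ)) (Real.sqrt (p * (1 - p) / t))

/-- The regression error (mean squared error) of the hypothesis `g` for the target `f`. -/
def regError {n : ℕ} (P : Measure (Fin n → ℝ)) (g f : (Fin n → ℝ) → ℝ) : ℝ≥0∞ :=
  ∫⁻ x, ENNReal.ofReal ((g x - f x) ^ 2) ∂P

/-- The error of `g` is smaller by at least `τ` than that of every constant function. -/
def BeatsConstants {n : ℕ} (P : Measure (Fin n → ℝ)) (τ : ℝ) (g f : (Fin n → ℝ) → ℝ) : Prop :=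
  ∀ a : ℝ, regError P g f + ENNReal.ofReal τ ≤ regError P (fun _ => a) f

/-- The randomized algorithm `A` (a deterministic algorithm for each random seed) learns every
`f ∈ F` with probability at least `1/2`, to within regression error `1/√t` less than any constant
function, with every `VSTAT(t)` oracle for `f`. -/
def WeaklyLearns {n : ℕ} {L : ℝ} (P : Measure (Fin n → ℝ)) (t : ℕ) (F : Set ((Fin n → ℝ) → ℝ))
    {Ω : Type} [MeasurableSpace Ω] (ρ : Measure Ω) (A : Ω → Algo n L) : Prop :=
  ∀ f ∈ F, ∀ O : Query n L → ℝ, IsVSTAT P f t O →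
    ∃ G : Set Ω, MeasurableSet G ∧ 1 / 2 ≤ ρ G ∧
      ∀ ω ∈ G, BeatsConstants P (1 / Real.sqrt t) ((A ω).run O) f

/-- The randomized algorithm `A` never asks more than `q` queries when it is run with a `VSTAT(t)`
oracle for a function in `F`. -/
def UsesAtMost {n : ℕ} {L : ℝ} (P : Measure (Fin n → ℝ)) (t : ℕ) (F : Set ((Fin n → ℝ) → ℝ))
    {Ω : Type} (A : Ω → Algo n L) (q : ℕ) : Prop :=
  ∀ f ∈ F, ∀ O : Query n L → ℝ, IsVSTAT P f t O → ∀ ω, (A ω).numQueries O ≤ q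

/-! ### Input distributions -/

/-- A measure on the line with a logconcave density. -/
def IsLogConcave (D : Measure ℝ) : Prop :=
  ∃ p : ℝ → ℝ, Measurable p ∧ (∀ x, 0 ≤ p x) ∧
    (∀ x y a b : ℝ, 0 < a → 0 < b → a + b = 1 → p x ^ a * p y ^ b ≤ p (a * x + b * y)) ∧
    D = (volume : Measure ℝ).withDensity (fun x => ENNReal.ofReal (p x))

end SQWave

end

namespace SQWave

/-! ### The one-dimensional wave and its periodic limit -/

/-! The finite waves are compared with a periodic limit. Up to scaling, `wave` is a sum of bumps
`σ(u+1) - σ(u-1)` at spacing 4; summing over all integers gives `psi`, which is 4-periodic,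
1-Lipschitz, bounded by `9/10` and not constant (`psi_zero_ge`, `psi_two_le`). With `m` of order `s
√n log X`, `X = n s λ`, the two agree up to a small mean square error, because a centred logconcave
sum over `S` has bounded exponential moments at scale `√n` (`exists_integral_wave_sub_psi_sq_le`).
Perturbing the weights by `η = X⁻⁷` also changes little (`integral_waveNet_sub_sq_le`). So every
target is within `X⁻³` in `L²` of `psi` applied to `s` times the centred sum over `S`.

The core is an almost-orthogonality argument. A logconcave density of unit variance is at least
`1/16` on an interval of fixed length, so its characteristic function is bounded by some `ρ < 1` at
all frequencies `|κ| ≥ 1`, uniformly in the distribution (`exists_charFun_bound`). Hence characters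
of the sums over `S` and `T` have inner product at most `ρ ^ |S ∆ T|`. The rows of this Gram matrix
sum to at most `(1 + ρ) ^ n`, and a Bessel-type inequality (`sum_sq_inner_le`) shows that the
squared correlations of a fixed `u ∈ L²` with all these characters total at most `(1 + ρ) ^ n ‖u‖²`.
The nonconstant harmonics of the periodic wave have frequencies that are nonzero multiples of `π s /
2 ≥ 1`, so they are all covered. Fejér approximation then gives `card_deviating_le`: for a kernel `H
x θ`, periodic and Lipschitz in `θ`, the mean of `H` at the random sum is close to an average over
angles that does not depend on `S`, except for polynomially many times `(1 + ρ) ^ n` sets.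

This is used twice. For a query `h` the kernel is `h x (psi θ)`, Lipschitz because `h` is Lipschitz
in the label; so one reference answer is valid for nearly all targets (`card_distinguished_le`). For
a hypothesis `g` the kernel is `(g - a) psi`, so `g` beats the constants for few targets
(`card_beatsConstants_le`). Averaging over the random seed (`card_div_two_le_of_weaklyLearns`), half
of the at least `2 ^ n / (n + 1)` targets must be covered by `q + 1` such exceptional families,
which forces `q` to be exponential.

The variance bound tests the random sum with a Fejér kernel at an angle where `psi` is far from its
mean. The well-conditioned matrices add `η` at a different coordinate in each row, as far as
coordinates allow (`diagWeights`). -/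

lemma sigmoidUnit_eq (s x : ℝ) : sigmoidUnit s x = Real.sigmoid (s * x) := by
  rw [sigmoidUnit, Real.sigmoid_def, Real.exp_neg]
  have := Real.exp_pos (s * x)
  field_simp
  ring

lemma lipschitzWith_sigmoid : LipschitzWith 1 Real.sigmoid := by
  refine lipschitzWith_of_nnnorm_deriv_le differentiable_sigmoid fun x => ?_
  rw [← NNReal.coe_le_coe, coe_nnnorm, Real.deriv_sigmoid, Real.norm_eq_abs, abs_le]
  have h0 := Real.sigmoid_nonneg x
  have h1 := Real.sigmoid_le_one x
  constructor <;> simp only [NNReal.coe_one] <;> nlinarith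

lemma sigmoid_le_exp (x : ℝ) : Real.sigmoid x ≤ Real.exp x := by
  rw [Real.sigmoid_def, Real.exp_neg]
  have := Real.exp_pos x
  rw [inv_le_comm₀ (by positivity) this]
  linarith

/-- A single bump of the wave. -/
noncomputable def bump (u : ℝ) : ℝ := Real.sigmoid (u + 1) - Real.sigmoid (u - 1)

lemma bump_nonneg (u : ℝ) : 0 ≤ bump u :=
  sub_nonneg.2 (Real.sigmoid_le (by linarith))

lemma bump_le_exp (u : ℝ) : bump u ≤ Real.exp (1 - |u|) := by
  unfold bump
  rcases le_total 0 u with h | h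
  · rw [abs_of_nonneg h]
    have h1 := Real.sigmoid_le_one (u + 1)
    have h2 := sigmoid_le_exp (1 - u)
    have h3 := Real.sigmoid_neg (u - 1)
    rw [neg_sub] at h3
    linarith
  · rw [abs_of_nonpos h]
    have h1 := Real.sigmoid_nonneg (u - 1)
    have h2 := sigmoid_le_exp (u + 1)
    rw [show 1 - -u = u + 1 by ring]
    linarith

lemma bump_eq (u : ℝ) : bump u = Real.exp u * (Real.exp 1 - Real.exp (-1)) /
    ((1 + Real.exp (u + 1)) * (1 + Real.exp (u - 1))) := by
  have h1 := sigmoidUnit_eq 1 (u + 1)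
  have h2 := sigmoidUnit_eq 1 (u - 1)
  rw [one_mul] at h1 h2
  rw [bump, ← h1, ← h2, sigmoidUnit, sigmoidUnit, one_mul, one_mul]
  have e1 := Real.exp_pos (u + 1)
  have e2 := Real.exp_pos (u - 1)
  have e3 : Real.exp (u + 1) = Real.exp u * Real.exp 1 := Real.exp_add _ _
  have e4 : Real.exp (u - 1) = Real.exp u * Real.exp (-1) := by rw [← Real.exp_add]; rfl
  field_simp
  rw [e3, e4]
  ring

/-- The ratio of the two bumps is at least `exp (-2)`, and `e² < 9`. With the pair bound below this
leaves a gap of `1/10` under the value 1, which later absorbs the perturbation of the weights. -/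
lemma bump_sub_two_ge (u : ℝ) : bump u / 9 ≤ bump (u - 2) := by
  rw [bump_eq, bump_eq]
  have e1 : Real.exp (u - 2) = Real.exp u * Real.exp (-2) := by rw [← Real.exp_add]; rfl
  have h9 : (1 : ℝ) / 9 ≤ Real.exp (-2) := by
    rw [Real.exp_neg, one_div]
    refine inv_anti₀ (Real.exp_pos _) ?_
    have : Real.exp 2 = Real.exp 1 * Real.exp 1 := by rw [← Real.exp_add]; norm_num
    rw [this]
    nlinarith [Real.exp_one_lt_d9, Real.exp_pos 1]
  have hd : 0 ≤ Real.exp 1 - Real.exp (-1) := by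
    rw [sub_nonneg]; exact Real.exp_le_exp.2 (by norm_num)
  have hm1 : Real.exp (u - 2 + 1) = Real.exp (u - 1) := by ring_nf
  have hm2 : Real.exp (u - 2 - 1) ≤ Real.exp (u + 1) := Real.exp_le_exp.2 (by linarith)
  rw [e1, hm1, div_div, div_le_div_iff₀ (by positivity) (by positivity)]
  have hu := Real.exp_pos u
  have hv := Real.exp_pos (u - 1)
  have hw := Real.exp_pos (u + 1)
  have hw' := Real.exp_pos (u - 2 - 1)
  calc _ = (Real.exp u * (Real.exp 1 - Real.exp (-1)) * (1 + Real.exp (u - 1))) *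
        (1 * (1 + Real.exp (u - 2 - 1))) := by ring
    _ ≤ (Real.exp u * (Real.exp 1 - Real.exp (-1)) * (1 + Real.exp (u - 1))) *
        ((9 * Real.exp (-2)) * (1 + Real.exp (u + 1))) := by
        gcongr
        linarith
    _ = _ := by ring

lemma sum_Icc_neg_succ (f : ℤ → ℝ) (m : ℕ) :
    ∑ k ∈ Finset.Icc (-((m + 1 : ℕ) : ℤ)) ((m + 1 : ℕ) : ℤ), f k =
      ∑ k ∈ Finset.Icc (-(m : ℤ)) (m : ℤ), f k + f (m + 1) + f (-(m + 1)) := by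
  have : Finset.Icc (-((m + 1 : ℕ) : ℤ)) ((m + 1 : ℕ) : ℤ) =
      insert (-(m + 1) : ℤ) (insert (m + 1 : ℤ) (Finset.Icc (-(m : ℤ)) (m : ℤ))) := by
    ext k
    simp only [Finset.mem_Icc, Finset.mem_insert]
    push_cast
    omega
  rw [this, Finset.sum_insert, Finset.sum_insert]
  · ring
  · simp
  · simp only [Finset.mem_insert, Finset.mem_Icc]
    omega

lemma exists_subset_Icc (F : Finset ℤ) : ∃ m : ℕ, F ⊆ Finset.Icc (-(m : ℤ)) (m : ℤ) := by
  refine ⟨F.sup Int.natAbs, fun k hk => ?_⟩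
  have : k.natAbs ≤ F.sup Int.natAbs := Finset.le_sup (f := Int.natAbs) hk
  rw [Finset.mem_Icc]
  omega

/-- The bumps centred at `4k` and `4k + 2` interleave, so over `|k| ≤ m` the sum telescopes to a
difference of two sigmoid values. Nonnegativity reduces a general `F` to this case. -/
lemma sum_bump_pair_le_one (F : Finset ℤ) (u : ℝ) :
    ∑ k ∈ F, bump (u - 4 * k) + ∑ k ∈ F, bump (u - 2 - 4 * k) ≤ 1 := by
  have hnn : ∀ k : ℤ, 0 ≤ bump (u - 4 * k) + bump (u - 2 - 4 * k) := fun k =>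
    add_nonneg (bump_nonneg _) (bump_nonneg _)
  obtain ⟨m, hm⟩ := exists_subset_Icc F
  rw [← Finset.sum_add_distrib]
  refine (Finset.sum_le_sum_of_subset_of_nonneg hm fun k _ _ => hnn k).trans ?_
  have key : ∀ m : ℕ, ∑ k ∈ Finset.Icc (-(m : ℤ)) (m : ℤ),
      (bump (u - 4 * k) + bump (u - 2 - 4 * k)) =
      Real.sigmoid (u + 4 * m + 1) - Real.sigmoid (u - 4 * m - 3) := by
    intro m
    induction m with
    | zero =>
      simp [bump]
      ring_nf
    | succ m ih =>
      rw [sum_Icc_neg_succ, ih]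
      simp only [bump]
      push_cast
      ring_nf
  rw [key]
  linarith [Real.sigmoid_le_one (u + 4 * m + 1), Real.sigmoid_nonneg (u - 4 * m - 3)]

lemma sum_bump_nonneg (F : Finset ℤ) (u : ℝ) : 0 ≤ ∑ k ∈ F, bump (u - 4 * k) :=
  Finset.sum_nonneg fun _ _ => bump_nonneg _

lemma sum_bump_le (F : Finset ℤ) (u : ℝ) : ∑ k ∈ F, bump (u - 4 * k) ≤ 9 / 10 := by
  have h1 := sum_bump_pair_le_one F u
  have h2 : (∑ k ∈ F, bump (u - 4 * k)) / 9 ≤ ∑ k ∈ F, bump (u - 2 - 4 * k) := by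
    rw [Finset.sum_div]
    refine Finset.sum_le_sum fun k _ => ?_
    have := bump_sub_two_ge (u - 4 * k)
    rwa [show u - 4 * (k : ℝ) - 2 = u - 2 - 4 * k by ring] at this
  linarith

lemma hasDerivAt_bump (u : ℝ) : HasDerivAt bump
    (Real.sigmoid (u + 1) * (1 - Real.sigmoid (u + 1)) -
      Real.sigmoid (u - 1) * (1 - Real.sigmoid (u - 1))) u := by
  have h1 := (Real.hasDerivAt_sigmoid (u + 1)).comp_add_const u 1
  have h2 := (Real.hasDerivAt_sigmoid (u - 1)).comp_sub_const u 1
  exact h1.sub h2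

/-- Since `σ' = σ (1 - σ)`, a bump `a - b` has derivative `(a - b) (1 - a - b)`, which is bounded by
the bump itself. The bound on the sum of bumps thus bounds its derivative. -/
lemma lipschitzWith_sum_bump (F : Finset ℤ) :
    LipschitzWith 1 fun u : ℝ => ∑ k ∈ F, bump (u - 4 * k) := by
  have hd : ∀ u : ℝ, HasDerivAt (fun u : ℝ => ∑ k ∈ F, bump (u - 4 * k)) (∑ k ∈ F,
      (Real.sigmoid (u - 4 * k + 1) * (1 - Real.sigmoid (u - 4 * k + 1)) -
      Real.sigmoid (u - 4 * k - 1) * (1 - Real.sigmoid (u - 4 * k - 1)))) u := fun u =>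
    HasDerivAt.fun_sum fun k _ => (hasDerivAt_bump (u - 4 * k)).comp_sub_const u (4 * k : ℝ)
  refine lipschitzWith_of_nnnorm_deriv_le (fun u => (hd u).differentiableAt) fun u => ?_
  rw [← NNReal.coe_le_coe, coe_nnnorm, (hd u).deriv, NNReal.coe_one]
  refine (norm_sum_le _ _).trans (le_trans ?_ ((sum_bump_le F u).trans (by norm_num)))
  refine Finset.sum_le_sum fun k _ => ?_
  have h0 := bump_nonneg (u - 4 * k)
  rw [bump] at h0 ⊢
  set a := Real.sigmoid (u - 4 * k + 1)
  set b := Real.sigmoid (u - 4 * k - 1)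
  have ha0 : 0 ≤ a := Real.sigmoid_nonneg _
  have ha1 : a ≤ 1 := Real.sigmoid_le_one _
  have hb0 : 0 ≤ b := Real.sigmoid_nonneg _
  have hb1 : b ≤ 1 := Real.sigmoid_le_one _
  rw [Real.norm_eq_abs, abs_le]
  constructor <;> nlinarith

/-- The periodic limit of the waves of sharpness `1`. -/
noncomputable def psi (u : ℝ) : ℝ := ∑' k : ℤ, bump (u - 4 * k)

lemma summable_exp_neg_two_abs : Summable fun k : ℤ => Real.exp (-2 * |(k : ℝ)|) := by
  have h : Summable fun n : ℕ => Real.exp (-2 * (n : ℝ)) := by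
    have := Real.summable_exp_nat_mul_iff (a := -2)
    refine (this.2 (by norm_num)).congr fun n => by ring_nf
  refine Summable.of_nat_of_neg ?_ ?_
  · simpa using h
  · simpa using h

lemma bump_shift_le (u : ℝ) (k : ℤ) :
    bump (u - 4 * k) ≤ Real.exp (1 + |u|) * Real.exp (-4 * |(k : ℝ)|) := by
  rw [← Real.exp_add]
  refine (bump_le_exp _).trans (Real.exp_le_exp.2 ?_)
  have h := abs_sub_abs_le_abs_sub (4 * (k : ℝ)) u
  rw [abs_sub_comm, abs_mul, abs_of_pos (by norm_num : (0 : ℝ) < 4)] at h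
  linarith

lemma summable_bump (u : ℝ) : Summable fun k : ℤ => bump (u - 4 * k) := by
  refine Summable.of_nonneg_of_le (fun k => bump_nonneg _) (fun k => (bump_shift_le u k).trans ?_)
    (summable_exp_neg_two_abs.mul_left (Real.exp (1 + |u|)))
  gcongr
  linarith [abs_nonneg (k : ℝ)]

lemma hasSum_bump (u : ℝ) : HasSum (fun k : ℤ => bump (u - 4 * k)) (psi u) :=
  (summable_bump u).hasSum

lemma psi_add_four (u : ℝ) : psi (u + 4) = psi u := by
  unfold psi
  rw [← (Equiv.addRight (1 : ℤ)).tsum_eq]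
  refine tsum_congr fun k => ?_
  simp only [Equiv.coe_addRight]
  push_cast
  ring_nf

lemma psi_nonneg (u : ℝ) : 0 ≤ psi u := tsum_nonneg fun _ => bump_nonneg _

lemma psi_le (u : ℝ) : psi u ≤ 9 / 10 :=
  (summable_bump u).tsum_le_of_sum_le fun F => sum_bump_le F u

lemma psi_le_one (u : ℝ) : psi u ≤ 1 := (psi_le u).trans (by norm_num)

lemma lipschitzWith_psi : LipschitzWith 1 psi := by
  refine LipschitzWith.of_dist_le_mul fun u v => ?_
  have h := (hasSum_bump u).sub (hasSum_bump v)
  rw [Real.dist_eq]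
  refine le_of_tendsto h.abs (Filter.Eventually.of_forall fun F => ?_)
  have := (lipschitzWith_sum_bump F).dist_le_mul u v
  rwa [Real.dist_eq, ← Finset.sum_sub_distrib] at this

lemma abs_psi_sub_psi_le (u v : ℝ) : |psi u - psi v| ≤ |u - v| := by
  simpa [Real.dist_eq] using lipschitzWith_psi.dist_le_mul u v

lemma psi_pair_le_one (u : ℝ) : psi u + psi (u - 2) ≤ 1 := by
  refine le_of_tendsto ((hasSum_bump u).add (hasSum_bump (u - 2)))
    (Filter.Eventually.of_forall fun F => ?_)
  rw [Finset.sum_add_distrib]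
  exact sum_bump_pair_le_one F u

/-- The three central bumps suffice: they sum to `2σ(1) - 1 + 2(σ(5) - σ(3)) ≈ 0.54`. Any value
above `1/2` shows, through the pair bound, that `psi` is not constant. -/
lemma psi_zero_ge : (53 : ℝ) / 100 ≤ psi 0 := by
  refine le_trans ?_ ((summable_bump 0).sum_le_tsum {-1, 0, 1} fun k _ => bump_nonneg _)
  rw [Finset.sum_insert (by decide), Finset.sum_insert (by decide), Finset.sum_singleton]
  simp only [bump]
  norm_num
  have h1 := Real.sigmoid_neg 1
  have h3 := Real.sigmoid_neg 3
  have h5 := Real.sigmoid_neg 5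
  have e1 := Real.exp_one_gt_d9
  have e2 := Real.exp_one_lt_d9
  have p3 : Real.exp 3 = Real.exp 1 ^ 3 := by rw [← Real.exp_nat_mul]; norm_num
  have p5 : Real.exp 5 = Real.exp 1 ^ 5 := by rw [← Real.exp_nat_mul]; norm_num
  have b3 : Real.exp 3 ≤ 20.1 := by
    rw [p3]
    calc Real.exp 1 ^ 3 ≤ (2.7182818286 : ℝ) ^ 3 := by gcongr
      _ ≤ _ := by norm_num
  have b5 : 148 ≤ Real.exp 5 := by
    rw [p5]
    calc (148 : ℝ) ≤ (2.7182818283 : ℝ) ^ 5 := by norm_num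
      _ ≤ _ := by gcongr
  have s1 : (0.73 : ℝ) ≤ Real.sigmoid 1 := by
    rw [Real.sigmoid_def, Real.exp_neg, le_inv_comm₀ (by norm_num) (by positivity)]
    have : (Real.exp 1)⁻¹ ≤ (2.71 : ℝ)⁻¹ := inv_anti₀ (by norm_num) (by linarith)
    norm_num at this ⊢
    linarith
  have s3 : Real.sigmoid 3 ≤ 0.953 := by
    rw [Real.sigmoid_def, Real.exp_neg, inv_le_comm₀ (by positivity) (by norm_num)]
    have : (20.1 : ℝ)⁻¹ ≤ (Real.exp 3)⁻¹ := inv_anti₀ (by positivity) (by linarith)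
    norm_num at this ⊢
    linarith
  have s5 : (0.993 : ℝ) ≤ Real.sigmoid 5 := by
    rw [Real.sigmoid_def, Real.exp_neg, le_inv_comm₀ (by norm_num) (by positivity)]
    have : (Real.exp 5)⁻¹ ≤ (148 : ℝ)⁻¹ := inv_anti₀ (by norm_num) (by linarith)
    norm_num at this ⊢
    linarith
  linarith

lemma psi_two_le : psi 2 ≤ (47 : ℝ) / 100 := by
  have h1 := psi_pair_le_one 0
  have h2 := psi_add_four (0 - 2)
  norm_num at h1 h2
  linarith [psi_zero_ge]

/-! ### Finite waves and networks -/

lemma wave_eq {s : ℝ} (hs : s ≠ 0) (m : ℕ) (x : ℝ) :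
    wave s m x = ∑ k ∈ Finset.Icc (-(m : ℤ)) (m : ℤ), bump (s * x - 4 * k) := by
  have hc : ((2 : ℝ) * m + 1) = ∑ _k ∈ Finset.Icc (-(m : ℤ)) (m : ℤ), (1 : ℝ) := by
    rw [Finset.sum_const, Int.card_Icc, nsmul_eq_mul, mul_one]
    have : ((m : ℤ) + 1 - -(m : ℤ)).toNat = 2 * m + 1 := by omega
    rw [this]
    push_cast
    ring
  rw [wave, hc, neg_add_eq_sub, ← Finset.sum_sub_distrib]
  refine Finset.sum_congr rfl fun k _ => ?_
  rw [sigmoidUnit_eq, sigmoidUnit_eq, bump]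
  have h1 : s * (x - (4 * k - 1) / s) = s * x - 4 * k + 1 := by field_simp; ring
  have h2 : s * ((4 * k + 1) / s - x) = -(s * x - 4 * k - 1) := by field_simp; ring
  rw [h1, h2, Real.sigmoid_neg]
  ring

lemma wave_nonneg {s : ℝ} (hs : s ≠ 0) (m : ℕ) (x : ℝ) : 0 ≤ wave s m x := by
  rw [wave_eq hs]; exact sum_bump_nonneg _ _

lemma wave_le {s : ℝ} (hs : s ≠ 0) (m : ℕ) (x : ℝ) : wave s m x ≤ 9 / 10 := by
  rw [wave_eq hs]; exact sum_bump_le _ _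

lemma wave_le_psi {s : ℝ} (hs : s ≠ 0) (m : ℕ) (x : ℝ) : wave s m x ≤ psi (s * x) := by
  rw [wave_eq hs]; exact (summable_bump _).sum_le_tsum _ fun k _ => bump_nonneg _

lemma psi_sub_wave_le_one {s : ℝ} (hs : s ≠ 0) (m : ℕ) (x : ℝ) :
    psi (s * x) - wave s m x ≤ 1 := by
  linarith [psi_le_one (s * x), wave_nonneg hs m x]

/-- The omitted bumps have `|k| > m` and size at most `exp (1 + |u| - 4 |k|)`. Half of this decay
produces `exp (-2 m)`; the other half sums to a constant. -/
lemma exists_psi_sub_wave_le : ∃ C : ℝ, 1 ≤ C ∧ ∀ (s : ℝ), s ≠ 0 → ∀ (m : ℕ) (x : ℝ),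
    psi (s * x) - wave s m x ≤ C * Real.exp (|s * x| - 2 * m) := by
  set Z : ℝ := ∑' k : ℤ, Real.exp (-2 * |(k : ℝ)|) with hZ
  have hZ1 : 1 ≤ Z := by
    have := summable_exp_neg_two_abs.le_tsum 0 fun k _ => (Real.exp_pos _).le
    simpa [hZ] using this
  refine ⟨Real.exp 1 * Z, one_le_mul_of_one_le_of_one_le (Real.one_le_exp zero_le_one) hZ1,
    fun s hs m x => ?_⟩
  rw [wave_eq hs, psi]
  set u := s * x
  set F := Finset.Icc (-(m : ℤ)) (m : ℤ)
  have h1 := (summable_bump u).sum_add_tsum_subtype_compl F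
  have h2 : ∑' k : {k : ℤ // k ∉ F}, bump (u - 4 * (k : ℤ)) ≤
      ∑' k : {k : ℤ // k ∉ F},
        Real.exp (1 + |u| - 2 * m) * Real.exp (-2 * |((k : ℤ) : ℝ)|) := by
    refine ((summable_bump u).subtype _).tsum_le_tsum ?_
      ((summable_exp_neg_two_abs.subtype _).mul_left _)
    rintro ⟨k, hk⟩
    refine (bump_shift_le u k).trans ?_
    rw [← Real.exp_add, ← Real.exp_add]
    refine Real.exp_le_exp.2 ?_
    have : (m : ℝ) ≤ |(k : ℝ)| := by
      have : (m : ℤ) ≤ |k| := by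
        by_contra hc
        refine hk (Finset.mem_Icc.2 (abs_le.1 (not_le.1 hc).le))
      exact_mod_cast this
    simp only
    linarith
  have h3 : ∑' k : {k : ℤ // k ∉ F},
        Real.exp (1 + |u| - 2 * m) * Real.exp (-2 * |((k : ℤ) : ℝ)|) ≤
        Real.exp (1 + |u| - 2 * m) * Z := by
    rw [tsum_mul_left]
    refine mul_le_mul_of_nonneg_left ?_ (Real.exp_pos _).le
    exact summable_exp_neg_two_abs.tsum_subtype_le _ _ (fun k => (Real.exp_pos _).le)
  have h4 : Real.exp 1 * Z * Real.exp (|u| - 2 * m) = Real.exp (1 + |u| - 2 * m) * Z := by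
    rw [show 1 + |u| - 2 * (m : ℝ) = 1 + (|u| - 2 * m) by ring, Real.exp_add]
    ring
  rw [h4]
  linarith

lemma card_waveUnit (m : ℕ) : Fintype.card (WaveUnit m) = 2 * (2 * m + 1) := by
  rw [Fintype.card_prod, Fintype.card_coe, Int.card_Icc, Fintype.card_bool]
  omega

lemma waveNet_waveWeights {n : ℕ} (s : ℝ) (m : ℕ) (S : Finset (Fin n)) (x : Fin n → ℝ) :
    waveNet s m (waveWeights m S) x = sWave s m S x := by
  rw [waveNet, oneHidden, sWave, wave, Fintype.sum_prod_type]
  congr 1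
  rw [← Finset.sum_coe_sort (Finset.Icc (-(m : ℤ)) (m : ℤ))]
  refine Finset.sum_congr rfl fun k _ => ?_
  rw [Fintype.sum_bool]
  simp only [waveWeights, waveBias, Matrix.mulVec, dotProduct, Matrix.of_apply, ite_mul, zero_mul,
    Finset.sum_ite_mem, Finset.univ_inter, if_true]
  simp only [one_mul, Bool.false_eq_true, if_false, neg_mul, Finset.sum_neg_distrib]
  rw [← sub_eq_add_neg, neg_add_eq_sub]

lemma abs_waveNet_sub_le {n : ℕ} {s η : ℝ} (hs : 0 ≤ s) (m : ℕ)
    (W V : Matrix (WaveUnit m) (Fin n) ℝ) (hW : ∀ j i, |W j i - V j i| ≤ η) (x : Fin n → ℝ) :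
    |waveNet s m W x - waveNet s m V x| ≤
      Fintype.card (WaveUnit m) * (s * (η * ∑ i, |x i|)) := by
  rw [waveNet, waveNet, oneHidden, oneHidden, add_sub_add_left_eq_sub, ← Finset.sum_sub_distrib]
  refine (Finset.abs_sum_le_sum_abs _ _).trans ?_
  rw [← nsmul_eq_mul]
  refine Finset.sum_le_card_nsmul _ _ _ fun j _ => ?_
  rw [sigmoidUnit_eq, sigmoidUnit_eq]
  have h := lipschitzWith_sigmoid.dist_le_mul (s * (W.mulVec x j + waveBias s m j))
    (s * (V.mulVec x j + waveBias s m j))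
  rw [Real.dist_eq, Real.dist_eq, NNReal.coe_one, one_mul] at h
  refine h.trans ?_
  rw [← mul_sub, abs_mul, abs_of_nonneg hs]
  refine mul_le_mul_of_nonneg_left ?_ hs
  rw [add_sub_add_right_eq_sub, Matrix.mulVec, Matrix.mulVec, dotProduct, dotProduct,
    ← Finset.sum_sub_distrib, Finset.mul_sum]
  refine (Finset.abs_sum_le_sum_abs _ _).trans (Finset.sum_le_sum fun i _ => ?_)
  rw [← sub_mul, abs_mul]
  exact mul_le_mul_of_nonneg_right (hW j i) (abs_nonneg _)

lemma continuous_waveNet {n : ℕ} (s : ℝ) (m : ℕ) (W : Matrix (WaveUnit m) (Fin n) ℝ) :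
    Continuous (waveNet s m W) := by
  unfold waveNet oneHidden
  simp only [sigmoidUnit_eq]
  refine continuous_const.add (continuous_finsetSum _ fun j _ => ?_)
  refine continuous_sigmoid.comp (continuous_const.mul (Continuous.add ?_ continuous_const))
  unfold Matrix.mulVec dotProduct
  fun_prop

end SQWave

namespace SQWave

/-! ### Logconcave distributions of unit variance -/

/-- The density of a logconcave probability measure on the line. -/
structure IsLogConcaveDensity (p : ℝ → ℝ) (D : Measure ℝ) : Prop where
  measurable : Measurable p
  nonneg : ∀ x, 0 ≤ p x
  logconcave : ∀ x y a b : ℝ, 0 < a → 0 < b → a + b = 1 → p x ^ a * p y ^ b ≤ p (a * x + b * y)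
  eq_withDensity : D = (volume : Measure ℝ).withDensity fun x => ENNReal.ofReal (p x)

lemma IsLogConcave.exists_density {D : Measure ℝ} (h : IsLogConcave D) :
    ∃ p, IsLogConcaveDensity p D := by
  obtain ⟨p, h1, h2, h3, h4⟩ := h
  exact ⟨p, h1, h2, h3, h4⟩

namespace IsLogConcaveDensity

variable {p : ℝ → ℝ} {D : Measure ℝ}

lemma apply_eq (h : IsLogConcaveDensity p D) {s : Set ℝ} (hs : MeasurableSet s) :
    D s = ∫⁻ x in s, ENNReal.ofReal (p x) := by
  rw [h.eq_withDensity, withDensity_apply _ hs]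

lemma integral_eq (h : IsLogConcaveDensity p D) (f : ℝ → ℝ) :
    ∫ x, f x ∂D = ∫ x, p x * f x := by
  rw [h.eq_withDensity, integral_withDensity_eq_integral_toReal_smul
    h.measurable.ennreal_ofReal (Filter.Eventually.of_forall fun _ => ENNReal.ofReal_lt_top)]
  refine integral_congr_ae (Filter.Eventually.of_forall fun x => ?_)
  simp only [smul_eq_mul, ENNReal.toReal_ofReal (h.nonneg x)]

lemma integrable_iff (h : IsLogConcaveDensity p D) (f : ℝ → ℝ) :
    Integrable f D ↔ Integrable fun x => p x * f x := by
  rw [h.eq_withDensity, integrable_withDensity_iff_integrable_smul'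
    h.measurable.ennreal_ofReal (Filter.Eventually.of_forall fun _ => ENNReal.ofReal_lt_top)]
  refine integrable_congr (Filter.Eventually.of_forall fun x => ?_)
  simp only [smul_eq_mul, ENNReal.toReal_ofReal (h.nonneg x)]

lemma integrable_density [IsProbabilityMeasure D] (h : IsLogConcaveDensity p D) :
    Integrable p := by
  have := (h.integrable_iff fun _ => 1).1 (integrable_const _)
  simpa using this

lemma integral_density [IsProbabilityMeasure D] (h : IsLogConcaveDensity p D) :
    ∫ x, p x = 1 := by
  have := h.integral_eq fun _ => 1
  simpa using this.symm

/-- A logconcave density decays exponentially away from any point, at a rate proportional to its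
value there. -/
lemma le_mul_exp [IsProbabilityMeasure D] (h : IsLogConcaveDensity p D) {z y : ℝ} (hz : 0 < p z)
    (hy : 6 / p z ≤ |y|) : p (z + y) ≤ p z * Real.exp (-(|y| * p z / 6)) := by
  -- Otherwise log-interpolation between `z` and `z + y` keeps `p ≥ M / 3` on the initial part `t <
  -- 1 / r` of the segment. That part has length `6 / M`, hence mass at least 2.
  by_contra! hc
  set M := p z with hM
  set r := |y| * M / 6 with hr
  have hr1 : 1 ≤ r := by
    rw [hr, le_div_iff₀ (by norm_num)]
    rw [div_le_iff₀ hz] at hy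
    linarith
  have hy0 : 0 < |y| := lt_of_lt_of_le (by positivity) hy
  have hyr : |y| / r = 6 / M := by
    rw [hr]; field_simp
  have key : ∀ t : ℝ, 0 < t → t < 1 / r → M / 3 ≤ p (z + t * y) := by
    intro t ht0 ht1
    have hrt : r * t < 1 := by
      rw [lt_div_iff₀ (by linarith)] at ht1; linarith
    have ht : t < 1 := by nlinarith
    have h1 := h.logconcave (z + y) z t (1 - t) ht0 (by linarith) (by ring)
    rw [show t * (z + y) + (1 - t) * z = z + t * y by ring] at h1
    refine le_trans ?_ h1
    have h2 : (M * Real.exp (-r)) ^ t ≤ p (z + y) ^ t :=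
      Real.rpow_le_rpow (by positivity) hc.le ht0.le
    have h3 : (M * Real.exp (-r)) ^ t * M ^ (1 - t) = M * Real.exp (-(r * t)) := by
      rw [Real.mul_rpow hz.le (Real.exp_pos _).le, ← Real.exp_mul, mul_right_comm,
        ← Real.rpow_add hz, add_sub_cancel, Real.rpow_one, neg_mul]
    have h4 : (1 : ℝ) / 3 ≤ Real.exp (-(r * t)) := by
      have e : Real.exp (-1) ≤ Real.exp (-(r * t)) := Real.exp_le_exp.2 (by linarith)
      have e3 : (1 : ℝ) / 3 ≤ Real.exp (-1) := by
        rw [Real.exp_neg, one_div]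
        exact inv_anti₀ (Real.exp_pos _) (by linarith [Real.exp_one_lt_d9])
      linarith
    calc M / 3 = M * (1 / 3) := by ring
      _ ≤ M * Real.exp (-(r * t)) := by gcongr
      _ = _ := h3.symm
      _ ≤ p (z + y) ^ t * M ^ (1 - t) := by gcongr
  have hmass : ∀ a b : ℝ, b - a = 6 / M → (∀ x ∈ Set.Ioo a b, M / 3 ≤ p x) → False := by
    intro a b hab hp
    have h1 : ∫ x in Set.Ioo a b, M / 3 ≤ ∫ x in Set.Ioo a b, p x :=
      setIntegral_mono_on (integrableOn_const (by simp)) h.integrable_density.integrableOn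
        measurableSet_Ioo hp
    have h2 : ∫ x in Set.Ioo a b, p x ≤ ∫ x, p x :=
      setIntegral_le_integral h.integrable_density (Filter.Eventually.of_forall h.nonneg)
    rw [h.integral_density] at h2
    rw [setIntegral_const, measureReal_def, Real.volume_Ioo, hab,
      ENNReal.toReal_ofReal (by positivity), smul_eq_mul] at h1
    have : 6 / M * (M / 3) = 2 := by field_simp; norm_num
    linarith
  rcases le_total 0 y with hy' | hy'
  · rw [abs_of_nonneg hy'] at hyr hy0
    refine hmass z (z + 6 / M) (by ring) fun x hx => ?_
    have := key ((x - z) / y) (div_pos (by linarith [hx.1]) hy0) (by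
      rw [div_lt_div_iff₀ hy0 (by linarith)]
      have : x - z < y / r := by rw [hyr]; linarith [hx.2]
      rw [lt_div_iff₀ (by linarith)] at this
      linarith)
    rwa [div_mul_cancel₀ _ hy0.ne', add_sub_cancel] at this
  · rw [abs_of_nonpos hy'] at hyr hy0
    refine hmass (z - 6 / M) z (by ring) fun x hx => ?_
    have := key ((z - x) / (-y)) (div_pos (by linarith [hx.2]) hy0) (by
      rw [div_lt_div_iff₀ hy0 (by linarith)]
      have : z - x < -y / r := by rw [hyr]; linarith [hx.1]
      rw [lt_div_iff₀ (by linarith)] at this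
      linarith)
    rwa [show z + (z - x) / -y * y = x by
      have : y ≠ 0 := by rintro rfl; simp at hy0
      field_simp
      ring] at this

end IsLogConcaveDensity

lemma integral_exp_neg_mul_abs_sub {b : ℝ} (hb : 0 < b) (z : ℝ) :
    ∫ x : ℝ, Real.exp (-(b * |x - z|)) = 2 / b := by
  rw [integral_sub_right_eq_self (fun x : ℝ => Real.exp (-(b * |x|))) z]
  have h1 := integral_comp_abs (f := fun x : ℝ => Real.exp (-(b * x)))
  rw [h1]
  have h2 := integral_exp_mul_Ioi (a := -b) (by linarith) 0
  simp only [neg_mul] at h2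
  rw [h2]
  simp
  field_simp

lemma integrable_exp_neg_mul_abs_sub {b : ℝ} (hb : 0 < b) (z : ℝ) :
    Integrable fun x : ℝ => Real.exp (-(b * |x - z|)) :=
  Integrable.of_integral_ne_zero (by rw [integral_exp_neg_mul_abs_sub hb]; positivity)

lemma sq_le_mul_exp {b : ℝ} (hb : 0 < b) (v : ℝ) :
    v ^ 2 ≤ 8 / b ^ 2 * Real.exp (b / 2 * |v|) := by
  have h := Real.quadratic_le_exp_of_nonneg (x := b / 2 * |v|) (by positivity)
  have h2 : (b / 2 * |v|) ^ 2 / 2 ≤ Real.exp (b / 2 * |v|) := by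
    have : 0 ≤ b / 2 * |v| := by positivity
    linarith
  rw [mul_pow, sq_abs] at h2
  rw [div_mul_eq_mul_div, le_div_iff₀ (by positivity)]
  nlinarith

lemma memLp_id_of_variance_eq_one {D : Measure ℝ} [IsProbabilityMeasure D]
    (hv : variance (fun x : ℝ => x) D = 1) : MemLp (fun x : ℝ => x) 2 D := by
  rw [← evariance_lt_top_iff_memLp (by fun_prop), lt_top_iff_ne_top]
  intro h
  rw [variance, h] at hv
  simp at hv

/-! ### Consequences of unit variance: bounded density, exponential tails, a fat interval -/

namespace IsLogConcaveDensity

variable {p : ℝ → ℝ} {D : Measure ℝ} [IsProbabilityMeasure D]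

/-- A high peak forces concentration. The decay away from `z` bounds the second moment about `z` by
`6948 / p(z)²`; that moment is at least the variance, and `84² > 6948`. -/
lemma le_of_variance_eq_one (h : IsLogConcaveDensity p D)
    (hv : variance (fun x : ℝ => x) D = 1) (z : ℝ) : p z ≤ 84 := by
  rcases (h.nonneg z).eq_or_lt with hz | hz
  · rw [← hz]; norm_num
  set M := p z with hM
  have hL := memLp_id_of_variance_eq_one hv
  have h1 : (1 : ℝ) ≤ ∫ x, (x - z) ^ 2 ∂D := by
    have h2 := variance_sub_const (μ := D) (X := fun x : ℝ => x) (by fun_prop) z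
    have h3 := variance_le_expectation_sq (μ := D) (X := fun x : ℝ => x - z) (by fun_prop)
    rw [h2, hv] at h3
    simpa using h3
  set b := M / 6 with hb
  have hb0 : 0 < b := by positivity
  have h2 : ∫ x, (x - z) ^ 2 ∂D ≤
      ∫ x, ((6 / M) ^ 2 * p x + M * (8 / b ^ 2) * Real.exp (-(b / 2 * |x - z|))) := by
    rw [h.integral_eq]
    refine integral_mono_of_nonneg
      (Filter.Eventually.of_forall fun x => mul_nonneg (h.nonneg x) (sq_nonneg _))
      ((h.integrable_density.const_mul _).add
        ((integrable_exp_neg_mul_abs_sub (by positivity) z).const_mul _))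
      (Filter.Eventually.of_forall fun x => ?_)
    simp only
    have hp := h.nonneg x
    rcases le_total (6 / M) |x - z| with hx | hx
    · have h3 := h.le_mul_exp hz hx
      rw [add_sub_cancel] at h3
      have h4 := sq_le_mul_exp hb0 (x - z)
      have h5 : p x * (x - z) ^ 2 ≤ (M * Real.exp (-(|x - z| * M / 6))) *
          (8 / b ^ 2 * Real.exp (b / 2 * |x - z|)) := by gcongr
      have h6 : (M * Real.exp (-(|x - z| * M / 6))) *
          (8 / b ^ 2 * Real.exp (b / 2 * |x - z|)) =
          M * (8 / b ^ 2) * Real.exp (-(b / 2 * |x - z|)) := by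
        have : Real.exp (-(|x - z| * M / 6)) * Real.exp (b / 2 * |x - z|) =
            Real.exp (-(b / 2 * |x - z|)) := by
          rw [← Real.exp_add, hb]; ring_nf
        rw [← this]; ring
      have : 0 ≤ (6 / M) ^ 2 * p x := by positivity
      linarith
    · have h3 : (x - z) ^ 2 ≤ (6 / M) ^ 2 := by
        rw [← sq_abs]; gcongr
      have h4 : p x * (x - z) ^ 2 ≤ p x * (6 / M) ^ 2 := by gcongr
      have : 0 ≤ M * (8 / b ^ 2) * Real.exp (-(b / 2 * |x - z|)) := by positivity
      linarith
  rw [integral_add (h.integrable_density.const_mul _)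
    ((integrable_exp_neg_mul_abs_sub (by positivity) z).const_mul _), integral_const_mul,
    integral_const_mul, h.integral_density, integral_exp_neg_mul_abs_sub (by positivity)] at h2
  have h3 : (6 / M) ^ 2 * 1 + M * (8 / b ^ 2) * (2 / (b / 2)) = 6948 / M ^ 2 := by
    rw [hb]; field_simp; norm_num
  rw [h3] at h2
  have h4 := h1.trans h2
  rw [le_div_iff₀ (by positivity)] at h4
  nlinarith

lemma measureReal_Ioo_ge (hv : variance (fun x : ℝ => x) D = 1) :
    3 / 4 ≤ D.real (Set.Ioo (∫ x, x ∂D - 2) (∫ x, x ∂D + 2)) := by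
  have hL := memLp_id_of_variance_eq_one hv
  have h1 := meas_ge_le_variance_div_sq hL (c := 2) (by norm_num)
  rw [hv] at h1
  set μ := ∫ x, x ∂D
  have h2 : {ω : ℝ | 2 ≤ |ω - μ|} = (Set.Ioo (μ - 2) (μ + 2))ᶜ := by
    ext x
    simp only [Set.mem_ofPred_eq, Set.mem_compl_iff, Set.mem_Ioo]
    rw [← not_iff_not, not_le, not_not, abs_lt]
    constructor <;> rintro ⟨h1, h2⟩ <;> constructor <;> linarith
  rw [h2] at h1
  have h3 := prob_add_prob_compl (μ := D) (measurableSet_Ioo (a := μ - 2) (b := μ + 2))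
  have h4 : D.real (Set.Ioo (μ - 2) (μ + 2))ᶜ ≤ 1 / 4 := by
    rw [measureReal_def]
    refine ENNReal.toReal_le_of_le_ofReal (by norm_num) (h1.trans (le_of_eq ?_))
    norm_num
  rw [measureReal_compl measurableSet_Ioo] at h4
  simp at h4
  linarith

lemma measureReal_le_mul (h : IsLogConcaveDensity p D) {c : ℝ} {s : Set ℝ}
    (hs : MeasurableSet s) (hvol : volume s ≠ ∞) (hc : ∀ x ∈ s, p x ≤ c) :
    D.real s ≤ c * volume.real s := by
  have h1 : D.real s = ∫ x in s, p x := by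
    rw [measureReal_def, h.apply_eq hs, ← ofReal_integral_eq_lintegral_ofReal
      h.integrable_density.integrableOn (Filter.Eventually.of_forall h.nonneg),
      ENNReal.toReal_ofReal (integral_nonneg h.nonneg)]
  rw [h1]
  have h2 : ∫ x in s, p x ≤ ∫ x in s, c :=
    setIntegral_mono_on h.integrable_density.integrableOn (integrableOn_const hvol) hs hc
  rwa [setIntegral_const, smul_eq_mul, mul_comm] at h2

lemma exists_large_value (h : IsLogConcaveDensity p D)
    (hv : variance (fun x : ℝ => x) D = 1) :
    ∃ z, |z - ∫ x, x ∂D| ≤ 2 ∧ 1 / 8 ≤ p z := by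
  by_contra! hc
  have h1 := measureReal_Ioo_ge hv
  set μ := ∫ x, x ∂D
  have h2 := h.measureReal_le_mul (c := 1 / 8) (s := Set.Ioo (μ - 2) (μ + 2)) measurableSet_Ioo
    (by simp) fun x hx => (hc x (abs_le.2 ⟨by linarith [hx.1], by linarith [hx.2]⟩)).le
  rw [measureReal_def (volume), Real.volume_Ioo, ENNReal.toReal_ofReal (by linarith)] at h2
  linarith

/-- Decay is started from a point near the mean where the density is at least `1/8`, which gives the
rate `1/48`. Two factors 3, each replacing `e`, pay for the region without decay and for recentring
at the mean; `756 = 84 · 3 · 3`. -/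
lemma le_exp_neg_abs_sub (h : IsLogConcaveDensity p D)
    (hv : variance (fun x : ℝ => x) D = 1) (x : ℝ) :
    p x ≤ 756 * Real.exp (-(1 / 48 * |x - ∫ x, x ∂D|)) := by
  obtain ⟨z, hz1, hz2⟩ := h.exists_large_value hv
  set μ := ∫ x, x ∂D
  have hpz : 0 < p z := by linarith
  have hb := h.le_of_variance_eq_one hv
  have h1 : p x ≤ 84 * 3 * Real.exp (-(1 / 48 * |x - z|)) := by
    rcases le_total (6 / p z) |x - z| with hx | hx
    · have h3 := h.le_mul_exp hpz hx
      rw [add_sub_cancel] at h3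
      have h4 : Real.exp (-(|x - z| * p z / 6)) ≤ Real.exp (-(1 / 48 * |x - z|)) :=
        Real.exp_le_exp.2 (by nlinarith [abs_nonneg (x - z)])
      calc p x ≤ _ := h3
        _ ≤ (84 * 3) * Real.exp (-(1 / 48 * |x - z|)) := by
          gcongr
          linarith [hb z]
    · have h3 : |x - z| ≤ 48 := by
        refine hx.trans ?_
        rw [div_le_iff₀ hpz]
        linarith
      have h4 : Real.exp (-1) ≤ Real.exp (-(1 / 48 * |x - z|)) :=
        Real.exp_le_exp.2 (by linarith)
      have e3 : (1 : ℝ) / 3 ≤ Real.exp (-1) := by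
        rw [Real.exp_neg, one_div]
        exact inv_anti₀ (Real.exp_pos _) (by linarith [Real.exp_one_lt_d9])
      linarith [hb x]
  have h2 : |x - μ| ≤ |x - z| + 2 := (abs_sub_le x z μ).trans (by linarith)
  have h3 : Real.exp (-(1 / 48 * |x - z|)) ≤ 3 * Real.exp (-(1 / 48 * |x - μ|)) := by
    have : Real.exp (-(1 / 48 * |x - z|)) ≤ Real.exp (1 + -(1 / 48 * |x - μ|)) :=
      Real.exp_le_exp.2 (by linarith)
    rw [Real.exp_add] at this
    refine this.trans ?_
    gcongr
    linarith [Real.exp_one_lt_d9]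
  linarith

lemma integrable_exp_abs_sub (h : IsLogConcaveDensity p D)
    (hv : variance (fun x : ℝ => x) D = 1) :
    Integrable (fun x => Real.exp (1 / 96 * |x - ∫ x, x ∂D|)) D ∧
      ∫ x, Real.exp (1 / 96 * |x - ∫ x, x ∂D|) ∂D ≤ 145152 := by
  set μ := ∫ x, x ∂D
  have hle : ∀ x, p x * Real.exp (1 / 96 * |x - μ|) ≤
      756 * Real.exp (-(1 / 96 * |x - μ|)) := by
    intro x
    have h1 := h.le_exp_neg_abs_sub hv x
    calc p x * Real.exp (1 / 96 * |x - μ|) ≤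
        (756 * Real.exp (-(1 / 48 * |x - μ|))) * Real.exp (1 / 96 * |x - μ|) := by gcongr
      _ = _ := by rw [mul_assoc, ← Real.exp_add]; ring_nf
  have hnn : ∀ x, 0 ≤ p x * Real.exp (1 / 96 * |x - μ|) := fun x =>
    mul_nonneg (h.nonneg x) (Real.exp_pos _).le
  have hi := (integrable_exp_neg_mul_abs_sub (b := 1 / 96) (by norm_num) μ).const_mul 756
  constructor
  · rw [h.integrable_iff]
    refine hi.mono' (h.measurable.mul (by fun_prop)).aestronglyMeasurable
      (Filter.Eventually.of_forall fun x => ?_)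
    rw [Real.norm_eq_abs, abs_of_nonneg (hnn x)]
    exact hle x
  · rw [h.integral_eq]
    refine (integral_mono_of_nonneg (Filter.Eventually.of_forall hnn) hi
      (Filter.Eventually.of_forall hle)).trans (le_of_eq ?_)
    rw [integral_const_mul, integral_exp_neg_mul_abs_sub (by norm_num)]
    norm_num

/-- Superlevel sets of a logconcave density are intervals. Within distance 2 of the mean, points
with `p < 1/16` carry mass at most `1/4`, so the others carry at least `1/2`. As `p ≤ 84`, they have
length at least `1/168 > 1/200` and contain two points `1/400` apart. -/
lemma exists_interval (h : IsLogConcaveDensity p D)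
    (hv : variance (fun x : ℝ => x) D = 1) :
    ∃ a : ℝ, ∀ x ∈ Set.Icc a (a + 1 / 400), 1 / 16 ≤ p x := by
  have h1 := measureReal_Ioo_ge hv
  have hb := h.le_of_variance_eq_one hv
  set μ := ∫ x, x ∂D
  set I := Set.Ioo (μ - 2) (μ + 2) with hI
  set E := I ∩ {x | 1 / 16 ≤ p x} with hE
  have hm : MeasurableSet {x | 1 / 16 ≤ p x} := measurableSet_le measurable_const h.measurable
  have hIv : volume.real I = 4 := by
    rw [measureReal_def, hI, Real.volume_Ioo, ENNReal.toReal_ofReal (by linarith)]; ring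
  have hIf : volume I ≠ ∞ := by simp [hI]
  have h2 : D.real (I \ {x | 1 / 16 ≤ p x}) ≤ 1 / 4 := by
    have hsub : volume.real (I \ {x | 1 / 16 ≤ p x}) ≤ 4 := by
      rw [← hIv]; exact measureReal_mono Set.sdiff_subset hIf
    have := h.measureReal_le_mul (c := 1 / 16) (measurableSet_Ioo.diff hm)
      (measure_ne_top_of_subset Set.sdiff_subset hIf) fun x hx => by
        have := hx.2
        simp only [Set.mem_ofPred_eq, not_le] at this
        exact this.le
    linarith
  have h3 : D.real E + D.real (I \ {x | 1 / 16 ≤ p x}) = D.real I :=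
    measureReal_inter_add_sdiff hm
  have h4 := h.measureReal_le_mul (c := 84) (measurableSet_Ioo.inter hm)
    (measure_ne_top_of_subset Set.inter_subset_left hIf) fun x _ => hb x
  have h5 : 1 / 168 ≤ volume.real E := by
    change D.real E ≤ 84 * volume.real E at h4
    linarith
  have hne : E.Nonempty := by
    rw [Set.nonempty_iff_ne_empty]
    intro h0
    rw [h0] at h5
    norm_num at h5
  obtain ⟨e, he⟩ := hne
  have hseg : ∀ a ∈ E, ∀ b ∈ E, a < b → ∀ x ∈ Set.Icc a b, 1 / 16 ≤ p x := by
    intro a ha b hb' hab x hx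
    rcases hx.1.eq_or_lt with rfl | hx1
    · exact ha.2
    rcases hx.2.eq_or_lt with rfl | hx2
    · exact hb'.2
    have hba : 0 < b - a := by linarith
    have h6 := h.logconcave a b ((b - x) / (b - a)) ((x - a) / (b - a))
      (div_pos (by linarith) hba) (div_pos (by linarith) hba) (by field_simp; ring)
    rw [show (b - x) / (b - a) * a + (x - a) / (b - a) * b = x by field_simp; ring] at h6
    refine le_trans ?_ h6
    have h7 : ((1 : ℝ) / 16) ^ ((b - x) / (b - a)) * (1 / 16) ^ ((x - a) / (b - a)) = 1 / 16 := by
      rw [← Real.rpow_add (by norm_num), ← add_div, show b - x + (x - a) = b - a by ring,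
        div_self hba.ne', Real.rpow_one]
    rw [← h7]
    have ha2 : 1 / 16 ≤ p a := ha.2
    have hb2 : 1 / 16 ≤ p b := hb'.2
    have := h.nonneg a
    gcongr
  obtain ⟨f, hf, hef⟩ : ∃ f ∈ E, 1 / 400 ≤ |f - e| := by
    by_contra! hc
    have : E ⊆ Set.Ioo (e - 1 / 400) (e + 1 / 400) := fun x hx => by
      have := abs_lt.1 (hc x hx)
      exact ⟨by linarith [this.1], by linarith [this.2]⟩
    have h6 := measureReal_mono (μ := volume) this (by simp)
    rw [measureReal_def (s := Set.Ioo _ _), Real.volume_Ioo,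
      ENNReal.toReal_ofReal (by linarith)] at h6
    linarith
  rcases le_total e f with hle | hle
  · rw [abs_of_nonneg (by linarith)] at hef
    exact ⟨e, fun x hx => hseg e he f hf (by linarith) x ⟨hx.1, by linarith [hx.2]⟩⟩
  · rw [abs_of_nonpos (by linarith)] at hef
    exact ⟨f, fun x hx => hseg f hf e he (by linarith) x ⟨hx.1, by linarith [hx.2]⟩⟩

end IsLogConcaveDensity

end SQWave

namespace SQWave

/-! ### Exponential moments and characteristic functions of logconcave distributions -/

lemma abs_exp_sub_one_sub_le (y : ℝ) : |Real.exp y - 1 - y| ≤ y ^ 2 * Real.exp |y| := by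
  have h := Complex.norm_exp_sub_sum_le_norm_mul_exp (y : ℂ) 2
  simp only [Finset.sum_range_succ, Finset.sum_range_zero] at h
  norm_num at h
  have h1 : Complex.exp (y : ℂ) - (1 + (y : ℂ)) = ((Real.exp y - 1 - y : ℝ) : ℂ) := by
    push_cast; ring
  rwa [h1, Complex.norm_real, Real.norm_eq_abs] at h

/-- Centring kills the linear term of the expansion, so the exponent is quadratic in `α`. For `α` of
order `n ^ (-1/2)` a product over `n` coordinates therefore stays bounded. -/
theorem exists_exp_moment_bound : ∃ a K : ℝ, 0 < a ∧ 0 < K ∧ ∀ (D : Measure ℝ),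
    IsProbabilityMeasure D → IsLogConcave D → variance (fun x : ℝ => x) D = 1 →
    ∀ α : ℝ, |α| ≤ a →
      Integrable (fun x => Real.exp (α * (x - ∫ y, y ∂D))) D ∧
      ∫ x, Real.exp (α * (x - ∫ y, y ∂D)) ∂D ≤ Real.exp (K * α ^ 2) := by
  -- The moment available at rate `1/96` is split equally: one `1/192` dominates `(x - μ)²`, the
  -- other `exp |α (x - μ)|`. The constant is `73728 = 8 · 96²`.
  refine ⟨1 / 192, 73728 * 145152, by norm_num, by norm_num, fun D _ hD hv α hα => ?_⟩
  obtain ⟨p, hp⟩ := hD.exists_density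
  obtain ⟨hi, hI⟩ := hp.integrable_exp_abs_sub hv
  have hid : Integrable (fun x : ℝ => x) D :=
    (memLp_id_of_variance_eq_one hv).integrable (by norm_num)
  set μ := ∫ x, x ∂D with hμ
  have hα0 := abs_nonneg α
  have hbound : ∀ x, Real.exp (α * (x - μ)) ≤
      1 + α * (x - μ) + α ^ 2 * 73728 * Real.exp (1 / 96 * |x - μ|) := by
    intro x
    have h1 := (abs_le.1 (abs_exp_sub_one_sub_le (α * (x - μ)))).2
    have h2 := sq_le_mul_exp (b := 1 / 96) (by norm_num) (x - μ)
    have h3 : Real.exp |α * (x - μ)| ≤ Real.exp (1 / 192 * |x - μ|) := by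
      rw [abs_mul]; gcongr
    have h4 : (α * (x - μ)) ^ 2 * Real.exp |α * (x - μ)| ≤
        α ^ 2 * (8 / (1 / 96) ^ 2 * Real.exp (1 / 96 / 2 * |x - μ|)) *
          Real.exp (1 / 192 * |x - μ|) := by
      rw [mul_pow]; gcongr
    have h5 : α ^ 2 * (8 / (1 / 96) ^ 2 * Real.exp (1 / 96 / 2 * |x - μ|)) *
          Real.exp (1 / 192 * |x - μ|) = α ^ 2 * 73728 * Real.exp (1 / 96 * |x - μ|) := by
      have : Real.exp (1 / 96 / 2 * |x - μ|) * Real.exp (1 / 192 * |x - μ|) =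
          Real.exp (1 / 96 * |x - μ|) := by rw [← Real.exp_add]; ring_nf
      rw [← this]; ring
    linarith
  have hi1 : Integrable (fun x => 1 + α * (x - μ)) D :=
    (integrable_const _).add ((hid.sub (integrable_const _)).const_mul _)
  have hi2 : Integrable (fun x => α ^ 2 * 73728 * Real.exp (1 / 96 * |x - μ|)) D :=
    hi.const_mul _
  have hi3 : Integrable (fun x => Real.exp (α * (x - μ))) D := by
    refine (hi1.add hi2).mono' (by fun_prop) (Filter.Eventually.of_forall fun x => ?_)
    rw [Real.norm_eq_abs, abs_of_pos (Real.exp_pos _)]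
    exact hbound x
  refine ⟨hi3, ?_⟩
  have h1 : ∫ x, Real.exp (α * (x - μ)) ∂D ≤
      ∫ x, (1 + α * (x - μ) + α ^ 2 * 73728 * Real.exp (1 / 96 * |x - μ|)) ∂D :=
    integral_mono hi3 (hi1.add hi2) hbound
  have h2 : ∫ x, (1 + α * (x - μ)) ∂D = 1 := by
    have hi4 : Integrable (fun x => α * (x - μ)) D := (hid.sub (integrable_const _)).const_mul _
    rw [integral_add (integrable_const _) hi4,
      integral_const_mul, integral_sub hid (integrable_const _)]
    simp [← hμ]
  rw [integral_add hi1 hi2, h2, integral_const_mul] at h1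
  refine h1.trans ?_
  have h3 := Real.add_one_le_exp (73728 * 145152 * α ^ 2)
  refine (add_le_add le_rfl
    (mul_le_mul_of_nonneg_left hI (by positivity : 0 ≤ α ^ 2 * 73728))).trans ?_
  linarith

lemma exists_sin_gap {v₀ : ℝ} (h0 : 0 < v₀) : ∃ δ : ℝ, 0 < δ ∧ δ ≤ 1 / 2 ∧
    ∀ v, v₀ ≤ v → |Real.sin v| ≤ (1 - δ) * v := by
  have hs := Real.sin_lt h0
  refine ⟨min (1 / 2) ((v₀ - Real.sin v₀) / 2), lt_min (by norm_num) (by linarith),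
    min_le_left _ _, fun v hv => ?_⟩
  rcases le_total v 2 with h2 | h2
  · have hd : min (1 / 2) ((v₀ - Real.sin v₀) / 2) ≤ (v₀ - Real.sin v₀) / 2 := min_le_right _ _
    have hsn : 0 ≤ Real.sin v :=
      Real.sin_nonneg_of_nonneg_of_le_pi (by linarith) (by linarith [Real.pi_gt_three])
    have hl : Real.sin v - Real.sin v₀ ≤ v - v₀ := by
      have hmono : Monotone fun x => x - Real.sin x := by
        refine monotone_of_deriv_nonneg (by fun_prop) fun x => ?_
        have hd : HasDerivAt (fun x => x - Real.sin x) (1 - Real.cos x) x :=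
          (hasDerivAt_id x).sub (Real.hasDerivAt_sin x)
        rw [hd.deriv]
        linarith [Real.cos_le_one x]
      have := hmono hv
      simp only at this
      linarith
    rw [abs_of_nonneg hsn]
    nlinarith
  · have hd : min (1 / 2) ((v₀ - Real.sin v₀) / 2) ≤ 1 / 2 := min_le_left _ _
    have := Real.abs_sin_le_one v
    nlinarith

/-- After a rotation of phase, `1 - ‖w‖` is the mean of `1 - cos`, of which only the part over the
interval from `exists_interval` is kept. There the cosine averages to at most a factor `|sin v| / v`
with `v = |κ| / 800`, which `exists_sin_gap` keeps away from 1. The gain is `δ / (16 · 400)`. -/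
theorem exists_charFun_bound : ∃ ρ : ℝ, 0 < ρ ∧ ρ < 1 ∧ ∀ (D : Measure ℝ),
    IsProbabilityMeasure D → IsLogConcave D → variance (fun x : ℝ => x) D = 1 →
    ∀ κ c : ℝ, 1 ≤ |κ| →
      ‖∫ x, Complex.exp ((κ * (x - c) : ℝ) * Complex.I) ∂D‖ ≤ ρ := by
  obtain ⟨δ, hδ0, hδ1, hδ⟩ := exists_sin_gap (v₀ := 1 / 800) (by norm_num)
  refine ⟨1 - δ / 6400, by linarith, by linarith, fun D _ hD hv κ c hκ => ?_⟩
  obtain ⟨p, hp⟩ := hD.exists_density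
  obtain ⟨a, ha⟩ := hp.exists_interval hv
  set w := ∫ x, Complex.exp ((κ * (x - c) : ℝ) * Complex.I) ∂D with hw
  set φ : ℝ := -Complex.arg w with hφ
  have hint : Integrable (fun x => Complex.exp ((κ * (x - c) : ℝ) * Complex.I)) D := by
    refine (integrable_const (1 : ℝ)).mono' (by fun_prop) (Filter.Eventually.of_forall fun x => ?_)
    rw [Complex.norm_exp_ofReal_mul_I]
  have hnorm : ‖w‖ = ∫ x, Real.cos (κ * (x - c) + φ) ∂D := by
    have h1 : (‖w‖ : ℂ) = Complex.exp (φ * Complex.I) * w := by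
      conv_rhs => rw [← Complex.norm_mul_exp_arg_mul_I w]
      rw [mul_left_comm, ← Complex.exp_add, hφ]
      push_cast
      rw [← add_mul, neg_add_cancel, zero_mul, Complex.exp_zero, mul_one]
    have h2 : ‖w‖ = (Complex.exp (φ * Complex.I) * w).re := by rw [← h1, Complex.ofReal_re]
    rw [h2, hw, ← integral_const_mul]
    have h3 := integral_re (hint.const_mul (Complex.exp (φ * Complex.I)))
    simp only [RCLike.re_eq_complex_re] at h3
    rw [← h3]
    refine integral_congr_ae (Filter.Eventually.of_forall fun x => ?_)
    simp only
    rw [← Complex.exp_add, ← add_mul, ← Complex.ofReal_add, Complex.exp_ofReal_mul_I_re, add_comm]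
  set β := φ - κ * c with hβ
  have hcosint : Integrable (fun x => Real.cos (κ * (x - c) + φ)) D :=
    (integrable_const (1 : ℝ)).mono' (by fun_prop)
      (Filter.Eventually.of_forall fun x => by simpa using Real.abs_cos_le_one _)
  have h1 : 1 - ‖w‖ = ∫ x, p x * (1 - Real.cos (κ * x + β)) := by
    rw [hnorm, ← hp.integral_eq]
    have h2 : ∫ x, (1 - Real.cos (κ * (x - c) + φ)) ∂D =
        1 - ∫ x, Real.cos (κ * (x - c) + φ) ∂D := by
      rw [integral_sub (integrable_const _) hcosint]
      simp
    rw [← h2]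
    refine integral_congr_ae (Filter.Eventually.of_forall fun x => ?_)
    simp only [hβ]
    ring_nf
  have hnn : ∀ x, 0 ≤ 1 - Real.cos (κ * x + β) := fun x => by linarith [Real.cos_le_one (κ * x + β)]
  have hi2 : Integrable fun x => p x * (1 - Real.cos (κ * x + β)) := by
    refine (hp.integrable_density.const_mul 2).mono'
      (hp.measurable.mul (by fun_prop)).aestronglyMeasurable
      (Filter.Eventually.of_forall fun x => ?_)
    rw [Real.norm_eq_abs, abs_of_nonneg (mul_nonneg (hp.nonneg x) (hnn x))]
    nlinarith [Real.neg_one_le_cos (κ * x + β), hp.nonneg x]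
  have h2 : ∫ x in Set.Icc a (a + 1 / 400), 1 / 16 * (1 - Real.cos (κ * x + β)) ≤
      ∫ x, p x * (1 - Real.cos (κ * x + β)) := by
    refine le_trans ?_ (setIntegral_le_integral (s := Set.Icc a (a + 1 / 400)) hi2 (Filter.Eventually.of_forall fun x =>
      mul_nonneg (hp.nonneg x) (hnn x)))
    refine setIntegral_mono_on (Continuous.integrableOn_Icc (by fun_prop)) hi2.integrableOn
      measurableSet_Icc fun x hx => ?_
    exact mul_le_mul_of_nonneg_right (ha x hx) (hnn x)
  have hκ0 : κ ≠ 0 := by rintro rfl; norm_num at hκ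
  have h3 : ∫ x in Set.Icc a (a + 1 / 400), 1 / 16 * (1 - Real.cos (κ * x + β)) =
      1 / 16 * (1 / 400 - (Real.sin (κ * (a + 1 / 400) + β) - Real.sin (κ * a + β)) / κ) := by
    rw [integral_Icc_eq_integral_Ioc, ← intervalIntegral.integral_of_le (by norm_num),
      intervalIntegral.integral_eq_sub_of_hasDerivAt (f := fun x =>
        1 / 16 * (x - Real.sin (κ * x + β) / κ))]
    · ring
    · intro x _
      have hlin : HasDerivAt (fun x => κ * x + β) κ x := by
        simpa using ((hasDerivAt_id x).const_mul κ).add_const β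
      have h4 := (((Real.hasDerivAt_sin (κ * x + β)).comp x hlin).div_const κ)
      rw [mul_div_cancel_right₀ _ hκ0] at h4
      exact ((hasDerivAt_id x).sub h4).const_mul (1 / 16)
    · exact (by fun_prop : Continuous fun x => 1 / 16 * (1 - Real.cos (κ * x + β))
        ).intervalIntegrable _ _
  have h4 : (Real.sin (κ * (a + 1 / 400) + β) - Real.sin (κ * a + β)) / κ ≤
      (1 - δ) * (1 / 400) := by
    refine (le_abs_self _).trans ?_
    rw [Real.sin_sub_sin, show (κ * (a + 1 / 400) + β - (κ * a + β)) / 2 = κ * (1 / 800) by ring,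
      abs_div, abs_mul, abs_mul]
    have h800 : |(1 : ℝ) / 800| = 1 / 800 := abs_of_pos (by norm_num)
    have h5 := hδ |κ * (1 / 800)| (by rw [abs_mul, h800]; linarith)
    have h6 : ∀ v : ℝ, |Real.sin (|v|)| = |Real.sin v| := fun v => by
      rcases abs_choice v with h | h <;> rw [h]
      rw [Real.sin_neg, abs_neg]
    rw [h6, abs_mul, h800] at h5
    have h7 := Real.abs_cos_le_one ((κ * (a + 1 / 400) + β + (κ * a + β)) / 2)
    rw [div_le_iff₀ (by linarith), abs_of_pos (by norm_num : (0 : ℝ) < 2)]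
    nlinarith [abs_nonneg (Real.sin (κ * (1 / 800)))]
  rw [← h1, h3] at h2
  linarith

end SQWave

namespace SQWave

/-! ### The Fejér kernel -/

/-- The Fejér kernel of order `M`. -/
noncomputable def fejer (M : ℕ) (d : ℝ) : ℝ :=
  ‖∑ j ∈ Finset.range M, Complex.exp ((j * d : ℝ) * Complex.I)‖ ^ 2 / M

lemma fejer_nonneg (M : ℕ) (d : ℝ) : 0 ≤ fejer M d := by unfold fejer; positivity

lemma fejer_eq (M : ℕ) (d : ℝ) : fejer M d = (1 / M) *
    ∑ j ∈ Finset.range M, ∑ l ∈ Finset.range M, Real.cos (((j : ℤ) - (l : ℤ) : ℤ) * d) := by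
  rw [fejer, ← Complex.normSq_eq_norm_sq, div_eq_inv_mul, ← one_div]
  congr 1
  have h : ((Complex.normSq (∑ j ∈ Finset.range M, Complex.exp ((j * d : ℝ) * Complex.I)) : ℝ) : ℂ)
      = ∑ j ∈ Finset.range M, ∑ l ∈ Finset.range M,
        Complex.exp (((((j : ℤ) - (l : ℤ) : ℤ) * d : ℝ) : ℂ) * Complex.I) := by
    rw [← Complex.mul_conj, map_sum, Finset.sum_mul_sum]
    refine Finset.sum_congr rfl fun j _ => Finset.sum_congr rfl fun l _ => ?_
    rw [← Complex.exp_conj, ← Complex.exp_add, map_mul, Complex.conj_I, Complex.conj_ofReal]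
    congr 1
    push_cast
    ring
  have h2 := congrArg Complex.re h
  rw [Complex.ofReal_re, Complex.re_sum] at h2
  rw [h2]
  refine Finset.sum_congr rfl fun j _ => ?_
  rw [Complex.re_sum]
  refine Finset.sum_congr rfl fun l _ => ?_
  rw [Complex.exp_ofReal_mul_I_re]

lemma fejer_le (M : ℕ) (d : ℝ) : fejer M d ≤ M := by
  rcases Nat.eq_zero_or_pos M with rfl | hM
  · simp [fejer]
  have hM' : (0 : ℝ) < M := by exact_mod_cast hM
  rw [fejer, div_le_iff₀ hM', ← sq]
  gcongr
  refine (norm_sum_le _ _).trans ?_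
  simp [Complex.norm_exp_ofReal_mul_I, -Complex.ofReal_mul]

lemma continuous_fejer (M : ℕ) : Continuous (fejer M) := by
  unfold fejer
  fun_prop

/-- Multiplying the geometric sum by `z - 1`, whose norm is `2 |sin (d/2)|`, leaves `z ^ M - 1`, of
norm at most 2. -/
lemma fejer_mul_sin_sq_le (M : ℕ) (d : ℝ) : fejer M d * Real.sin (d / 2) ^ 2 ≤ 1 / M := by
  rcases Nat.eq_zero_or_pos M with rfl | hM
  · simp [fejer]
  have hM' : (0 : ℝ) < M := by exact_mod_cast hM
  rw [fejer, div_mul_eq_mul_div]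
  refine div_le_div_of_nonneg_right ?_ hM'.le
  set z := Complex.exp (Complex.I * d) with hz
  have h1 : ∑ j ∈ Finset.range M, Complex.exp ((j * d : ℝ) * Complex.I) =
      ∑ j ∈ Finset.range M, z ^ j := by
    refine Finset.sum_congr rfl fun j _ => ?_
    rw [hz, ← Complex.exp_nat_mul]
    congr 1
    push_cast
    ring
  have h2 : ‖z - 1‖ = 2 * |Real.sin (d / 2)| := by
    rw [hz, Complex.norm_exp_I_mul_ofReal_sub_one, norm_mul, Real.norm_eq_abs, Real.norm_eq_abs,
      abs_of_pos (by norm_num : (0 : ℝ) < 2)]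
  have h3 := geom_sum_mul z M
  have hz1 : ‖z‖ = 1 := by rw [hz, mul_comm, Complex.norm_exp_ofReal_mul_I]
  have h4 : ‖∑ j ∈ Finset.range M, z ^ j‖ * ‖z - 1‖ ≤ 2 := by
    rw [← norm_mul, h3]
    refine (norm_sub_le _ _).trans ?_
    rw [norm_pow, hz1]
    norm_num
  rw [h1, ← sq_abs (Real.sin _), ← mul_pow]
  rw [h2] at h4
  have h5 : ‖∑ j ∈ Finset.range M, z ^ j‖ * |Real.sin (d / 2)| ≤ 1 := by linarith
  exact pow_le_one₀ (by positivity) h5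

/-- Periodicity reduces the difference of angles to `[-π, π]`, where Jordan's inequality gives `|d|
≤ π |sin (d/2)|`. -/
lemma abs_sub_le_mul_abs_sin {H : ℝ → ℝ} {L : ℝ} (hper : Function.Periodic H (2 * Real.pi))
    (hL : ∀ u v, |H u - H v| ≤ L * |u - v|) (θ u : ℝ) :
    |H θ - H u| ≤ L * Real.pi * |Real.sin ((θ - u) / 2)| := by
  have hL0 : 0 ≤ L := by
    have := (abs_nonneg _).trans (hL 1 0)
    simpa using this
  have hpi := Real.pi_pos
  obtain ⟨k, hk⟩ : ∃ k : ℤ, |θ - u - k * (2 * Real.pi)| ≤ Real.pi := by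
    refine ⟨round ((θ - u) / (2 * Real.pi)), ?_⟩
    have h := abs_sub_round ((θ - u) / (2 * Real.pi))
    have h2 : θ - u - (round ((θ - u) / (2 * Real.pi)) : ℝ) * (2 * Real.pi) =
        ((θ - u) / (2 * Real.pi) - round ((θ - u) / (2 * Real.pi))) * (2 * Real.pi) := by
      field_simp
    rw [h2, abs_mul, abs_of_pos (by positivity : 0 < 2 * Real.pi)]
    nlinarith
  have h1 : H θ = H (θ - k * (2 * Real.pi)) := (hper.sub_int_mul_eq k).symm
  have h2 := hL (θ - k * (2 * Real.pi)) u
  rw [← h1] at h2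
  set d := θ - u - k * (2 * Real.pi) with hd
  rw [show θ - k * (2 * Real.pi) - u = d by rw [hd]; ring] at h2
  have h3 := Real.mul_abs_le_abs_sin (x := d / 2) (by
    rw [abs_div, abs_of_pos (by norm_num : (0 : ℝ) < 2)]; linarith)
  have h4 : |Real.sin (d / 2)| = |Real.sin ((θ - u) / 2)| := by
    rw [show d / 2 = (θ - u) / 2 - k * Real.pi by rw [hd]; ring, Real.sin_sub_int_mul_pi, abs_mul]
    simp
  rw [h4, abs_div, abs_of_pos (by norm_num : (0 : ℝ) < 2)] at h3
  have h5 : |d| ≤ Real.pi * |Real.sin ((θ - u) / 2)| := by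
    have : |d| = Real.pi * (2 / Real.pi * (|d| / 2)) := by field_simp
    rw [this]
    gcongr
  calc _ ≤ L * |d| := h2
    _ ≤ L * (Real.pi * |Real.sin ((θ - u) / 2)|) := by gcongr
    _ = _ := by ring

/-- AM-GM gives `2 √M |sin| ≤ 1 + M sin²`, and the kernel times `M sin²` is at most 1. The bound is
pointwise, so it can be averaged over a grid or over a random angle; the price is the rate `1 / √M`.
-/
lemma abs_sub_mul_fejer_le {H : ℝ → ℝ} {L : ℝ} (hper : Function.Periodic H (2 * Real.pi))
    (hL : ∀ u v, |H u - H v| ≤ L * |u - v|) {M : ℕ} (hM : 0 < M) (θ u : ℝ) :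
    |H θ - H u| * fejer M (θ - u) ≤ L * Real.pi / (2 * √M) * (fejer M (θ - u) + 1) := by
  have hL0 : 0 ≤ L := by
    have := (abs_nonneg _).trans (hL 1 0)
    simpa using this
  have hM' : (0 : ℝ) < M := by exact_mod_cast hM
  have hs : 0 < √(M : ℝ) := Real.sqrt_pos.2 hM'
  have hs2 : √(M : ℝ) ^ 2 = M := Real.sq_sqrt hM'.le
  have h1 := abs_sub_le_mul_abs_sin hper hL θ u
  have h2 := fejer_mul_sin_sq_le M (θ - u)
  have h3 := fejer_nonneg M (θ - u)
  rw [← sq_abs] at h2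
  set t := |Real.sin ((θ - u) / 2)|
  set F := fejer M (θ - u)
  have h4 : t * F ≤ 1 / (2 * √M) * (F + 1) := by
    have h5 : 2 * √M * t ≤ 1 + M * t ^ 2 := by
      have : 2 * √M * t ≤ 1 + √(M : ℝ) ^ 2 * t ^ 2 := by
        linarith [sq_nonneg (√(M : ℝ) * t - 1), mul_pow (√(M : ℝ)) t 2,
          sub_sq (√(M : ℝ) * t) 1]
      rwa [hs2] at this
    have h6 : F * (M * t ^ 2) ≤ 1 := by
      rw [le_div_iff₀ hM'] at h2; linarith
    rw [one_div, inv_mul_eq_div, le_div_iff₀ (by positivity)]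
    nlinarith [mul_le_mul_of_nonneg_left h5 h3]
  calc _ ≤ L * Real.pi * t * F := by gcongr
    _ = L * Real.pi * (t * F) := by ring
    _ ≤ L * Real.pi * (1 / (2 * √M) * (F + 1)) := by
      have := Real.pi_pos
      gcongr
    _ = _ := by ring

/-- The `r`-th of `R` equispaced points of the circle. -/
noncomputable def gridPoint (R r : ℕ) : ℝ := 2 * Real.pi * r / R

lemma sum_cos_gridPoint {R : ℕ} {k : ℤ} (hk : k ≠ 0) (hkR : |k| < R) (θ : ℝ) :
    ∑ r ∈ Finset.range R, Real.cos (k * (θ - gridPoint R r)) = 0 := by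
  have hR : (R : ℝ) ≠ 0 := by
    rintro h0
    have : R = 0 := by exact_mod_cast h0
    subst this
    have := abs_nonneg k
    simp at hkR
    omega
  set z := Complex.exp (2 * Real.pi * Complex.I * (-k / R)) with hz
  have hzR : z ^ R = 1 := by
    rw [hz, ← Complex.exp_nat_mul]
    have h1 : (R : ℂ) * (2 * Real.pi * Complex.I * (-k / R)) =
        (-k : ℤ) * (2 * Real.pi * Complex.I) := by
      have : (R : ℂ) ≠ 0 := by exact_mod_cast hR
      field_simp
      push_cast
      ring
    rw [h1]
    exact Complex.exp_int_mul_two_pi_mul_I _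
  have hz1 : z ≠ 1 := by
    intro h1
    rw [hz, Complex.exp_eq_one_iff] at h1
    obtain ⟨j, hj⟩ := h1
    have h2 : (-k / R : ℂ) = j := by
      have hpi : (2 * Real.pi * Complex.I : ℂ) ≠ 0 := Complex.two_pi_I_ne_zero
      rw [mul_comm (j : ℂ)] at hj
      exact mul_left_cancel₀ hpi hj
    have hRc : (R : ℂ) ≠ 0 := by exact_mod_cast hR
    rw [div_eq_iff hRc] at h2
    have h3 : -k = j * R := by exact_mod_cast h2
    have h4 : (R : ℤ) ∣ k := by
      rw [← dvd_neg, h3]; exact Dvd.intro_left _ rfl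
    have h5 := Int.le_of_dvd (abs_pos.2 hk) ((dvd_abs _ _).2 h4)
    omega
  have hgeom : ∑ r ∈ Finset.range R, z ^ r = 0 := by
    have := geom_sum_mul z R
    rw [hzR, sub_self] at this
    exact (mul_eq_zero.1 this).resolve_right (sub_ne_zero.2 hz1)
  have h : ∀ r : ℕ, Real.cos (k * (θ - gridPoint R r)) =
      (Complex.exp ((k * θ : ℝ) * Complex.I) * z ^ r).re := by
    intro r
    rw [hz, ← Complex.exp_nat_mul, ← Complex.exp_add, ← Complex.exp_ofReal_mul_I_re]
    congr 2
    rw [gridPoint]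
    push_cast
    ring
  rw [Finset.sum_congr rfl fun r _ => h r, ← Complex.re_sum, ← Finset.mul_sum, hgeom, mul_zero,
    Complex.zero_re]

/-- The frequencies of the kernel are smaller than `M ≤ R` in size, so every nonconstant harmonic
sums to zero over the grid. -/
lemma sum_fejer_gridPoint {M R : ℕ} (hM : 0 < M) (hMR : M ≤ R) (θ : ℝ) :
    ∑ r ∈ Finset.range R, fejer M (θ - gridPoint R r) = R := by
  have hM' : (M : ℝ) ≠ 0 := by exact_mod_cast hM.ne'
  simp_rw [fejer_eq]
  rw [← Finset.mul_sum, Finset.sum_comm]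
  have h : ∀ j ∈ Finset.range M, ∑ r ∈ Finset.range R, ∑ l ∈ Finset.range M,
      Real.cos (((j : ℤ) - (l : ℤ) : ℤ) * (θ - gridPoint R r)) = R := by
    intro j hj
    rw [Finset.sum_comm, Finset.sum_eq_single_of_mem j hj]
    · simp
    · intro l hl hlj
      refine sum_cos_gridPoint (by omega) ?_ θ
      rw [Finset.mem_range] at hj hl
      rw [abs_lt]
      omega
  rw [Finset.sum_congr rfl h, Finset.sum_const, Finset.card_range, nsmul_eq_mul]
  field_simp

/-- Fejér approximation of a Lipschitz periodic function by a discrete convolution. -/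
lemma abs_sub_sum_fejer_le {H : ℝ → ℝ} {L : ℝ} (hper : Function.Periodic H (2 * Real.pi))
    (hL : ∀ u v, |H u - H v| ≤ L * |u - v|) {M : ℕ} (hM : 0 < M) (θ : ℝ) :
    |H θ - 1 / M * ∑ r ∈ Finset.range M, H (gridPoint M r) * fejer M (θ - gridPoint M r)| ≤
      L * Real.pi / √M := by
  have hM' : (0 : ℝ) < M := by exact_mod_cast hM
  have hsum := sum_fejer_gridPoint hM le_rfl θ
  have h1 : H θ - 1 / M * ∑ r ∈ Finset.range M, H (gridPoint M r) * fejer M (θ - gridPoint M r) =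
      1 / M * ∑ r ∈ Finset.range M, (H θ - H (gridPoint M r)) * fejer M (θ - gridPoint M r) := by
    simp_rw [sub_mul]
    rw [Finset.sum_sub_distrib, ← Finset.mul_sum, hsum]
    field_simp
  rw [h1, abs_mul, abs_of_pos (by positivity)]
  have h2 : |∑ r ∈ Finset.range M, (H θ - H (gridPoint M r)) * fejer M (θ - gridPoint M r)| ≤
      ∑ r ∈ Finset.range M, L * Real.pi / (2 * √M) * (fejer M (θ - gridPoint M r) + 1) := by
    refine (Finset.abs_sum_le_sum_abs _ _).trans (Finset.sum_le_sum fun r _ => ?_)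
    rw [abs_mul, abs_of_nonneg (fejer_nonneg _ _)]
    exact abs_sub_mul_fejer_le hper hL hM θ _
  rw [← Finset.mul_sum, Finset.sum_add_distrib, hsum] at h2
  simp only [Finset.sum_const, Finset.card_range, nsmul_eq_mul, mul_one] at h2
  calc _ ≤ 1 / M * (L * Real.pi / (2 * √M) * (M + M)) := by gcongr
    _ = _ := by
      have : √(M : ℝ) ≠ 0 := (Real.sqrt_pos.2 hM').ne'
      field_simp
      ring

end SQWave

namespace SQWave

/-! ### Almost orthogonal families -/

/-- A Bessel inequality for almost orthogonal vectors. For `w = Σ ⟨v i, u⟩ v i` one has `⟨w, u⟩ =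
V`, while `2 |c i| |c j| ≤ |c i|² + |c j|²` and the row sums give `‖w‖² ≤ Γ V`. Cauchy–Schwarz
concludes. -/
lemma sum_sq_inner_le {ι E : Type*} [NormedAddCommGroup E] [InnerProductSpace ℂ E] (s : Finset ι)
    (v : ι → E) (u : E) {Γ : ℝ} (hΓ0 : 0 ≤ Γ)
    (hΓ : ∀ i ∈ s, ∑ j ∈ s, ‖inner ℂ (v i) (v j)‖ ≤ Γ) :
    ∑ i ∈ s, ‖inner ℂ (v i) u‖ ^ 2 ≤ Γ * ‖u‖ ^ 2 := by
  set c : ι → ℂ := fun i => inner ℂ (v i) u with hc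
  set V := ∑ i ∈ s, ‖c i‖ ^ 2 with hV
  have hV0 : 0 ≤ V := Finset.sum_nonneg fun _ _ => by positivity
  rcases hV0.eq_or_lt with h0 | hpos
  · rw [← h0]; positivity
  set w := ∑ i ∈ s, c i • v i with hw
  have h1 : inner ℂ w u = (V : ℂ) := by
    rw [hw, sum_inner, hV]
    push_cast
    refine Finset.sum_congr rfl fun i _ => ?_
    rw [inner_smul_left]
    exact_mod_cast Complex.conj_mul' (c i)
  have h2 : ‖w‖ ^ 2 ≤ Γ * V := by
    have h3 : ‖w‖ ^ 2 = ‖inner ℂ w w‖ := by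
      rw [inner_self_eq_norm_sq_to_K, norm_pow]; simp
    have h4 : ‖inner ℂ w w‖ ≤ ∑ i ∈ s, ∑ j ∈ s, ‖c i‖ * ‖c j‖ * ‖inner ℂ (v i) (v j)‖ := by
      rw [hw, sum_inner]
      refine (norm_sum_le _ _).trans (Finset.sum_le_sum fun i _ => ?_)
      rw [inner_sum]
      refine (norm_sum_le _ _).trans (Finset.sum_le_sum fun j _ => ?_)
      rw [inner_smul_left, inner_smul_right, norm_mul, norm_mul, RCLike.norm_conj]
      exact le_of_eq (by ring)
    have h5 : ∑ i ∈ s, ∑ j ∈ s, ‖c i‖ * ‖c j‖ * ‖inner ℂ (v i) (v j)‖ ≤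
        ∑ i ∈ s, ∑ j ∈ s, (‖c i‖ ^ 2 / 2 * ‖inner ℂ (v i) (v j)‖ +
          ‖c j‖ ^ 2 / 2 * ‖inner ℂ (v j) (v i)‖) := by
      refine Finset.sum_le_sum fun i _ => Finset.sum_le_sum fun j _ => ?_
      rw [norm_inner_symm (v j) (v i), ← add_mul]
      refine mul_le_mul_of_nonneg_right ?_ (norm_nonneg _)
      nlinarith [sq_nonneg (‖c i‖ - ‖c j‖)]
    have h6 : ∑ i ∈ s, ∑ j ∈ s, ‖c i‖ ^ 2 / 2 * ‖inner ℂ (v i) (v j)‖ ≤ Γ * V / 2 := by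
      rw [hV, Finset.mul_sum, Finset.sum_div]
      refine Finset.sum_le_sum fun i hi => ?_
      rw [← Finset.mul_sum]
      have := mul_le_mul_of_nonneg_left (hΓ i hi) (by positivity : 0 ≤ ‖c i‖ ^ 2 / 2)
      linarith
    simp_rw [Finset.sum_add_distrib] at h5
    rw [Finset.sum_comm (f := fun i j => ‖c j‖ ^ 2 / 2 * ‖inner ℂ (v j) (v i)‖)] at h5
    linarith
  have h3 : V ≤ ‖w‖ * ‖u‖ := by
    have := norm_inner_le_norm (𝕜 := ℂ) w u
    rw [h1, Complex.norm_real, Real.norm_eq_abs, abs_of_pos hpos] at this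
    exact this
  have h4 : V * V ≤ (Γ * ‖u‖ ^ 2) * V := by
    calc V * V ≤ (‖w‖ * ‖u‖) * (‖w‖ * ‖u‖) := by gcongr
      _ = ‖w‖ ^ 2 * ‖u‖ ^ 2 := by ring
      _ ≤ Γ * V * ‖u‖ ^ 2 := by gcongr
      _ = _ := by ring
  exact le_of_mul_le_mul_right h4 hpos

/-! ### Characters of product measures -/

lemma norm_integral_pi_exp_le {n : ℕ} {D : Measure ℝ} [IsProbabilityMeasure D] {c ρ : ℝ}
    (hρ : ∀ κ : ℝ, 1 ≤ |κ| → ‖∫ x, Complex.exp ((κ * (x - c) : ℝ) * Complex.I) ∂D‖ ≤ ρ)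
    (w : Fin n → ℝ) (hw : ∀ i, w i = 0 ∨ 1 ≤ |w i|) :
    ‖∫ x : Fin n → ℝ, Complex.exp ((∑ i, w i * (x i - c) : ℝ) * Complex.I)
      ∂Measure.pi fun _ => D‖ ≤ ρ ^ (Finset.univ.filter fun i => w i ≠ 0).card := by
  have h1 : ∀ x : Fin n → ℝ, Complex.exp ((∑ i, w i * (x i - c) : ℝ) * Complex.I) =
      ∏ i, Complex.exp ((w i * (x i - c) : ℝ) * Complex.I) := by
    intro x
    rw [← Complex.exp_sum, ← Finset.sum_mul, Complex.ofReal_sum]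
  simp_rw [h1]
  rw [integral_fintype_prod_eq_prod (f := fun i (y : ℝ) =>
    Complex.exp ((w i * (y - c) : ℝ) * Complex.I)), norm_prod, ← Finset.prod_const,
    Finset.prod_filter]
  refine Finset.prod_le_prod (fun _ _ => norm_nonneg _) fun i _ => ?_
  rcases hw i with h | h
  · simp [h]
  · have : w i ≠ 0 := by rintro h0; rw [h0] at h; norm_num at h
    rw [if_pos this]
    exact hρ _ h

/-- The centred sum of the coordinates in `S`. -/
noncomputable def centredSum {n : ℕ} (c : ℝ) (S : Finset (Fin n)) (x : Fin n → ℝ) : ℝ :=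
  ∑ i ∈ S, (x i - c)

lemma continuous_centredSum {n : ℕ} (c : ℝ) (S : Finset (Fin n)) :
    Continuous (centredSum c S) := by
  unfold centredSum; fun_prop

/-- Coordinates common to `S` and `T` cancel. Each coordinate of the symmetric difference appears
with frequency `±κ` and contributes a factor at most `ρ`. -/
lemma norm_integral_exp_centredSum_le {n : ℕ} {D : Measure ℝ} [IsProbabilityMeasure D] {c ρ : ℝ}
    (hρ : ∀ κ : ℝ, 1 ≤ |κ| → ‖∫ x, Complex.exp ((κ * (x - c) : ℝ) * Complex.I) ∂D‖ ≤ ρ)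
    {κ : ℝ} (hκ : 1 ≤ |κ|) (S T : Finset (Fin n)) :
    ‖∫ x : Fin n → ℝ, Complex.exp ((κ * (centredSum c S x - centredSum c T x) : ℝ) * Complex.I)
      ∂Measure.pi fun _ => D‖ ≤ ρ ^ (symmDiff S T).card := by
  set w : Fin n → ℝ := fun i => κ * ((if i ∈ S then 1 else 0) - (if i ∈ T then 1 else 0)) with hw
  have hκ0 : κ ≠ 0 := by rintro rfl; norm_num at hκ
  have h1 : ∀ x : Fin n → ℝ, κ * (centredSum c S x - centredSum c T x) =
      ∑ i, w i * (x i - c) := by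
    intro x
    simp only [hw, centredSum, mul_assoc, sub_mul, ite_mul, one_mul, zero_mul]
    rw [← Finset.mul_sum]
    congr 1
    conv_rhs => rw [Finset.sum_sub_distrib]
    rw [Finset.sum_ite_mem, Finset.sum_ite_mem, Finset.univ_inter, Finset.univ_inter]
  have h2 : (Finset.univ.filter fun i => w i ≠ 0) = symmDiff S T := by
    ext i
    simp only [hw, Finset.mem_filter, Finset.mem_univ, true_and, Finset.mem_symmDiff]
    by_cases hS : i ∈ S <;> by_cases hT : i ∈ T <;> simp [hS, hT, hκ0]
  simp_rw [h1]
  rw [← h2]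
  refine norm_integral_pi_exp_le hρ w fun i => ?_
  simp only [hw]
  by_cases hS : i ∈ S <;> by_cases hT : i ∈ T <;> simp [hS, hT, hκ0, hκ]

/-- `T ↦ S ∆ T` permutes the subsets, so this is the binomial theorem. For `ρ < 1` the row sum is
exponentially smaller than the number `2 ^ n` of subsets, which is where the lower bound comes from.
-/
lemma sum_pow_card_symmDiff {n : ℕ} (ρ : ℝ) (S : Finset (Fin n)) :
    ∑ T : Finset (Fin n), ρ ^ (symmDiff S T).card = (1 + ρ) ^ n := by
  have h : ∑ T : Finset (Fin n), ρ ^ (symmDiff S T).card = ∑ T : Finset (Fin n), ρ ^ T.card :=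
    Equiv.sum_comp
      (Function.Involutive.toPerm (symmDiff S) (symmDiff_symmDiff_cancel_left S))
      fun T : Finset (Fin n) => ρ ^ T.card
  rw [h]
  have := Fintype.sum_pow_mul_eq_add_pow (Fin n) ρ (1 : ℝ)
  simp only [one_pow, mul_one, Fintype.card_fin] at this
  rw [this, add_comm]

/-- The characters of the sums over different coordinate sets are almost orthogonal, so that only
few of them correlate with a given function. -/
lemma sum_sq_norm_integral_mul_exp_le {n : ℕ} {D : Measure ℝ} [IsProbabilityMeasure D] {c ρ : ℝ}
    (hρ : ∀ κ : ℝ, 1 ≤ |κ| → ‖∫ x, Complex.exp ((κ * (x - c) : ℝ) * Complex.I) ∂D‖ ≤ ρ)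
    {κ : ℝ} (hκ : 1 ≤ |κ|) {u : (Fin n → ℝ) → ℝ} (hu : MemLp u 2 (Measure.pi fun _ => D))
    (s : Finset (Finset (Fin n))) :
    ∑ S ∈ s, ‖∫ x, (u x : ℂ) * Complex.exp ((κ * centredSum c S x : ℝ) * Complex.I)
      ∂Measure.pi fun _ => D‖ ^ 2 ≤ (1 + ρ) ^ n * ∫ x, u x ^ 2 ∂Measure.pi fun _ => D := by
  have hρ0 : 0 ≤ ρ := (norm_nonneg _).trans (hρ 1 (by norm_num))
  set P := Measure.pi fun _ : Fin n => D
  -- The frequency is `-κ` because the inner product conjugates its first argument.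
  set e : Finset (Fin n) → (Fin n → ℝ) → ℂ := fun S x =>
    Complex.exp ((-κ * centredSum c S x : ℝ) * Complex.I) with he
  have hcont : ∀ S, Continuous (e S) := fun S => by
    have := continuous_centredSum c S
    simp only [he]
    fun_prop
  have hmem : ∀ S, MemLp (e S) 2 P := fun S =>
    MemLp.of_bound (hcont S).aestronglyMeasurable 1 (Filter.Eventually.of_forall fun x => by
      simp only [he]; rw [Complex.norm_exp_ofReal_mul_I])
  have huc : MemLp (fun x => (u x : ℂ)) 2 P := hu.ofReal
  set v : Finset (Fin n) → Lp ℂ 2 P := fun S => (hmem S).toLp (e S) with hv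
  set U : Lp ℂ 2 P := huc.toLp _ with hU
  have hinner : ∀ S, inner ℂ (v S) U =
      ∫ x, (u x : ℂ) * Complex.exp ((κ * centredSum c S x : ℝ) * Complex.I) ∂P := by
    intro S
    rw [L2.inner_def]
    refine integral_congr_ae ?_
    filter_upwards [(hmem S).coeFn_toLp, huc.coeFn_toLp] with x h1 h2
    rw [hv, hU, h1, h2, RCLike.inner_apply]
    simp only [he]
    rw [← Complex.exp_conj, map_mul, Complex.conj_I, Complex.conj_ofReal]
    congr 2
    push_cast
    ring
  have hgram : ∀ S T, ‖inner ℂ (v S) (v T)‖ ≤ ρ ^ (symmDiff S T).card := by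
    intro S T
    refine le_trans (le_of_eq ?_) (norm_integral_exp_centredSum_le hρ hκ S T)
    rw [L2.inner_def]
    congr 1
    refine integral_congr_ae ?_
    filter_upwards [(hmem S).coeFn_toLp, (hmem T).coeFn_toLp] with x h1 h2
    rw [hv, h1, h2, RCLike.inner_apply]
    simp only [he]
    rw [← Complex.exp_conj, map_mul, Complex.conj_I, Complex.conj_ofReal, ← Complex.exp_add]
    congr 1
    push_cast
    ring
  have hnorm : ‖U‖ ^ 2 = ∫ x, u x ^ 2 ∂P := by
    have h1 : (inner ℂ U U).re = ‖U‖ ^ 2 := by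
      rw [inner_self_eq_norm_sq_to_K]; norm_cast
    have h2 : inner ℂ U U = ((∫ x, u x ^ 2 ∂P : ℝ) : ℂ) := by
      rw [L2.inner_def, ← integral_complex_ofReal]
      refine integral_congr_ae ?_
      filter_upwards [huc.coeFn_toLp] with x h2
      rw [hU, h2, RCLike.inner_apply, Complex.conj_ofReal]
      push_cast
      ring
    rw [← h1, h2, Complex.ofReal_re]
  have hΓ : ∀ S ∈ s, ∑ T ∈ s, ‖inner ℂ (v S) (v T)‖ ≤ (1 + ρ) ^ n := by
    intro S _
    rw [← sum_pow_card_symmDiff ρ S]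
    refine (Finset.sum_le_sum fun T _ => hgram S T).trans ?_
    exact Finset.sum_le_sum_of_subset_of_nonneg (Finset.subset_univ s) fun _ _ _ => by positivity
  have := sum_sq_inner_le s v U (by positivity) hΓ
  rw [hnorm] at this
  refine le_trans (le_of_eq (Finset.sum_congr rfl fun S _ => ?_)) this
  rw [hinner]

end SQWave

namespace SQWave

/-! ### Periodic functions of random sums -/

lemma fejer_sub_one {M : ℕ} (hM : 0 < M) (d : ℝ) : fejer M d - 1 =
    1 / M * ∑ q ∈ (Finset.range M).offDiag, Real.cos (((q.1 : ℤ) - (q.2 : ℤ) : ℤ) * d) := by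
  have hM' : (M : ℝ) ≠ 0 := by exact_mod_cast hM.ne'
  rw [fejer_eq, ← Finset.sum_product', ← Finset.diag_union_offDiag,
    Finset.sum_union (Finset.disjoint_diag_offDiag _), mul_add, Finset.sum_diag]
  simp
  field_simp
  simp only [mul_comm, add_sub_cancel_left]

lemma one_le_abs_int_mul {k : ℤ} (hk : k ≠ 0) {κ : ℝ} (hκ : 1 ≤ κ) : 1 ≤ |(k : ℝ) * κ| := by
  rw [abs_mul, abs_of_pos (by linarith : 0 < κ)]
  have : (1 : ℝ) ≤ |(k : ℝ)| := by exact_mod_cast Int.one_le_abs hk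
  nlinarith

lemma integral_le_of_integral_sq_le {X : Type*} [MeasurableSpace X] {P : Measure X}
    [IsProbabilityMeasure P] {b : X → ℝ} (hb : MemLp b 2 P) {B : ℝ} (hB0 : 0 ≤ B)
    (hB : ∫ x, b x ^ 2 ∂P ≤ B ^ 2) : ∫ x, b x ∂P ≤ B := by
  have h := variance_nonneg b P
  rw [variance_eq_sub hb] at h
  simp only [Pi.pow_apply] at h
  exact le_of_abs_le (abs_le_of_sq_le_sq (by linarith) hB0)

/-- A function of the input and of an angle, which is periodic and Lipschitz in the angle, with
size and Lipschitz constant controlled by a square integrable function of the input. -/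
structure IsAngleKernel {n : ℕ} (P : Measure (Fin n → ℝ)) (b : (Fin n → ℝ) → ℝ) (L B : ℝ)
    (H : (Fin n → ℝ) → ℝ → ℝ) : Prop where
  measurable : Measurable (Function.uncurry H)
  periodic : ∀ x, Function.Periodic (H x) (2 * Real.pi)
  memLp : MemLp b 2 P
  L_nonneg : 0 ≤ L
  B_nonneg : 0 ≤ B
  integral_sq_le : ∫ x, b x ^ 2 ∂P ≤ B ^ 2
  abs_apply_le : ∀ x u, |H x u| ≤ b x
  lipschitz : ∀ x u v, |H x u - H x v| ≤ L * b x * |u - v|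

/-- The mean of the kernel over equispaced angles. -/
noncomputable def gridMean {n : ℕ} (P : Measure (Fin n → ℝ)) (M : ℕ) (H : (Fin n → ℝ) → ℝ → ℝ) :
    ℝ :=
  ∫ x, 1 / M * ∑ r ∈ Finset.range M, H x (gridPoint M r) ∂P

section

variable {n : ℕ} {D : Measure ℝ} [IsProbabilityMeasure D] {c ρ κ : ℝ}
  {b : (Fin n → ℝ) → ℝ} {L B : ℝ} {H : (Fin n → ℝ) → ℝ → ℝ}

local notation "Pn" => Measure.pi fun _ : Fin n => D

lemma IsAngleKernel.integrable (hH : IsAngleKernel (Pn) b L B H) {ϑ : (Fin n → ℝ) → ℝ}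
    (hϑ : Measurable ϑ) : Integrable (fun x => H x (ϑ x)) (Pn) := by
  refine (hH.memLp.integrable (by norm_num)).mono'
    (hH.measurable.comp (measurable_id.prodMk hϑ)).aestronglyMeasurable
    (Filter.Eventually.of_forall fun x => hH.abs_apply_le x _)

lemma IsAngleKernel.memLp_apply {P : Measure (Fin n → ℝ)} (hH : IsAngleKernel P b L B H) (u : ℝ) :
    MemLp (fun x => H x u) 2 P :=
  hH.memLp.mono (hH.measurable.comp (measurable_id.prodMk measurable_const)).aestronglyMeasurable
    (Filter.Eventually.of_forall fun x => (hH.abs_apply_le x u).trans (le_abs_self _))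

lemma IsAngleKernel.integral_sq_apply_le {P : Measure (Fin n → ℝ)}
    (hH : IsAngleKernel P b L B H) (u : ℝ) : ∫ x, H x u ^ 2 ∂P ≤ B ^ 2 := by
  refine le_trans ?_ hH.integral_sq_le
  refine integral_mono (hH.memLp_apply u).integrable_sq hH.memLp.integrable_sq fun x => ?_
  exact sq_le_sq' (by linarith [abs_le.1 (hH.abs_apply_le x u)]) (le_of_abs_le (hH.abs_apply_le x u))

/-- The correlation of the kernel at a grid point with a character. -/
noncomputable def gridCorr (D : Measure ℝ) (c κ : ℝ) (H : (Fin n → ℝ) → ℝ → ℝ) (M : ℕ)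
    (S : Finset (Fin n)) (a : ℕ × ℕ × ℕ) : ℝ :=
  ‖∫ x, (H x (gridPoint M a.1) : ℂ) *
    Complex.exp ((((a.2.1 : ℤ) - (a.2.2 : ℤ) : ℤ) * κ * centredSum c S x : ℝ) * Complex.I)
    ∂Measure.pi fun _ : Fin n => D‖

/-- The shift `u` only rotates the phase of the character, so the bound does not depend on it. -/
lemma abs_integral_mul_cos_le (hH : IsAngleKernel (Pn) b L B H) (M : ℕ) (S : Finset (Fin n))
    (a : ℕ × ℕ × ℕ) (u : ℝ) :
    |∫ x, H x (gridPoint M a.1) *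
      Real.cos (((a.2.1 : ℤ) - (a.2.2 : ℤ) : ℤ) * (κ * centredSum c S x - u)) ∂(Pn)| ≤
      gridCorr D c κ H M S a := by
  set k : ℤ := (a.2.1 : ℤ) - (a.2.2 : ℤ) with hk
  have hcont := continuous_centredSum c S
  have hint : Integrable (fun x => (H x (gridPoint M a.1) : ℂ) *
      Complex.exp ((k * κ * centredSum c S x : ℝ) * Complex.I)) (Pn) := by
    refine ((hH.memLp.integrable (by norm_num)).mono' ?_ (Filter.Eventually.of_forall fun x => ?_))
    · exact (((hH.memLp_apply _).aestronglyMeasurable.aemeasurable.complex_ofReal).mul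
        (by fun_prop)).aestronglyMeasurable
    · rw [norm_mul, Complex.norm_exp_ofReal_mul_I, mul_one, Complex.norm_real]
      exact hH.abs_apply_le x _
  have h1 : ∫ x, H x (gridPoint M a.1) * Real.cos (k * (κ * centredSum c S x - u)) ∂(Pn) =
      (Complex.exp ((-(k * u) : ℝ) * Complex.I) * ∫ x, (H x (gridPoint M a.1) : ℂ) *
        Complex.exp ((k * κ * centredSum c S x : ℝ) * Complex.I) ∂(Pn)).re := by
    rw [← integral_const_mul]
    have h3 := integral_re (hint.const_mul (Complex.exp ((-(k * u) : ℝ) * Complex.I)))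
    simp only [RCLike.re_eq_complex_re] at h3
    rw [← h3]
    refine integral_congr_ae (Filter.Eventually.of_forall fun x => ?_)
    simp only
    rw [mul_left_comm, ← Complex.exp_add, ← add_mul, ← Complex.ofReal_add, Complex.re_ofReal_mul,
      Complex.exp_ofReal_mul_I_re]
    ring_nf
  rw [h1]
  refine (Complex.abs_re_le_norm _).trans ?_
  rw [norm_mul, Complex.norm_exp_ofReal_mul_I, one_mul, gridCorr]

/-- The first term is the error of the Fejér discretisation of `H x`. In the discretised integral
the constant term of the kernel gives `gridMean`, and each remaining harmonic is a correlation with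
a character. -/
lemma abs_integral_sub_gridMean_le (hH : IsAngleKernel (Pn) b L B H) {M : ℕ} (hM : 0 < M)
    (S : Finset (Fin n)) :
    |∫ x, H x (κ * centredSum c S x) ∂(Pn) - gridMean (Pn) M H| ≤
      L * B * Real.pi / √M + 1 / (M : ℝ) ^ 2 *
        ∑ a ∈ Finset.range M ×ˢ (Finset.range M).offDiag, gridCorr D c κ H M S a := by
  have hM' : (0 : ℝ) < M := by exact_mod_cast hM
  have hcont := continuous_centredSum c S
  set ϑ : (Fin n → ℝ) → ℝ := fun x => κ * centredSum c S x with hϑ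
  have hϑm : Measurable ϑ := by fun_prop
  have hH1 := hH.integrable hϑm
  have hHr : ∀ r, Integrable (fun x => H x (gridPoint M r)) (Pn) := fun r =>
    hH.integrable measurable_const
  have hHF : ∀ r, Integrable (fun x => H x (gridPoint M r) * fejer M (ϑ x - gridPoint M r))
      (Pn) := fun r => by
    refine (hHr r).mul_bdd (c := M)
      ((continuous_fejer M).measurable.comp (hϑm.sub_const _)).aestronglyMeasurable
      (Filter.Eventually.of_forall fun x => ?_)
    rw [Real.norm_eq_abs, abs_of_nonneg (fejer_nonneg _ _)]
    exact fejer_le _ _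
  have h1 : |∫ x, H x (ϑ x) ∂(Pn) - ∫ x, 1 / M * ∑ r ∈ Finset.range M,
      H x (gridPoint M r) * fejer M (ϑ x - gridPoint M r) ∂(Pn)| ≤ L * B * Real.pi / √M := by
    rw [← integral_sub hH1 ((integrable_finsetSum _ fun r _ => hHF r).const_mul _)]
    refine (abs_integral_le_integral_abs).trans ?_
    have h2 : ∫ x, L * Real.pi / √M * b x ∂(Pn) ≤ L * B * Real.pi / √M := by
      rw [integral_const_mul]
      have := integral_le_of_integral_sq_le hH.memLp hH.B_nonneg hH.integral_sq_le
      have hL := hH.L_nonneg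
      have hpi := Real.pi_pos
      calc _ ≤ L * Real.pi / √M * B := by gcongr
        _ = _ := by ring
    refine le_trans (integral_mono_of_nonneg (Filter.Eventually.of_forall fun _ => abs_nonneg _)
      ((hH.memLp.integrable (by norm_num)).const_mul _)
      (Filter.Eventually.of_forall fun x => ?_)) h2
    refine (abs_sub_sum_fejer_le (hH.periodic x) (hH.lipschitz x) hM (ϑ x)).trans (le_of_eq ?_)
    ring
  have h2 : |∫ x, 1 / M * ∑ r ∈ Finset.range M,
      H x (gridPoint M r) * fejer M (ϑ x - gridPoint M r) ∂(Pn) - gridMean (Pn) M H| ≤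
      1 / (M : ℝ) ^ 2 *
        ∑ a ∈ Finset.range M ×ˢ (Finset.range M).offDiag, gridCorr D c κ H M S a := by
    rw [gridMean, ← integral_sub ((integrable_finsetSum _ fun r _ => hHF r).const_mul _)
      ((integrable_finsetSum _ fun r _ => hHr r).const_mul _)]
    have h3 : ∀ x, 1 / (M : ℝ) * ∑ r ∈ Finset.range M,
        H x (gridPoint M r) * fejer M (ϑ x - gridPoint M r) -
        1 / (M : ℝ) * ∑ r ∈ Finset.range M, H x (gridPoint M r) =
        1 / (M : ℝ) ^ 2 * ∑ a ∈ Finset.range M ×ˢ (Finset.range M).offDiag,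
          H x (gridPoint M a.1) *
            Real.cos (((a.2.1 : ℤ) - (a.2.2 : ℤ) : ℤ) * (ϑ x - gridPoint M a.1)) := by
      intro x
      rw [← mul_sub, ← Finset.sum_sub_distrib, Finset.sum_product, sq, ← one_div_mul_one_div,
        mul_assoc]
      congr 1
      rw [Finset.mul_sum]
      refine Finset.sum_congr rfl fun r _ => ?_
      rw [← mul_sub_one, fejer_sub_one hM, Finset.mul_sum, Finset.mul_sum, Finset.mul_sum]
      refine Finset.sum_congr rfl fun q _ => ?_
      ring
    simp_rw [h3]
    rw [integral_const_mul, integral_finsetSum, abs_mul, abs_of_pos (by positivity)]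
    · refine mul_le_mul_of_nonneg_left ((Finset.abs_sum_le_sum_abs _ _).trans
        (Finset.sum_le_sum fun a _ => abs_integral_mul_cos_le hH M S a _)) (by positivity)
    · intro a _
      refine (hHr a.1).mul_bdd (c := 1) (by fun_prop)
        (Filter.Eventually.of_forall fun x => ?_)
      exact Real.abs_cos_le_one _
  exact (abs_sub_le _ _ _).trans (add_le_add h1 h2)

/-- For all but a small number of coordinate sets, the expectation of the kernel at the random sum
is close to its mean over all angles. -/
theorem card_deviating_le
    (hρ : ∀ κ : ℝ, 1 ≤ |κ| → ‖∫ x, Complex.exp ((κ * (x - c) : ℝ) * Complex.I) ∂D‖ ≤ ρ)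
    (hκ : 1 ≤ κ) (hH : IsAngleKernel (Pn) b L B H) {M : ℕ} (hM : 0 < M) {ε : ℝ} (hε : 0 < ε)
    (hME : L * B * Real.pi / √M ≤ ε / 2) (s : Finset (Finset (Fin n)))
    (hs : ∀ S ∈ s, ε < |∫ x, H x (κ * centredSum c S x) ∂(Pn) - gridMean (Pn) M H|) :
    (s.card : ℝ) ≤ 4 * M ^ 2 * B ^ 2 * (1 + ρ) ^ n / ε ^ 2 := by
  have hM' : (0 : ℝ) < M := by exact_mod_cast hM
  have hρ0 : 0 ≤ ρ := (norm_nonneg _).trans (hρ 1 (by norm_num))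
  set A := Finset.range M ×ˢ (Finset.range M).offDiag with hA
  have hAcard : (A.card : ℝ) ≤ M ^ 3 := by
    have : A.card ≤ M ^ 3 := by
      rw [hA, Finset.card_product, Finset.card_range, Finset.offDiag_card, Finset.card_range]
      calc M * (M * M - M) ≤ M * (M * M) := by gcongr; omega
        _ = M ^ 3 := by ring
    exact_mod_cast this
  -- A deviating set has correlations summing to at least `ε M² / 2`. Cauchy–Schwarz over at most
  -- `M³` triples passes to squares, which almost orthogonality bounds when summed over `S`.
  have h1 : ∀ S ∈ s, M * ε ^ 2 / 4 ≤ ∑ a ∈ A, gridCorr D c κ H M S a ^ 2 := by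
    intro S hS
    have h2 := (hs S hS).trans_le (abs_integral_sub_gridMean_le hH hM S)
    set Z := ∑ a ∈ A, gridCorr D c κ H M S a
    have h3 : ε / 2 ≤ 1 / (M : ℝ) ^ 2 * Z := by linarith
    have h4 : ε / 2 * M ^ 2 ≤ Z := by
      rw [one_div, inv_mul_eq_div, le_div_iff₀ (by positivity)] at h3; exact h3
    have h5 : Z ^ 2 ≤ A.card * ∑ a ∈ A, gridCorr D c κ H M S a ^ 2 := sq_sum_le_card_mul_sum_sq
    set Q := ∑ a ∈ A, gridCorr D c κ H M S a ^ 2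
    have hQ : 0 ≤ Q := Finset.sum_nonneg fun _ _ => by positivity
    have h6 : (ε / 2 * M ^ 2) ^ 2 ≤ M ^ 3 * Q := by
      calc _ ≤ Z ^ 2 := by gcongr
        _ ≤ _ := h5
        _ ≤ _ := by gcongr
    have h7 : (M : ℝ) ^ 3 * (M * ε ^ 2 / 4) ≤ M ^ 3 * Q := by
      calc _ = (ε / 2 * M ^ 2) ^ 2 := by ring
        _ ≤ _ := h6
    exact le_of_mul_le_mul_left h7 (by positivity)
  have h2 : ∑ S ∈ s, ∑ a ∈ A, gridCorr D c κ H M S a ^ 2 ≤ M ^ 3 * ((1 + ρ) ^ n * B ^ 2) := by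
    rw [Finset.sum_comm]
    calc _ ≤ ∑ a ∈ A, (1 + ρ) ^ n * B ^ 2 := by
          refine Finset.sum_le_sum fun a ha => ?_
          have hne : (a.2.1 : ℤ) - (a.2.2 : ℤ) ≠ 0 := by
            rw [hA, Finset.mem_product, Finset.mem_offDiag] at ha
            have := ha.2.2.2
            omega
          refine (sum_sq_norm_integral_mul_exp_le hρ (one_le_abs_int_mul hne hκ)
            (hH.memLp_apply (gridPoint M a.1)) s).trans ?_
          gcongr
          exact hH.integral_sq_apply_le _
      _ = A.card * ((1 + ρ) ^ n * B ^ 2) := by rw [Finset.sum_const, nsmul_eq_mul]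
      _ ≤ _ := by gcongr
  have h3 := Finset.card_nsmul_le_sum s _ _ h1
  rw [nsmul_eq_mul] at h3
  have h4 := h3.trans h2
  rw [le_div_iff₀ (by positivity)]
  have h5 : (M / 4 : ℝ) * ((s.card : ℝ) * ε ^ 2) ≤ M / 4 * (4 * M ^ 2 * B ^ 2 * (1 + ρ) ^ n) := by
    calc _ = (s.card : ℝ) * (M * ε ^ 2 / 4) := by ring
      _ ≤ _ := h4
      _ = _ := by ring
  exact le_of_mul_le_mul_left h5 (by positivity)

end

end SQWave

namespace SQWave

/-! ### The periodic limit as a function of an angle -/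

/-- The periodic wave as a function of the angle. -/
noncomputable def anglePsi (θ : ℝ) : ℝ := psi (2 / Real.pi * θ)

lemma anglePsi_periodic : Function.Periodic anglePsi (2 * Real.pi) := by
  intro θ
  have := Real.pi_pos
  rw [anglePsi, anglePsi, ← psi_add_four (2 / Real.pi * θ)]
  congr 1
  field_simp
  ring

lemma abs_anglePsi_sub_le (u v : ℝ) : |anglePsi u - anglePsi v| ≤ |u - v| := by
  refine (abs_psi_sub_psi_le _ _).trans ?_
  rw [← mul_sub, abs_mul]
  have h : |2 / Real.pi| ≤ 1 := by
    rw [abs_of_pos (div_pos two_pos Real.pi_pos), div_le_one Real.pi_pos]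
    exact Real.two_le_pi
  nlinarith [abs_nonneg (u - v)]

lemma continuous_anglePsi : Continuous anglePsi :=
  lipschitzWith_psi.continuous.comp (by fun_prop)

lemma anglePsi_nonneg (θ : ℝ) : 0 ≤ anglePsi θ := psi_nonneg _

lemma anglePsi_le_one (θ : ℝ) : anglePsi θ ≤ 1 := psi_le_one _

lemma anglePsi_mul (s y : ℝ) : anglePsi (Real.pi / 2 * s * y) = psi (s * y) := by
  have := Real.pi_pos
  rw [anglePsi]
  congr 1
  field_simp

lemma one_le_pi_div_two_mul {s : ℝ} (hs : 1 ≤ s) : 1 ≤ Real.pi / 2 * s := by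
  nlinarith [Real.two_le_pi]

/-! ### Variance of the periodic wave at a random sum -/

/-- The values at the angles `0` and `π` lie on either side of `1/2` at distance at least `0.03`, so
one of them is that far from `a`. -/
lemma exists_far_angle (a : ℝ) : ∃ θ : ℝ, 9 / 10000 ≤ (anglePsi θ - a) ^ 2 := by
  have h0 : anglePsi 0 = psi 0 := by simp [anglePsi]
  have h1 : anglePsi Real.pi = psi 2 := by
    have := Real.pi_pos
    rw [anglePsi]; congr 1; field_simp
  rcases le_total a (1 / 2) with h | h
  · refine ⟨0, ?_⟩
    rw [h0]
    nlinarith [psi_zero_ge]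
  · refine ⟨Real.pi, ?_⟩
    rw [h1]
    nlinarith [psi_two_le]

section

variable {n : ℕ} {D : Measure ℝ} [IsProbabilityMeasure D] {c ρ κ : ℝ}

local notation "Pn" => Measure.pi fun _ : Fin n => D

/-- Near-equidistribution of the sum modulo `2π`: each nonconstant harmonic is the Gram bound with
`T = ∅`, hence at most `ρ ^ |S|`. -/
lemma abs_integral_fejer_sub_one_le
    (hρ : ∀ κ : ℝ, 1 ≤ |κ| → ‖∫ x, Complex.exp ((κ * (x - c) : ℝ) * Complex.I) ∂D‖ ≤ ρ)
    (hκ : 1 ≤ κ) {M : ℕ} (hM : 0 < M) (S : Finset (Fin n)) (θ₀ : ℝ) :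
    |∫ x, fejer M (κ * centredSum c S x - θ₀) ∂(Pn) - 1| ≤ M * ρ ^ S.card := by
  have hM' : (0 : ℝ) < M := by exact_mod_cast hM
  have hρ0 : 0 ≤ ρ := (norm_nonneg _).trans (hρ 1 (by norm_num))
  have hcont := continuous_centredSum c S
  have hF : Integrable (fun x => fejer M (κ * centredSum c S x - θ₀)) (Pn) :=
    (integrable_const (M : ℝ)).mono'
      ((continuous_fejer M).comp (by fun_prop)).aestronglyMeasurable
      (Filter.Eventually.of_forall fun x => by
        rw [Real.norm_eq_abs, abs_of_nonneg (fejer_nonneg _ _)]; exact fejer_le _ _)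
  have h1 : ∫ x, fejer M (κ * centredSum c S x - θ₀) ∂(Pn) - 1 =
      ∫ x, (fejer M (κ * centredSum c S x - θ₀) - 1) ∂(Pn) := by
    rw [integral_sub hF (integrable_const _)]; simp
  rw [h1]
  simp_rw [fejer_sub_one hM]
  rw [integral_const_mul, integral_finsetSum, abs_mul, abs_of_pos (by positivity)]
  swap
  · intro q _
    exact (integrable_const (1 : ℝ)).mono' (by fun_prop)
      (Filter.Eventually.of_forall fun x => Real.abs_cos_le_one _)
  have h2 : ∀ q ∈ (Finset.range M).offDiag, |∫ x : Fin n → ℝ, Real.cos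
      (((q.1 : ℤ) - (q.2 : ℤ) : ℤ) * (κ * centredSum c S x - θ₀)) ∂(Pn)| ≤ ρ ^ S.card := by
    intro q hq
    set k : ℤ := (q.1 : ℤ) - (q.2 : ℤ) with hk
    have hne : k ≠ 0 := by
      rw [Finset.mem_offDiag] at hq
      have := hq.2.2
      omega
    have h3 := norm_integral_exp_centredSum_le hρ (one_le_abs_int_mul hne hκ) S ∅
    have hbot : symmDiff S ∅ = S := symmDiff_bot S
    rw [hbot] at h3
    have hint : Integrable (fun x : Fin n → ℝ => Complex.exp
        ((k * κ * (centredSum c S x - centredSum c ∅ x) : ℝ) * Complex.I)) (Pn) := by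
      have := continuous_centredSum c (∅ : Finset (Fin n))
      exact (integrable_const (1 : ℝ)).mono' (by fun_prop)
        (Filter.Eventually.of_forall fun x => (Complex.norm_exp_ofReal_mul_I _).le)
    have h4 : ∫ x, Real.cos (k * (κ * centredSum c S x - θ₀)) ∂(Pn) =
        (Complex.exp ((-(k * θ₀) : ℝ) * Complex.I) * ∫ x : Fin n → ℝ, Complex.exp
        ((k * κ * (centredSum c S x - centredSum c ∅ x) : ℝ) * Complex.I) ∂(Pn)).re := by
      rw [← integral_const_mul]
      have h5 := integral_re (hint.const_mul (Complex.exp ((-(k * θ₀) : ℝ) * Complex.I)))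
      simp only [RCLike.re_eq_complex_re] at h5
      rw [← h5]
      refine integral_congr_ae (Filter.Eventually.of_forall fun x => ?_)
      simp only
      rw [← Complex.exp_add, ← add_mul, ← Complex.ofReal_add, Complex.exp_ofReal_mul_I_re]
      have h0 : centredSum c (∅ : Finset (Fin n)) x = 0 := by simp [centredSum]
      rw [h0]
      ring_nf
    rw [h4]
    refine (Complex.abs_re_le_norm _).trans ?_
    rw [norm_mul, Complex.norm_exp_ofReal_mul_I, one_mul]
    exact h3
  have h3 := (Finset.abs_sum_le_sum_abs _ _).trans (Finset.sum_le_card_nsmul _ _ _ h2)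
  rw [nsmul_eq_mul] at h3
  have hcard : ((Finset.range M).offDiag.card : ℝ) ≤ M ^ 2 := by
    have : (Finset.range M).offDiag.card ≤ M ^ 2 := by
      rw [Finset.offDiag_card, Finset.card_range, sq]; omega
    exact_mod_cast this
  calc _ ≤ 1 / (M : ℝ) * (M ^ 2 * ρ ^ S.card) := by
        refine mul_le_mul_of_nonneg_left (h3.trans ?_) (by positivity)
        gcongr
    _ = _ := by field_simp

/-- The squared distance `G` to `a` is bounded below at some angle `θ₀`. A Fejér kernel centred
there has mean at least `1/2` and size at most `M`, so integrating the pointwise localisation bound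
leaves `∫ G` of order at least `1 / M`. -/
lemma integral_anglePsi_sub_sq_ge
    (hρ : ∀ κ : ℝ, 1 ≤ |κ| → ‖∫ x, Complex.exp ((κ * (x - c) : ℝ) * Complex.I) ∂D‖ ≤ ρ)
    (hκ : 1 ≤ κ) (S : Finset (Fin n)) (hS : 10 ^ 10 * ρ ^ S.card ≤ 1 / 2) {a : ℝ} (ha0 : 0 ≤ a)
    (ha1 : a ≤ 1) :
    1 / 10 ^ 14 ≤ ∫ x, (anglePsi (κ * centredSum c S x) - a) ^ 2 ∂(Pn) := by
  obtain ⟨θ₀, hθ₀⟩ := exists_far_angle a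
  set G : ℝ → ℝ := fun θ => (anglePsi θ - a) ^ 2 with hG
  have hGper : Function.Periodic G (2 * Real.pi) := fun θ => by
    simp only [hG, anglePsi_periodic θ]
  have hGL : ∀ u v, |G u - G v| ≤ 2 * |u - v| := by
    intro u v
    have h1 : G u - G v = (anglePsi u - anglePsi v) * (anglePsi u + anglePsi v - 2 * a) := by
      simp only [hG]; ring
    rw [h1, abs_mul]
    have h2 : |anglePsi u + anglePsi v - 2 * a| ≤ 2 := by
      rw [abs_le]
      constructor <;> linarith [anglePsi_nonneg u, anglePsi_nonneg v, anglePsi_le_one u,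
        anglePsi_le_one v]
    have h3 := abs_anglePsi_sub_le u v
    calc _ ≤ |u - v| * 2 := by gcongr
      _ = _ := by ring
  -- With `√M = 10 ^ 5` the localisation error is about `8 · 10⁻⁵`, well below the main term `9 /
  -- 20000`; dividing the remainder by `M` leaves more than `10⁻¹⁴`.
  set M : ℕ := 10 ^ 10 with hM
  have hM0 : 0 < M := by norm_num [hM]
  have hMr : (M : ℝ) = 10 ^ 10 := by norm_num [hM]
  have hsq : √(M : ℝ) = 10 ^ 5 := by
    rw [hMr, show (10 : ℝ) ^ 10 = (10 ^ 5) ^ 2 by norm_num]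
    exact Real.sqrt_sq (by norm_num)
  have hφ := abs_integral_fejer_sub_one_le (n := n) hρ hκ hM0 S θ₀
  set ϑ : (Fin n → ℝ) → ℝ := fun x => κ * centredSum c S x with hϑ
  have hcont := continuous_centredSum c S
  have hϑc : Continuous ϑ := by fun_prop
  have hGc : Continuous G := by
    have := continuous_anglePsi
    fun_prop
  rw [hMr] at hφ
  have hφ2 := abs_le.1 (hφ.trans hS)
  set φ := ∫ x, fejer M (κ * centredSum c S x - θ₀) ∂(Pn) with hφdef
  have hF : Integrable (fun x => fejer M (ϑ x - θ₀)) (Pn) :=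
    (integrable_const (M : ℝ)).mono'
      ((continuous_fejer M).comp (by fun_prop)).aestronglyMeasurable
      (Filter.Eventually.of_forall fun x => by
        rw [Real.norm_eq_abs, abs_of_nonneg (fejer_nonneg _ _)]; exact fejer_le _ _)
  have hG0 : ∀ θ, 0 ≤ G θ := fun θ => sq_nonneg _
  have hG1 : ∀ θ, G θ ≤ 1 := fun θ => by
    have h1 := anglePsi_nonneg θ
    have h2 := anglePsi_le_one θ
    simp only [hG]
    rw [sq_le_one_iff_abs_le_one, abs_le]
    constructor <;> linarith
  have hGi : Integrable (fun x => G (ϑ x)) (Pn) :=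
    (integrable_const (1 : ℝ)).mono' (hGc.comp hϑc).aestronglyMeasurable
      (Filter.Eventually.of_forall fun x => by
        rw [Real.norm_eq_abs, abs_of_nonneg (hG0 _)]; exact hG1 _)
  have hpt : ∀ x, G θ₀ * fejer M (ϑ x - θ₀) ≤
      M * G (ϑ x) + 2 * Real.pi / (2 * √M) * (fejer M (ϑ x - θ₀) + 1) := by
    intro x
    have h1 := abs_sub_mul_fejer_le hGper hGL hM0 (ϑ x) θ₀
    have h2 := fejer_nonneg M (ϑ x - θ₀)
    have h3 := fejer_le M (ϑ x - θ₀)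
    have h4 : G θ₀ - G (ϑ x) ≤ |G (ϑ x) - G θ₀| := by
      rw [abs_sub_comm]; exact le_abs_self _
    have h5 := mul_le_mul_of_nonneg_right h4 h2
    have h6 := mul_le_mul_of_nonneg_left h3 (hG0 (ϑ x))
    calc _ = (G θ₀ - G (ϑ x)) * fejer M (ϑ x - θ₀) + G (ϑ x) * fejer M (ϑ x - θ₀) := by
          rw [sub_mul, sub_add_cancel]
      _ ≤ _ := add_le_add (h5.trans h1) h6
      _ = _ := by rw [add_comm, mul_comm (G (ϑ x))]
  have hF1 : Integrable (fun x => 2 * Real.pi / (2 * √M) * (fejer M (ϑ x - θ₀) + 1)) (Pn) :=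
    (hF.add (integrable_const 1)).const_mul _
  have hint := integral_mono (hF.const_mul (G θ₀)) ((hGi.const_mul (M : ℝ)).add hF1) hpt
  simp only [Pi.add_apply] at hint
  rw [integral_const_mul, integral_add (hGi.const_mul (M : ℝ)) hF1, integral_const_mul,
    integral_const_mul,
    integral_add hF (integrable_const 1)] at hint
  simp only [integral_const, probReal_univ, smul_eq_mul, mul_one] at hint
  rw [← hφdef, hsq, hMr] at hint
  have hθ₀' : 9 / 10000 ≤ G θ₀ := hθ₀
  have hpi := Real.pi_lt_d2
  have h1 : 9 / 10000 * (1 / 2) ≤ G θ₀ * φ :=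
    mul_le_mul hθ₀' (by linarith [hφ2.1]) (by norm_num) (hG0 _)
  have h2 : 2 * Real.pi / (2 * 10 ^ 5) * (φ + 1) ≤ 2 * 3.15 / (2 * 10 ^ 5) * (5 / 2) := by
    gcongr
    · linarith [hφ2.1]
    · linarith [hφ2.2]
  change 1 / 10 ^ 14 ≤ ∫ x, G (ϑ x) ∂(Pn)
  norm_num at h2 hint h1 ⊢
  linarith

end

end SQWave

namespace SQWave

/-! ### Mean square approximation of networks by the periodic wave -/

section

variable {n : ℕ} {D : Measure ℝ} [IsProbabilityMeasure D] {c : ℝ}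

local notation "Pn" => Measure.pi fun _ : Fin n => D

lemma integral_exp_centredSum_le {K α : ℝ} (hK : 0 ≤ K)
    (hi : Integrable (fun x => Real.exp (α * (x - c))) D)
    (hI : ∫ x, Real.exp (α * (x - c)) ∂D ≤ Real.exp (K * α ^ 2)) (S : Finset (Fin n)) :
    Integrable (fun x => Real.exp (α * centredSum c S x)) (Pn) ∧
    ∫ x, Real.exp (α * centredSum c S x) ∂(Pn) ≤ Real.exp (K * α ^ 2 * n) := by
  set f : Fin n → ℝ → ℝ := fun i y => if i ∈ S then Real.exp (α * (y - c)) else 1 with hf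
  have h1 : (fun x => Real.exp (α * centredSum c S x)) = fun x : Fin n → ℝ => ∏ i, f i (x i) := by
    funext x
    rw [centredSum, Finset.mul_sum, Real.exp_sum]
    simp only [hf]
    rw [Finset.prod_ite_mem, Finset.univ_inter]
  rw [h1]
  constructor
  · refine Integrable.fintype_prod fun i => ?_
    simp only [hf]
    split_ifs
    · exact hi
    · exact integrable_const _
  · rw [integral_fintype_prod_eq_prod]
    calc ∏ i, ∫ y, f i y ∂D ≤ ∏ _i : Fin n, Real.exp (K * α ^ 2) := by
          refine Finset.prod_le_prod (fun i _ => integral_nonneg fun y => ?_) fun i _ => ?_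
          · simp only [hf]
            split_ifs
            · exact (Real.exp_pos _).le
            · exact zero_le_one
          · simp only [hf]
            split_ifs
            · exact hI
            · simp only [integral_const, probReal_univ, smul_eq_mul, mul_one]
              exact Real.one_le_exp (by positivity)
      _ = _ := by
        rw [Finset.prod_const, Finset.card_univ, Fintype.card_fin, ← Real.exp_nat_mul]
        ring_nf

lemma integral_sum_abs_sq_le (hi : Integrable (fun x => (x - c) ^ 2) D)
    (hI : ∫ x, (x - c) ^ 2 ∂D = 1) :
    Integrable (fun x : Fin n → ℝ => (∑ i, |x i - c|) ^ 2) (Pn) ∧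
    ∫ x : Fin n → ℝ, (∑ i, |x i - c|) ^ 2 ∂(Pn) ≤ (n : ℝ) ^ 2 := by
  have hev : ∀ i : Fin n, Integrable (fun x : Fin n → ℝ => (x i - c) ^ 2) (Pn) := fun i =>
    (measurePreserving_eval (fun _ : Fin n => D) i).integrable_comp_of_integrable hi
  have hev2 : ∀ i : Fin n, ∫ x : Fin n → ℝ, (x i - c) ^ 2 ∂(Pn) = 1 := fun i => by
    have h := integral_map (μ := Pn) (φ := fun x : Fin n → ℝ => x i)
      (measurable_pi_apply i).aemeasurable (f := fun y : ℝ => (y - c) ^ 2) (by fun_prop)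
    rw [(measurePreserving_eval (fun _ : Fin n => D) i).map_eq, hI] at h
    exact h.symm
  have hle : ∀ x : Fin n → ℝ, (∑ i, |x i - c|) ^ 2 ≤ n * ∑ i, (x i - c) ^ 2 := by
    intro x
    have h := sq_sum_le_card_mul_sum_sq (s := (Finset.univ : Finset (Fin n)))
      (f := fun i => |x i - c|)
    simpa [sq_abs] using h
  have hsum : Integrable (fun x : Fin n → ℝ => (n : ℝ) * ∑ i, (x i - c) ^ 2) (Pn) :=
    (integrable_finsetSum _ fun i _ => hev i).const_mul _
  have hint : Integrable (fun x : Fin n → ℝ => (∑ i, |x i - c|) ^ 2) (Pn) := by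
    refine hsum.mono' (((continuous_finsetSum _ fun i _ =>
      ((continuous_apply i).sub continuous_const).abs).pow 2).aestronglyMeasurable)
      (Filter.Eventually.of_forall fun x => ?_)
    rw [Real.norm_eq_abs, abs_of_nonneg (sq_nonneg _)]
    exact hle x
  refine ⟨hint, (integral_mono hint hsum hle).trans (le_of_eq ?_)⟩
  rw [integral_const_mul, integral_finsetSum _ fun i _ => hev i, Finset.sum_congr rfl fun i _ =>
    hev2 i]
  simp [sq]

lemma integral_waveNet_sub_sq_le {s η : ℝ} (hs : 0 ≤ s)
    (hi : Integrable (fun x => (x - c) ^ 2) D) (hI : ∫ x, (x - c) ^ 2 ∂D = 1) (m : ℕ)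
    (W V : Matrix (WaveUnit m) (Fin n) ℝ) (hW : ∀ j i, |W j i - V j i| ≤ η) :
    ∫ x : Fin n → ℝ, (waveNet s m W (fun i => x i - c) - waveNet s m V (fun i => x i - c)) ^ 2
      ∂(Pn) ≤ (Fintype.card (WaveUnit m) * s * η * n) ^ 2 := by
  obtain ⟨h1, h2⟩ := integral_sum_abs_sq_le (n := n) hi hI
  set A : ℝ := Fintype.card (WaveUnit m) * s * η with hA
  calc _ ≤ ∫ x : Fin n → ℝ, A ^ 2 * (∑ i, |x i - c|) ^ 2 ∂(Pn) := by
        refine integral_mono_of_nonneg (Filter.Eventually.of_forall fun _ => sq_nonneg _)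
          (h1.const_mul _) (Filter.Eventually.of_forall fun x => ?_)
        have h := abs_waveNet_sub_le hs m W V hW fun i => x i - c
        simp only
        rw [← sq_abs, ← mul_pow]
        refine pow_le_pow_left₀ (abs_nonneg _) (h.trans (le_of_eq ?_)) 2
        rw [hA]; ring
    _ = A ^ 2 * ∫ x : Fin n → ℝ, (∑ i, |x i - c|) ^ 2 ∂(Pn) := integral_const_mul _ _
    _ ≤ A ^ 2 * (n : ℝ) ^ 2 := by gcongr
    _ = _ := by ring

end

lemma sWave_sub {n : ℕ} (s : ℝ) (m : ℕ) (S : Finset (Fin n)) (x : Fin n → ℝ) (c : ℝ) :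
    sWave s m S (fun i => x i - c) = wave s m (centredSum c S x) := rfl

/-- For large sums only the trivial bound 1 is available. For `0 ≤ γ ≤ 1` it and the tail bound are
both dominated by `C exp (γ (|s y| - 2 m))`. The choice `γ = a / (s √n)` makes `γ s = a / √n`, at
which the exponential moments of the sum are bounded independently of `n` and `s`. -/
theorem exists_integral_wave_sub_psi_sq_le : ∃ C a : ℝ, 0 < C ∧ 0 < a ∧ ∀ (D : Measure ℝ),
    IsProbabilityMeasure D → IsLogConcave D → variance (fun x : ℝ => x) D = 1 →
    ∀ (n : ℕ), 1 ≤ n → ∀ (s : ℝ), 1 ≤ s → ∀ (m : ℕ) (S : Finset (Fin n)),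
      ∫ x, (wave s m (centredSum (∫ y, y ∂D) S x) - psi (s * centredSum (∫ y, y ∂D) S x)) ^ 2
        ∂(Measure.pi fun _ => D) ≤ C * Real.exp (-(2 * m * (a / (s * √n)))) := by
  obtain ⟨a₀, K, ha₀, hK, hmgf⟩ := exists_exp_moment_bound
  obtain ⟨C, hC1, hC⟩ := exists_psi_sub_wave_le
  set a := min a₀ 1 with ha
  have ha0 : 0 < a := lt_min ha₀ one_pos
  have ha1 : a ≤ 1 := min_le_right _ _
  have haa : a ≤ a₀ := min_le_left _ _
  refine ⟨C * (2 * Real.exp (K * a ^ 2)), a, by positivity, ha0,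
    fun D _ hD hv n hn s hs m S => ?_⟩
  set c := ∫ y, y ∂D
  have hn' : (1 : ℝ) ≤ n := by exact_mod_cast hn
  have hsn : 1 ≤ √(n : ℝ) := Real.one_le_sqrt.2 hn'
  set β := a / √(n : ℝ) with hβ
  have hβ0 : 0 ≤ β := by positivity
  have hβa : β ≤ a := div_le_self ha0.le hsn
  have hβsq : β ^ 2 * n = a ^ 2 := by
    rw [hβ, div_pow, Real.sq_sqrt (by positivity)]; field_simp
  obtain ⟨hi1, hI1⟩ := hmgf D ‹_› hD hv β (by rw [abs_of_nonneg hβ0]; linarith)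
  obtain ⟨hi2, hI2⟩ := hmgf D ‹_› hD hv (-β) (by rw [abs_neg, abs_of_nonneg hβ0]; linarith)
  obtain ⟨hj1, hJ1⟩ := integral_exp_centredSum_le (n := n) hK.le hi1 hI1 S
  obtain ⟨hj2, hJ2⟩ := integral_exp_centredSum_le (n := n) hK.le hi2 hI2 S
  rw [neg_sq, mul_assoc, hβsq] at hJ2
  rw [mul_assoc, hβsq] at hJ1
  set γ := a / (s * √n) with hγ
  have hγ0 : 0 ≤ γ := by positivity
  have hγ1 : γ ≤ 1 := by
    rw [hγ, div_le_one (by positivity)]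
    nlinarith
  have hγs : γ * s = β := by
    rw [hγ, hβ]; field_simp
  have hs0 : s ≠ 0 := by linarith
  have hpt : ∀ x : Fin n → ℝ, (wave s m (centredSum c S x) - psi (s * centredSum c S x)) ^ 2 ≤
      C * Real.exp (-(2 * m * γ)) * (Real.exp (β * centredSum c S x) +
        Real.exp (-β * centredSum c S x)) := by
    intro x
    set y := centredSum c S x
    have h1 := wave_le_psi hs0 m y
    have h2 := psi_sub_wave_le_one hs0 m y
    have h3 := hC s hs0 m y
    -- The difference lies in `[0, 1]`, so it dominates its own square.
    have h4 : (wave s m y - psi (s * y)) ^ 2 ≤ psi (s * y) - wave s m y := by nlinarith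
    have h5 : psi (s * y) - wave s m y ≤ C * Real.exp (γ * (|s * y| - 2 * m)) := by
      rcases le_total 0 (|s * y| - 2 * m) with h | h
      · refine h2.trans (one_le_mul_of_one_le_of_one_le hC1 (Real.one_le_exp (by positivity)))
      · refine h3.trans (mul_le_mul_of_nonneg_left (Real.exp_le_exp.2 ?_) (by linarith))
        nlinarith
    have h6 : Real.exp (γ * (|s * y| - 2 * m)) = Real.exp (-(2 * m * γ)) * Real.exp (β * |y|) := by
      rw [← Real.exp_add, ← hγs, abs_mul, abs_of_pos (by linarith : 0 < s)]
      ring_nf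
    have h7 : Real.exp (β * |y|) ≤ Real.exp (β * y) + Real.exp (-β * y) := by
      rcases abs_choice y with h | h <;> rw [h]
      · linarith [Real.exp_pos (-β * y)]
      · rw [mul_neg, ← neg_mul]; linarith [Real.exp_pos (β * y)]
    calc _ ≤ C * Real.exp (γ * (|s * y| - 2 * m)) := h4.trans h5
      _ = C * Real.exp (-(2 * m * γ)) * Real.exp (β * |y|) := by rw [h6]; ring
      _ ≤ _ := by gcongr
  have h := integral_mono_of_nonneg (μ := Measure.pi fun _ : Fin n => D)
    (Filter.Eventually.of_forall fun _ => sq_nonneg _)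
    ((hj1.add hj2).const_mul (C * Real.exp (-(2 * m * γ)))) (Filter.Eventually.of_forall hpt)
  refine h.trans ?_
  simp only [Pi.add_apply]
  rw [integral_const_mul, integral_add hj1 hj2]
  calc _ ≤ C * Real.exp (-(2 * m * γ)) * (Real.exp (K * a ^ 2) + Real.exp (K * a ^ 2)) := by
        gcongr
    _ = _ := by ring

end SQWave

namespace SQWave

/-! ### Adaptive algorithms and reference oracles -/

section

variable {n : ℕ} {L : ℝ}

/-- The first (at most `q`) queries asked when queries are answered by `O`. -/
noncomputable def Algo.trace (O : Query n L → ℝ) : Algo n L → ℕ → List (Query n L)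
  | .output _ _, _ => []
  | .query _ _, 0 => []
  | .query h next, q + 1 => h :: (next (O h)).trace O q

lemma Algo.length_trace_le (O : Query n L → ℝ) (A : Algo n L) (q : ℕ) :
    (A.trace O q).length ≤ q := by
  induction A generalizing q with
  | output g hg => simp [Algo.trace]
  | query h next ih =>
    cases q with
    | zero => simp [Algo.trace]
    | succ q => simpa [Algo.trace] using ih (O h) q

lemma Algo.measurable_run (O : Query n L → ℝ) (A : Algo n L) : Measurable (A.run O) := by
  induction A with
  | output g hg => simpa [Algo.run] using hg
  | query h next ih => simpa [Algo.run] using ih (O h)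

/-- Two oracles which agree on the queries asked lead to the same hypothesis. -/
lemma Algo.run_eq_of_trace {O O' : Query n L → ℝ} (A : Algo n L) {q : ℕ}
    (hq : A.numQueries O' ≤ q) (h : ∀ k ∈ A.trace O q, O' k = O k) : A.run O' = A.run O := by
  induction A generalizing q with
  | output g hg => simp [Algo.run]
  | query k next ih =>
    cases q with
    | zero => simp [Algo.numQueries] at hq
    | succ q =>
      simp only [Algo.numQueries, Nat.add_le_add_iff_right] at hq
      simp only [Algo.trace, List.mem_cons, forall_eq_or_imp] at h
      rw [Algo.run, Algo.run, h.1]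
      rw [h.1] at hq
      exact ih (O k) hq h.2

open scoped Classical in
lemma card_filter_exists_mem_list_le {ι κ : Type*} (s : Finset ι) (bad : κ → ι → Prop)
    {β : ℝ} (l : List κ) (hβ : ∀ k, (({S ∈ s | bad k S} : Finset ι).card : ℝ) ≤ β) :
    (({S ∈ s | ∃ k ∈ l, bad k S} : Finset ι).card : ℝ) ≤ l.length * β := by
  induction l with
  | nil => simp
  | cons k l ih =>
    have hsub : ({S ∈ s | ∃ k' ∈ k :: l, bad k' S} : Finset ι) ⊆
        {S ∈ s | bad k S} ∪ {S ∈ s | ∃ k' ∈ l, bad k' S} := by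
      intro S hS
      simp only [Finset.mem_filter, List.mem_cons, exists_eq_or_imp, Finset.mem_union] at hS ⊢
      tauto
    have h1 : (({S ∈ s | ∃ k' ∈ k :: l, bad k' S} : Finset ι).card : ℝ) ≤
        ({S ∈ s | bad k S} : Finset ι).card + ({S ∈ s | ∃ k' ∈ l, bad k' S} : Finset ι).card := by
      exact_mod_cast (Finset.card_le_card hsub).trans (Finset.card_union_le _ _)
    rw [List.length_cons]
    push_cast
    linarith [hβ k]

open scoped Classical in
/-- The counting bound behind the query lower bound: if every query distinguishes few targets
from a reference oracle, and every hypothesis is good for few targets, then many queries are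
needed. -/
theorem card_div_two_le_of_weaklyLearns {ι : Type*} (s : Finset ι) (P : Measure (Fin n → ℝ))
    (t : ℕ) (F : Set ((Fin n → ℝ) → ℝ)) (f : ι → (Fin n → ℝ) → ℝ) (hf : ∀ S ∈ s, f S ∈ F)
    {Ω : Type} [MeasurableSpace Ω] (ρ : Measure Ω) [IsProbabilityMeasure ρ] (A : Ω → Algo n L)
    (q : ℕ) (hq : UsesAtMost P t F A q) (hA : WeaklyLearns P t F ρ A) (O₀ : Query n L → ℝ)
    {β γ : ℝ} (hβ0 : 0 ≤ β)
    (hβ : ∀ h : Query n L, (({S ∈ s | 1 / (t : ℝ) <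
      |∫ x, h.toFun x (f S x) ∂P - O₀ h|} : Finset ι).card : ℝ) ≤ β)
    (hγ : ∀ g : (Fin n → ℝ) → ℝ, Measurable g →
      (({S ∈ s | BeatsConstants P (1 / √(t : ℝ)) g (f S)} : Finset ι).card : ℝ) ≤ γ) :
    (s.card : ℝ) / 2 ≤ q * β + γ := by
  set bad : Query n L → ι → Prop := fun h S => 1 / (t : ℝ) < |∫ x, h.toFun x (f S x) ∂P - O₀ h|
    with hbad
  -- Both branches respect the tolerance `1 / t`, so this is a valid oracle for `f S`, and it
  -- differs from `O₀` only on queries that distinguish `S`.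
  set O : ι → Query n L → ℝ := fun S h => if bad h S then ∫ x, h.toFun x (f S x) ∂P else O₀ h
    with hO
  have hV : ∀ S, IsVSTAT P (f S) t (O S) := by
    intro S h
    simp only [hO]
    by_cases hb : bad h S
    · rw [if_pos hb, sub_self, abs_zero]
      exact le_max_of_le_left (by positivity)
    · rw [if_neg hb]
      exact le_max_of_le_left (not_lt.1 hb)
  choose! G hGm hG2 hGb using fun S (hS : S ∈ s) => hA (f S) (hf S hS) (O S) (hV S)
  have hpt : ∀ ω, (({S ∈ s | ω ∈ G S} : Finset ι).card : ℝ) ≤ q * β + γ := by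
    intro ω
    set l := (A ω).trace O₀ q with hl
    have hsub : ({S ∈ s | ω ∈ G S} : Finset ι) ⊆ {S ∈ s | ∃ k ∈ l, bad k S} ∪
        {S ∈ s | BeatsConstants P (1 / √(t : ℝ)) ((A ω).run O₀) (f S)} := by
      intro S hS
      rw [Finset.mem_filter] at hS
      rw [Finset.mem_union, Finset.mem_filter, Finset.mem_filter]
      by_cases hb : ∃ k ∈ l, bad k S
      · exact Or.inl ⟨hS.1, hb⟩
      · push Not at hb
        refine Or.inr ⟨hS.1, ?_⟩
        -- The query bound is known only for the valid oracle `O S`; `O₀` need not be valid for any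
        -- target. This is why the run under `O₀` is truncated after `q` queries.
        have hrun : (A ω).run (O S) = (A ω).run O₀ :=
          (A ω).run_eq_of_trace (hq (f S) (hf S hS.1) (O S) (hV S) ω) fun k hk => by
            simp only [hO]; rw [if_neg (hb k hk)]
        rw [← hrun]
        exact hGb S hS.1 ω hS.2
    have h1 : (({S ∈ s | ω ∈ G S} : Finset ι).card : ℝ) ≤
        ({S ∈ s | ∃ k ∈ l, bad k S} : Finset ι).card +
        ({S ∈ s | BeatsConstants P (1 / √(t : ℝ)) ((A ω).run O₀) (f S)} : Finset ι).card := by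
      exact_mod_cast (Finset.card_le_card hsub).trans (Finset.card_union_le _ _)
    have h2 := card_filter_exists_mem_list_le s bad l hβ
    have h3 := hγ _ ((A ω).measurable_run O₀)
    have h4 : (l.length : ℝ) ≤ q := by exact_mod_cast (A ω).length_trace_le O₀ q
    have h5 : (l.length : ℝ) * β ≤ q * β := by gcongr
    linarith
  -- Double counting: the success probabilities sum to the mean number of targets for which a seed
  -- succeeds.
  have hint : ∑ S ∈ s, ρ.real (G S) = ∫ ω, (({S ∈ s | ω ∈ G S} : Finset ι).card : ℝ) ∂ρ := by
    have h1 : ∀ ω, (({S ∈ s | ω ∈ G S} : Finset ι).card : ℝ) =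
        ∑ S ∈ s, (G S).indicator (fun _ => (1 : ℝ)) ω := by
      intro ω
      rw [Finset.card_filter]
      push_cast
      refine Finset.sum_congr rfl fun S _ => ?_
      rw [Set.indicator_apply]
    simp_rw [h1]
    rw [integral_finsetSum _ fun S hS => (integrable_const _).indicator (hGm S hS)]
    refine Finset.sum_congr rfl fun S hS => ?_
    rw [integral_indicator_const _ (hGm S hS), smul_eq_mul, mul_one]
  have hlow : (s.card : ℝ) / 2 ≤ ∑ S ∈ s, ρ.real (G S) := by
    have : ∀ S ∈ s, (1 : ℝ) / 2 ≤ ρ.real (G S) := by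
      intro S hS
      have h2 := ENNReal.toReal_mono (measure_ne_top ρ (G S)) (hG2 S hS)
      rw [measureReal_def]
      refine le_trans (le_of_eq ?_) h2
      simp
    have h3 := Finset.card_nsmul_le_sum s _ _ this
    rw [nsmul_eq_mul] at h3
    linarith
  rw [hint] at hlow
  refine hlow.trans ?_
  have h6 : ∫ ω, (({S ∈ s | ω ∈ G S} : Finset ι).card : ℝ) ∂ρ ≤ ∫ _ω, (q * β + γ) ∂ρ :=
    integral_mono_of_nonneg (Filter.Eventually.of_forall fun _ => by positivity)
      (integrable_const _) (Filter.Eventually.of_forall hpt)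
  simpa using h6

end

end SQWave

namespace SQWave

/-! ### Bounds for singular values -/

section

variable {E F : Type*} [NormedAddCommGroup E] [InnerProductSpace ℝ E] [FiniteDimensional ℝ E]
  [NormedAddCommGroup F] [InnerProductSpace ℝ F] [FiniteDimensional ℝ F]

lemma norm_sq_eq_sum_eigenvalues (T : E →ₗ[ℝ] F) (x : E) : ‖T x‖ ^ 2 =
    ∑ i, T.isSymmetric_adjoint_comp_self.eigenvalues rfl i *
      (inner ℝ (T.isSymmetric_adjoint_comp_self.eigenvectorBasis rfl i) x) ^ 2 := by
  set hT := T.isSymmetric_adjoint_comp_self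
  have h1 : ‖T x‖ ^ 2 = inner ℝ ((LinearMap.adjoint T ∘ₗ T) x) x := by
    rw [LinearMap.comp_apply, LinearMap.adjoint_inner_left, real_inner_self_eq_norm_sq]
  rw [h1, ← (hT.eigenvectorBasis rfl).sum_inner_mul_inner]
  refine Finset.sum_congr rfl fun i _ => ?_
  rw [hT, hT.apply_eigenvectorBasis, inner_smul_right, real_inner_comm x]
  simp
  ring

/-- A lower bound for a linear map on a subspace of dimension larger than `r` bounds its `r`-th
singular value from below. -/
lemma le_singularValues_of_le_norm {V : Type*} [AddCommGroup V] [Module ℝ V]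
    [FiniteDimensional ℝ V] (T : E →ₗ[ℝ] F) (J : V →ₗ[ℝ] E) (hJ : Function.Injective J) {r : ℕ}
    (hr : r < Module.finrank ℝ V) {c : ℝ} (hc : 0 ≤ c)
    (h : ∀ y, c * ‖J y‖ ≤ ‖T (J y)‖) : c ≤ T.singularValues r := by
  have hrE : r < Module.finrank ℝ E := hr.trans_le (LinearMap.finrank_le_finrank_of_injective hJ)
  set hT := T.isSymmetric_adjoint_comp_self
  set b := hT.eigenvectorBasis rfl
  -- Courant–Fischer: orthogonality to the top `r` eigenvectors imposes `r` conditions on a space of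
  -- larger dimension. On a nonzero solution `T` stretches by at most the singular value of index
  -- `r`, counted from 0.
  set Φ : V →ₗ[ℝ] (Fin r → ℝ) := LinearMap.pi fun i =>
    (innerₛₗ ℝ (b ⟨i, i.2.trans hrE⟩)).comp J with hΦ
  have hker : LinearMap.ker Φ ≠ ⊥ := LinearMap.ker_ne_bot_of_finrank_lt (by simpa using hr)
  obtain ⟨y, hy, hy0⟩ := Submodule.exists_mem_ne_zero_of_ne_bot hker
  have hJy : J y ≠ 0 := fun h0 => hy0 (hJ (by rw [h0, map_zero]))
  have horth : ∀ i : Fin (Module.finrank ℝ E), (i : ℕ) < r → inner ℝ (b i) (J y) = 0 := by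
    intro i hi
    have := congrFun (LinearMap.mem_ker.1 hy) ⟨i, hi⟩
    simpa [hΦ] using this
  have h1 : ‖T (J y)‖ ^ 2 ≤ T.singularValues r ^ 2 * ‖J y‖ ^ 2 := by
    rw [norm_sq_eq_sum_eigenvalues, T.sq_singularValues_of_lt rfl hrE,
      ← b.sum_sq_norm_inner_right, Finset.mul_sum]
    refine Finset.sum_le_sum fun i _ => ?_
    rw [Real.norm_eq_abs, sq_abs]
    rcases lt_or_ge (i : ℕ) r with hi | hi
    · rw [horth i hi]; simp
    · refine mul_le_mul_of_nonneg_right ?_ (sq_nonneg _)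
      exact hT.eigenvalues_antitone rfl (Fin.mk_le_of_le_val hi)
  have h2 : (c * ‖J y‖) ^ 2 ≤ (T.singularValues r * ‖J y‖) ^ 2 := by
    rw [mul_pow (T.singularValues r)]
    exact (pow_le_pow_left₀ (by positivity) (h y) 2).trans h1
  have h3 := (sq_le_sq₀ (by positivity) (mul_nonneg (T.singularValues_nonneg r)
    (norm_nonneg _))).1 h2
  exact le_of_mul_le_mul_right h3 (norm_pos_iff.2 hJy)

lemma singularValues_zero_le (T : E →ₗ[ℝ] F) {C : ℝ} (hC : 0 ≤ C) (h : ∀ x, ‖T x‖ ≤ C * ‖x‖) :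
    T.singularValues 0 ≤ C := by
  rcases Nat.eq_zero_or_pos (Module.finrank ℝ E) with h0 | h0
  · rw [T.singularValues_of_finrank_le h0.le]
    exact hC
  set hT := T.isSymmetric_adjoint_comp_self
  set b := hT.eigenvectorBasis rfl
  have h1 : T.singularValues 0 ^ 2 = ‖T (b ⟨0, h0⟩)‖ ^ 2 := by
    rw [norm_sq_eq_sum_eigenvalues, T.sq_singularValues_of_lt rfl h0,
      Finset.sum_eq_single ⟨0, h0⟩]
    · rw [real_inner_self_eq_norm_sq, b.norm_eq_one]; simp
    · intro i _ hi
      rw [b.inner_eq_zero hi]; simp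
    · simp
  have h2 := h (b ⟨0, h0⟩)
  rw [b.norm_eq_one, mul_one] at h2
  refine le_of_sq_le_sq ?_ hC
  rw [h1]
  exact pow_le_pow_left₀ (norm_nonneg _) h2 2

end

/-! ### Well-conditioned perturbations of the weight matrices -/

/-- Quantitative injectivity of `x ↦ a 1 + η x`. Summing the coordinates in `S` gives `(|S| + η) a`,
without cancellation as `η ≥ 0`, so the image controls `a`; then `η x i` is the image coordinate
minus `a`. -/
lemma sq_mul_sum_sq_le {d n : ℕ} (hdn : d ≤ n) (hn : 1 ≤ n) {η : ℝ} (hη : 0 ≤ η)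
    (S : Finset (Fin d)) (x : Fin d → ℝ) :
    η ^ 2 * ∑ i, x i ^ 2 ≤ 4 * (n : ℝ) ^ 2 * ∑ i, (∑ k ∈ S, x k + η * x i) ^ 2 := by
  set a := ∑ k ∈ S, x k with ha
  set Q := ∑ i, (a + η * x i) ^ 2 with hQ
  have hn' : (1 : ℝ) ≤ n := by exact_mod_cast hn
  have hdn' : (d : ℝ) ≤ n := by exact_mod_cast hdn
  have hQ0 : 0 ≤ Q := Finset.sum_nonneg fun _ _ => sq_nonneg _
  have haQ : a ^ 2 ≤ Q := by
    rcases S.eq_empty_or_nonempty with rfl | hne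
    · simp only [ha, Finset.sum_empty]
      simpa using hQ0
    have hk : (1 : ℝ) ≤ S.card := by exact_mod_cast hne.card_pos
    have h1 : ∑ i ∈ S, (a + η * x i) = (S.card + η) * a := by
      rw [Finset.sum_add_distrib, ← Finset.mul_sum, ← ha]
      simp
      ring
    have h2 : ((S.card + η) * a) ^ 2 ≤ S.card * Q := by
      rw [← h1]
      refine sq_sum_le_card_mul_sum_sq.trans ?_
      gcongr
      exact Finset.sum_le_univ_sum_of_nonneg fun _ => sq_nonneg _
    have h3 : (S.card : ℝ) * a ^ 2 ≤ ((S.card + η) * a) ^ 2 := by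
      rw [mul_pow]
      refine mul_le_mul_of_nonneg_right ?_ (sq_nonneg _)
      nlinarith
    exact le_of_mul_le_mul_left (h3.trans h2) (by linarith)
  calc η ^ 2 * ∑ i, x i ^ 2 ≤ ∑ i, (2 * (a + η * x i) ^ 2 + 2 * a ^ 2) := by
        rw [Finset.mul_sum]
        refine Finset.sum_le_sum fun i _ => ?_
        nlinarith [sq_nonneg (2 * a + η * x i)]
    _ = 2 * Q + d * (2 * a ^ 2) := by
        rw [Finset.sum_add_distrib, ← Finset.mul_sum]; simp [hQ]
    _ ≤ 2 * Q + n * (2 * Q) := by gcongr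
    _ ≤ 4 * (n : ℝ) ^ 2 * Q := by
        have h : 1 + (n : ℝ) ≤ 2 * n ^ 2 := by nlinarith
        nlinarith [mul_le_mul_of_nonneg_right h hQ0]

lemma norm_toEuclideanLin_sq {ι : Type} [Fintype ι] [DecidableEq ι] {n : ℕ}
    (W : Matrix ι (Fin n) ℝ) (x : EuclideanSpace ℝ (Fin n)) :
    ‖Matrix.toEuclideanLin W x‖ ^ 2 = ∑ j, (∑ i, W j i * x i) ^ 2 := by
  rw [EuclideanSpace.norm_sq_eq]
  refine Finset.sum_congr rfl fun j _ => ?_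
  rw [Real.norm_eq_abs, sq_abs]
  rfl

lemma norm_toEuclideanLin_le {ι : Type} [Fintype ι] [DecidableEq ι] {n : ℕ}
    (W : Matrix ι (Fin n) ℝ) (hW : ∀ j i, |W j i| ≤ 2) (x : EuclideanSpace ℝ (Fin n)) :
    ‖Matrix.toEuclideanLin W x‖ ≤ 2 * (Fintype.card ι * n) * ‖x‖ := by
  refine le_of_sq_le_sq ?_ (by positivity)
  rw [norm_toEuclideanLin_sq]
  have h1 : ∀ j, (∑ i, W j i * x i) ^ 2 ≤ (n * 4) * ‖x‖ ^ 2 := by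
    intro j
    refine (Finset.sum_mul_sq_le_sq_mul_sq _ _ _).trans ?_
    rw [EuclideanSpace.norm_sq_eq]
    simp only [Real.norm_eq_abs, sq_abs]
    refine mul_le_mul_of_nonneg_right ?_ (Finset.sum_nonneg fun _ _ => sq_nonneg _)
    have := Finset.sum_le_card_nsmul Finset.univ (fun i => W j i ^ 2) 4 fun i _ => by
      rw [← sq_abs]; nlinarith [hW j i, abs_nonneg (W j i)]
    simpa using this
  have h2 := Finset.sum_le_card_nsmul Finset.univ _ _ fun j _ => h1 j
  rw [nsmul_eq_mul, Finset.card_univ] at h2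
  refine h2.trans ?_
  rw [mul_pow, ← mul_assoc]
  refine mul_le_mul_of_nonneg_right ?_ (sq_nonneg _)
  have h3 : ((Fintype.card ι * n : ℕ) : ℝ) ≤ ((Fintype.card ι * n : ℕ) : ℝ) ^ 2 := by
    exact_mod_cast Nat.le_self_pow two_ne_zero _
  push_cast at h3
  nlinarith

/-- The embedding of a coordinate subspace. -/
noncomputable def coordEmbedding {d n : ℕ} (_hd : d ≤ n) :
    (Fin d → ℝ) →ₗ[ℝ] EuclideanSpace ℝ (Fin n) where
  toFun y := WithLp.toLp 2 fun i => if h : (i : ℕ) < d then y ⟨i, h⟩ else 0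
  map_add' y z := by
    ext i
    simp only [PiLp.add_apply]
    split_ifs <;> simp
  map_smul' c y := by
    ext i
    simp only [PiLp.smul_apply, RingHom.id_apply]
    split_ifs <;> simp

lemma coordEmbedding_castLE {d n : ℕ} (hd : d ≤ n) (y : Fin d → ℝ) (i : Fin d) :
    coordEmbedding hd y (Fin.castLE hd i) = y i := by
  have : ((Fin.castLE hd i : Fin n) : ℕ) < d := by simp
  exact dif_pos this

lemma coordEmbedding_of_not_lt {d n : ℕ} (hd : d ≤ n) (y : Fin d → ℝ) {i : Fin n}
    (hi : ¬ (i : ℕ) < d) : coordEmbedding hd y i = 0 := dif_neg hi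

lemma coordEmbedding_injective {d n : ℕ} (hd : d ≤ n) :
    Function.Injective (coordEmbedding hd) := fun y z hyz => by
  funext i
  rw [← coordEmbedding_castLE hd y i, ← coordEmbedding_castLE hd z i, hyz]

lemma sum_eq_sum_castLE {d n : ℕ} (hd : d ≤ n) (f : Fin n → ℝ)
    (hf : ∀ i : Fin n, ¬ (i : ℕ) < d → f i = 0) :
    ∑ i, f i = ∑ i : Fin d, f (Fin.castLE hd i) := by
  rw [← Finset.sum_image (s := Finset.univ) (f := f) (g := Fin.castLE hd)
    fun a _ b _ hab => Fin.castLE_injective hd hab]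
  symm
  refine Finset.sum_subset (Finset.subset_univ _) fun i _ hi => hf i fun hlt => hi ?_
  exact Finset.mem_image.2 ⟨⟨i, hlt⟩, Finset.mem_univ _, rfl⟩

/-- The weight matrix with rows `± (1_S + η e_j)`, where each unit `j` has its own coordinate as
long as there are enough coordinates. -/
noncomputable def diagWeights {n : ℕ} (m : ℕ) (η : ℝ) (S : Finset (Fin n)) :
    Matrix (WaveUnit m) (Fin n) ℝ :=
  Matrix.of fun j i => (if j.2 then (1 : ℝ) else -1) *
    ((if i ∈ S then 1 else 0) + if (Fintype.equivFin (WaveUnit m) j : ℕ) = i then η else 0)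

lemma abs_diagWeights_sub_le {n : ℕ} (m : ℕ) {η : ℝ} (hη : 0 ≤ η) (S : Finset (Fin n))
    (j : WaveUnit m) (i : Fin n) : |diagWeights m η S j i - waveWeights m S j i| ≤ η := by
  have h : diagWeights m η S j i - waveWeights m S j i = (if j.2 then (1 : ℝ) else -1) *
      (if (Fintype.equivFin (WaveUnit m) j : ℕ) = i then η else 0) := by
    simp only [diagWeights, waveWeights, Matrix.of_apply, mul_add]
    by_cases hi : i ∈ S <;> simp [hi]
  rw [h, abs_mul]
  have h1 : |if j.2 then (1 : ℝ) else -1| = 1 := by split_ifs <;> simp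
  rw [h1, one_mul]
  split_ifs
  · rw [abs_of_nonneg hη]
  · simpa using hη

/-- Only the `d` units matched with the first `d` coordinates are kept, since other rows can only
increase the norm. Row signs disappear on squaring. Taking `d` as the smaller dimension handles both
wide and tall matrices. -/
lemma le_norm_diagWeights {d n m : ℕ} (hd : d ≤ n) (hn : 1 ≤ n)
    (hdN : d ≤ Fintype.card (WaveUnit m)) {η : ℝ} (hη : 0 ≤ η) (S : Finset (Fin n))
    (y : Fin d → ℝ) : η / (2 * n) * ‖coordEmbedding hd y‖ ≤
      ‖Matrix.toEuclideanLin (diagWeights m η S) (coordEmbedding hd y)‖ := by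
  have hn' : (1 : ℝ) ≤ n := by exact_mod_cast hn
  refine le_of_sq_le_sq ?_ (norm_nonneg _)
  rw [mul_pow, norm_toEuclideanLin_sq, EuclideanSpace.norm_sq_eq]
  simp only [Real.norm_eq_abs, sq_abs]
  rw [sum_eq_sum_castLE hd (fun i => coordEmbedding hd y i ^ 2) fun i hi => by
    rw [coordEmbedding_of_not_lt hd y hi]; simp]
  simp only [coordEmbedding_castLE]
  set S' : Finset (Fin d) := Finset.univ.filter fun i => Fin.castLE hd i ∈ S with hS'
  have h1 := sq_mul_sum_sq_le hd hn hη S' y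
  set g : Fin d → WaveUnit m := fun i => (Fintype.equivFin (WaveUnit m)).symm (Fin.castLE hdN i)
    with hg
  have hginj : Function.Injective g := fun a b hab =>
    Fin.castLE_injective _ ((Fintype.equivFin (WaveUnit m)).symm.injective hab)
  have hgval : ∀ i, (Fintype.equivFin (WaveUnit m) (g i) : ℕ) = i := fun i => by
    simp only [hg, Equiv.apply_symm_apply, Fin.val_castLE]
  have h3 : ∀ i : Fin d, (∑ k, diagWeights m η S (g i) k * coordEmbedding hd y k) ^ 2 =
      (∑ k ∈ S', y k + η * y i) ^ 2 := by
    intro i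
    rw [sum_eq_sum_castLE hd (fun k => diagWeights m η S (g i) k * coordEmbedding hd y k)
      fun k hk => by rw [coordEmbedding_of_not_lt hd y hk, mul_zero]]
    simp only [coordEmbedding_castLE, diagWeights, Matrix.of_apply, mul_assoc, hgval]
    rw [← Finset.mul_sum, mul_pow]
    have hsgn : (if (g i).2 then (1 : ℝ) else -1) ^ 2 = 1 := by split_ifs <;> norm_num
    rw [hsgn, one_mul]
    congr 1
    simp only [add_mul, ite_mul, one_mul, zero_mul]
    rw [Finset.sum_add_distrib, hS', Finset.sum_filter]
    congr 1
    rw [Finset.sum_eq_single i]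
    · simp
    · intro k _ hk
      rw [if_neg]
      intro h
      exact hk (Fin.ext h.symm)
    · simp
  have h2 : ∑ i : Fin d, (∑ k ∈ S', y k + η * y i) ^ 2 ≤
      ∑ j, (∑ i, diagWeights m η S j i * coordEmbedding hd y i) ^ 2 := by
    rw [← Finset.sum_congr rfl fun i _ => h3 i,
      ← Finset.sum_image (s := Finset.univ) (g := g)
        (f := fun j => (∑ k, diagWeights m η S j k * coordEmbedding hd y k) ^ 2)
        fun a _ b _ hab => hginj hab]
    exact Finset.sum_le_univ_sum_of_nonneg fun _ => sq_nonneg _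
  have h4 : (η / (2 * n)) ^ 2 * ∑ i, y i ^ 2 =
      (η ^ 2 * ∑ i, y i ^ 2) / (4 * (n : ℝ) ^ 2) := by
    rw [div_pow, div_mul_eq_mul_div]; ring
  rw [h4, div_le_iff₀ (by positivity)]
  refine h1.trans ?_
  rw [mul_comm]
  gcongr

theorem condNumber_diagWeights_le {n : ℕ} (hn : 1 ≤ n) (m : ℕ) {η : ℝ} (hη0 : 0 < η)
    (hη1 : η ≤ 1) (S : Finset (Fin n)) : condNumber (diagWeights m η S) ≤
      ENNReal.ofReal (2 * (Fintype.card (WaveUnit m) * n) / (η / (2 * n))) := by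
  have hN1 : 1 ≤ Fintype.card (WaveUnit m) := by rw [card_waveUnit]; omega
  have hn' : (1 : ℝ) ≤ n := by exact_mod_cast hn
  have hbound : ∀ j i, |diagWeights m η S j i| ≤ 2 := by
    intro j i
    have h1 : |waveWeights m S j i| ≤ 1 := by
      simp only [waveWeights, Matrix.of_apply]
      split_ifs <;> simp
    have h2 := abs_sub_abs_le_abs_sub (diagWeights m η S j i) (waveWeights m S j i)
    linarith [abs_diagWeights_sub_le m hη0.le S j i]
  have hd1 : 1 ≤ min (Fintype.card (WaveUnit m)) n := le_min hN1 hn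
  have hσr := le_singularValues_of_le_norm (Matrix.toEuclideanLin (diagWeights m η S))
    (coordEmbedding (min_le_right _ _)) (coordEmbedding_injective _)
    (r := min (Fintype.card (WaveUnit m)) n - 1)
    (by rw [Module.finrank_fin_fun]; omega) (by positivity)
    (le_norm_diagWeights (min_le_right _ _) hn (min_le_left _ _) hη0.le S)
  have hσ0 := singularValues_zero_le (Matrix.toEuclideanLin (diagWeights m η S)) (by positivity)
    (norm_toEuclideanLin_le _ hbound)
  have hc0 : 0 < η / (2 * n) := by positivity
  simp only [condNumber]
  rw [if_neg (hc0.trans_le hσr).ne']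
  refine ENNReal.ofReal_le_ofReal ?_
  gcongr

end SQWave

namespace SQWave

/-! ### Few targets are distinguished by a query or approximated by a hypothesis -/

lemma memLp_of_continuous_of_abs_le {X : Type*} [TopologicalSpace X] [MeasurableSpace X]
    [OpensMeasurableSpace X] {P : Measure X} [IsProbabilityMeasure P]
    {f : X → ℝ} (hf : Continuous f) {C : ℝ} (hC : ∀ x, |f x| ≤ C) : MemLp f 2 P :=
  MemLp.of_bound hf.measurable.aestronglyMeasurable C (Filter.Eventually.of_forall hC)

lemma abs_waveNet_le {n : ℕ} (s : ℝ) (m : ℕ) (W : Matrix (WaveUnit m) (Fin n) ℝ)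
    (x : Fin n → ℝ) : |waveNet s m W x| ≤ 2 * m + 1 + Fintype.card (WaveUnit m) := by
  rw [waveNet, oneHidden]
  refine (abs_add_le _ _).trans (add_le_add ?_ ?_)
  · rw [abs_neg, abs_of_nonneg (by positivity)]
  · refine (Finset.abs_sum_le_sum_abs _ _).trans ?_
    have := Finset.sum_le_card_nsmul Finset.univ
      (fun j => |sigmoidUnit s (W.mulVec x j + waveBias s m j)|) 1 fun j _ => by
        rw [sigmoidUnit_eq, abs_of_nonneg (Real.sigmoid_nonneg _)]
        exact Real.sigmoid_le_one _
    simpa using this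

section

variable {n : ℕ} {D : Measure ℝ} [IsProbabilityMeasure D] {c ρ : ℝ}

local notation "Pn" => Measure.pi fun _ : Fin n => D

lemma memLp_waveNet (s : ℝ) (m : ℕ) (W : Matrix (WaveUnit m) (Fin n) ℝ) :
    MemLp (fun x : Fin n → ℝ => waveNet s m W fun i => x i - c) 2 (Pn) :=
  memLp_of_continuous_of_abs_le ((continuous_waveNet s m W).comp (by fun_prop))
    fun _ => abs_waveNet_le _ _ _ _

lemma memLp_psi_centredSum (s : ℝ) (S : Finset (Fin n)) :
    MemLp (fun x : Fin n → ℝ => psi (s * centredSum c S x)) 2 (Pn) :=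
  memLp_of_continuous_of_abs_le (C := 1)
    (lipschitzWith_psi.continuous.comp (continuous_const.mul (continuous_centredSum c S)))
    fun _ => by rw [abs_of_nonneg (psi_nonneg _)]; exact psi_le_one _

lemma integral_sq_sub_le_of_triangle {X : Type*} [MeasurableSpace X] {P : Measure X}
    {f g h : X → ℝ} (hf : MemLp f 2 P) (hg : MemLp g 2 P)
    (hh : MemLp h 2 P) {A B : ℝ} (hA : ∫ x, (f x - g x) ^ 2 ∂P ≤ A)
    (hB : ∫ x, (g x - h x) ^ 2 ∂P ≤ B) : ∫ x, (f x - h x) ^ 2 ∂P ≤ 2 * A + 2 * B := by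
  have h1 := (hf.sub hg).integrable_sq
  have h2 := (hg.sub hh).integrable_sq
  simp only [Pi.sub_apply] at h1 h2
  calc _ ≤ ∫ x, (2 * (f x - g x) ^ 2 + 2 * (g x - h x) ^ 2) ∂P := by
        refine integral_mono_of_nonneg (Filter.Eventually.of_forall fun _ => sq_nonneg _)
          ((h1.const_mul 2).add (h2.const_mul 2)) (Filter.Eventually.of_forall fun x => ?_)
        simp only
        nlinarith [sq_nonneg (f x - g x - (g x - h x))]
    _ = 2 * ∫ x, (f x - g x) ^ 2 ∂P + 2 * ∫ x, (g x - h x) ^ 2 ∂P := by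
        rw [integral_add (h1.const_mul 2) (h2.const_mul 2), integral_const_mul,
          integral_const_mul]
    _ ≤ _ := by linarith

open scoped Classical in
-- The tolerance `1 / t` is split in two. One half pays, through the Lipschitz condition on the
-- label, for replacing the target by the periodic wave; the other is the allowed deviation of the
-- angle kernel.
theorem card_distinguished_le
    (hρ : ∀ κ : ℝ, 1 ≤ |κ| → ‖∫ x, Complex.exp ((κ * (x - c) : ℝ) * Complex.I) ∂D‖ ≤ ρ)
    {s lam δ : ℝ} (hs : 1 ≤ s) (hlam : 0 ≤ lam) (hδ : 0 ≤ δ) {t M : ℕ} (ht : 0 < t) (hM : 0 < M)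
    (hMt : lam * Real.pi / √M ≤ 1 / (4 * t)) (hδt : lam * δ ≤ 1 / (2 * t))
    (F : Finset (Finset (Fin n))) (f : Finset (Fin n) → (Fin n → ℝ) → ℝ)
    (hf : ∀ S ∈ F, MemLp (f S) 2 (Pn)) (hfm : ∀ S ∈ F, Measurable (f S))
    (hfδ : ∀ S ∈ F, ∫ x, (f S x - psi (s * centredSum c S x)) ^ 2 ∂(Pn) ≤ δ ^ 2)
    (h : Query n lam) :
    (({S ∈ F | 1 / (t : ℝ) < |∫ x, h.toFun x (f S x) ∂(Pn) -
      gridMean (Pn) M fun x θ => h.toFun x (anglePsi θ)|} : Finset (Finset (Fin n))).card : ℝ) ≤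
      4 * M ^ 2 * (1 + ρ) ^ n / (1 / (2 * t : ℝ)) ^ 2 := by
  have ht' : (0 : ℝ) < t := by exact_mod_cast ht
  have hker : IsAngleKernel (Pn) (fun _ => (1 : ℝ)) lam 1 fun x θ => h.toFun x (anglePsi θ) :=
    { measurable := h.measurable_toFun.comp (measurable_fst.prodMk
        (continuous_anglePsi.measurable.comp measurable_snd))
      periodic := fun x θ => by simp only [anglePsi_periodic θ]
      memLp := memLp_const _
      L_nonneg := hlam
      B_nonneg := zero_le_one
      integral_sq_le := by simp
      abs_apply_le := fun x u => by
        have := h.mem_Icc x (anglePsi u)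
        rw [abs_of_nonneg this.1]; exact this.2
      lipschitz := fun x u v => by
        refine (h.lipschitz x _ _).trans ?_
        rw [mul_one]
        exact mul_le_mul_of_nonneg_left (abs_anglePsi_sub_le u v) hlam }
  have := card_deviating_le hρ (one_le_pi_div_two_mul hs) hker hM (ε := 1 / (2 * t))
    (by positivity) (by rw [mul_one]; refine hMt.trans (le_of_eq ?_); field_simp; norm_num)
    {S ∈ F | 1 / (t : ℝ) < |∫ x, h.toFun x (f S x) ∂(Pn) -
      gridMean (Pn) M fun x θ => h.toFun x (anglePsi θ)|} ?_
  · simpa using this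
  intro S hS
  rw [Finset.mem_filter] at hS
  obtain ⟨hSF, hdev⟩ := hS
  have hψ := memLp_psi_centredSum (n := n) (D := D) (c := c) s S
  have hdiff := (hf S hSF).sub hψ
  have habs : ∫ x, |f S x - psi (s * centredSum c S x)| ∂(Pn) ≤ δ :=
    integral_le_of_integral_sq_le hdiff.abs hδ (by
      refine le_trans (le_of_eq ?_) (hfδ S hSF)
      refine integral_congr_ae (Filter.Eventually.of_forall fun x => ?_)
      simp [sq_abs])
  have hi1 : Integrable (fun x => h.toFun x (f S x)) (Pn) :=
    (integrable_const (1 : ℝ)).mono'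
      (h.measurable_toFun.comp (measurable_id.prodMk (hfm S hSF))).aestronglyMeasurable
      (Filter.Eventually.of_forall fun x => by
        have := h.mem_Icc x (f S x)
        rw [Real.norm_eq_abs, abs_of_nonneg this.1]; exact this.2)
  have hϑ : Measurable fun x : Fin n → ℝ => Real.pi / 2 * s * centredSum c S x :=
    (continuous_const.mul (continuous_centredSum c S)).measurable
  have hi2 := hker.integrable hϑ
  have hclose : |∫ x, h.toFun x (f S x) ∂(Pn) -
      ∫ x, h.toFun x (anglePsi (Real.pi / 2 * s * centredSum c S x)) ∂(Pn)| ≤ 1 / (2 * t) := by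
    rw [← integral_sub hi1 hi2]
    refine abs_integral_le_integral_abs.trans (le_trans ?_ hδt)
    calc _ ≤ ∫ x, lam * |f S x - psi (s * centredSum c S x)| ∂(Pn) := by
          refine integral_mono_of_nonneg (Filter.Eventually.of_forall fun _ => abs_nonneg _)
            (hdiff.abs.integrable (by norm_num) |>.const_mul lam)
            (Filter.Eventually.of_forall fun x => ?_)
          simp only
          rw [anglePsi_mul]
          exact h.lipschitz x _ _
      _ = lam * ∫ x, |f S x - psi (s * centredSum c S x)| ∂(Pn) := integral_const_mul _ _
      _ ≤ _ := by gcongr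
  have htri := abs_sub_le (∫ x, h.toFun x (f S x) ∂(Pn))
    (∫ x, h.toFun x (anglePsi (Real.pi / 2 * s * centredSum c S x)) ∂(Pn))
    (gridMean (Pn) M fun x θ => h.toFun x (anglePsi θ))
  have h2 : (1 : ℝ) / t = 1 / (2 * t) + 1 / (2 * t) := by field_simp; norm_num
  linarith

/-- Expanding squares around `a` turns the advantage over the constant `a` into a lower bound on the
correlation of `g - a` with `f - a`. Finiteness of the error of `g` also yields its square
integrability. -/
lemma BeatsConstants.integral_sq_le {P : Measure (Fin n → ℝ)} [IsProbabilityMeasure P] {τ : ℝ}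
    (hτ : 0 ≤ τ) {g f : (Fin n → ℝ) → ℝ} (hg : Measurable g) (hf : MemLp f 2 P)
    (hfm : Measurable f) (h : BeatsConstants P τ g f) (a : ℝ) :
    MemLp (fun x => g x - a) 2 P ∧
      ∫ x, (g x - a) ^ 2 ∂P + τ ≤ 2 * ∫ x, (g x - a) * (f x - a) ∂P := by
  have hfa : MemLp (fun x => a - f x) 2 P := (memLp_const a).sub hf
  have hreg : ∀ {k : (Fin n → ℝ) → ℝ}, MemLp (fun x => k x - f x) 2 P →
      regError P k f = ENNReal.ofReal (∫ x, (k x - f x) ^ 2 ∂P) := fun hk =>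
    (ofReal_integral_eq_lintegral_ofReal hk.integrable_sq
      (Filter.Eventually.of_forall fun _ => sq_nonneg _)).symm
  have h1 := h a
  rw [hreg hfa] at h1
  have hfin : regError P g f < ∞ :=
    lt_of_le_of_lt (le_self_add.trans h1) ENNReal.ofReal_lt_top
  have hgf : MemLp (fun x => g x - f x) 2 P := by
    refine (memLp_two_iff_integrable_sq (f := fun x => g x - f x)
      (hg.sub hfm).aestronglyMeasurable).2 ?_
    refine ⟨((hg.sub hfm).pow_const 2).aestronglyMeasurable, ?_⟩
    rw [hasFiniteIntegral_iff_ofReal (Filter.Eventually.of_forall fun _ => sq_nonneg _)]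
    exact hfin
  have hga : MemLp (fun x => g x - a) 2 P := by
    have := (hgf.add hf).sub (memLp_const a)
    refine this.ae_eq (Filter.Eventually.of_forall fun x => ?_)
    simp
  refine ⟨hga, ?_⟩
  have hfa' : MemLp (fun x => f x - a) 2 P := hf.sub (memLp_const a)
  rw [hreg hgf, ← ENNReal.ofReal_add (integral_nonneg fun _ => sq_nonneg _) hτ,
    ENNReal.ofReal_le_ofReal_iff (integral_nonneg fun _ => sq_nonneg _)] at h1
  have hmul : Integrable (fun x => (g x - a) * (f x - a)) P := hga.integrable_mul hfa'
  have hs1 : Integrable (fun x => (g x - a) ^ 2 - 2 * ((g x - a) * (f x - a))) P :=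
    hga.integrable_sq.sub (hmul.const_mul 2)
  have h2 : ∫ x, (g x - f x) ^ 2 ∂P = ∫ x, (g x - a) ^ 2 ∂P -
      2 * ∫ x, (g x - a) * (f x - a) ∂P + ∫ x, (a - f x) ^ 2 ∂P := by
    rw [← integral_const_mul, ← integral_sub hga.integrable_sq (hmul.const_mul 2),
      ← integral_add hs1 hfa.integrable_sq]
    refine integral_congr_ae (Filter.Eventually.of_forall fun x => ?_)
    simp only
    ring
  linarith

lemma two_mul_integral_mul_le {P : Measure (Fin n → ℝ)} {u v : (Fin n → ℝ) → ℝ}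
    (hu : MemLp u 2 P) (hv : MemLp v 2 P) {r : ℝ} (hr : 0 < r) :
    2 * ∫ x, u x * v x ∂P ≤ r * ∫ x, u x ^ 2 ∂P + 1 / r * ∫ x, v x ^ 2 ∂P := by
  rw [← integral_const_mul, ← integral_const_mul, ← integral_const_mul,
    ← integral_add (hu.integrable_sq.const_mul _) (hv.integrable_sq.const_mul _)]
  refine integral_mono ((hu.integrable_mul hv).const_mul 2)
    ((hu.integrable_sq.const_mul _).add (hv.integrable_sq.const_mul _)) fun x => ?_
  simp only
  have : r * u x ^ 2 + 1 / r * v x ^ 2 - 2 * (u x * v x) = (r * u x - v x) ^ 2 / r := by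
    field_simp; ring
  have h2 : 0 ≤ (r * u x - v x) ^ 2 / r := by positivity
  linarith

open scoped Classical in
theorem card_beatsConstants_le
    (hρ : ∀ κ : ℝ, 1 ≤ |κ| → ‖∫ x, Complex.exp ((κ * (x - c) : ℝ) * Complex.I) ∂D‖ ≤ ρ)
    {s δ τ : ℝ} (hs : 1 ≤ s) (hδ : 0 < δ) (hτ : 0 < τ) {M : ℕ} (hM : 0 < M)
    (hMτ : 3 * Real.pi / √M ≤ τ / 16) (hδ4 : δ ≤ 1 / 4) (hδτ : δ ≤ τ / 20)
    (F : Finset (Finset (Fin n))) (f : Finset (Fin n) → (Fin n → ℝ) → ℝ)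
    (hf : ∀ S ∈ F, MemLp (f S) 2 (Pn)) (hfm : ∀ S ∈ F, Measurable (f S))
    (hfδ : ∀ S ∈ F, ∫ x, (f S x - psi (s * centredSum c S x)) ^ 2 ∂(Pn) ≤ δ ^ 2)
    (g : (Fin n → ℝ) → ℝ) (hg : Measurable g) :
    (({S ∈ F | BeatsConstants (Pn) τ g (f S)} : Finset (Finset (Fin n))).card : ℝ) ≤
      4 * M ^ 2 * 3 ^ 2 * (1 + ρ) ^ n / (τ / 8) ^ 2 := by
  have hρ0 : 0 ≤ ρ := (norm_nonneg _).trans (hρ 1 (by norm_num))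
  have hM' : (0 : ℝ) < M := by exact_mod_cast hM
  rcases Finset.eq_empty_or_nonempty {S ∈ F | BeatsConstants (Pn) τ g (f S)} with h0 | hne
  · rw [h0]
    simp only [Finset.card_empty, Nat.cast_zero]
    positivity
  -- With the grid average as comparison constant, `gridMean` of `u x * anglePsi θ` is exactly `∫ u
  -- a`, so a positive correlation of `u` with `psi - a` is a deviation in the sense of
  -- `card_deviating_le`.
  set a : ℝ := 1 / M * ∑ r ∈ Finset.range M, anglePsi (gridPoint M r) with ha
  have ha0 : 0 ≤ a := mul_nonneg (by positivity) (Finset.sum_nonneg fun _ _ => anglePsi_nonneg _)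
  have ha1 : a ≤ 1 := by
    rw [ha, one_div, inv_mul_le_iff₀ hM', mul_one]
    have := Finset.sum_le_card_nsmul (Finset.range M) (fun r => anglePsi (gridPoint M r)) 1
      fun r _ => anglePsi_le_one _
    simpa using this
  set u : (Fin n → ℝ) → ℝ := fun x => g x - a with hu
  have key : ∀ S ∈ F, BeatsConstants (Pn) τ g (f S) →
      MemLp u 2 (Pn) ∧ ∫ x, u x ^ 2 ∂(Pn) ≤ 3 ^ 2 ∧
      τ / 4 ≤ ∫ x, u x * (psi (s * centredSum c S x) - a) ∂(Pn) := by
    intro S hS hb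
    obtain ⟨hu2, hle⟩ := hb.integral_sq_le hτ.le hg (hf S hS) (hfm S hS) a
    have hψ := memLp_psi_centredSum (n := n) (D := D) (c := c) s S
    have hd1 : MemLp (fun x => f S x - psi (s * centredSum c S x)) 2 (Pn) := (hf S hS).sub hψ
    have hd2 : MemLp (fun x => psi (s * centredSum c S x) - a) 2 (Pn) := hψ.sub (memLp_const a)
    have hsplit : ∫ x, u x * (f S x - a) ∂(Pn) =
        ∫ x, u x * (f S x - psi (s * centredSum c S x)) ∂(Pn) +
        ∫ x, u x * (psi (s * centredSum c S x) - a) ∂(Pn) := by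
      have hm1 : Integrable (fun x => u x * (f S x - psi (s * centredSum c S x))) (Pn) :=
        hu2.integrable_mul hd1
      have hm2 : Integrable (fun x => u x * (psi (s * centredSum c S x) - a)) (Pn) :=
        hu2.integrable_mul hd2
      rw [← integral_add hm1 hm2]
      refine integral_congr_ae (Filter.Eventually.of_forall fun x => ?_)
      simp only
      ring
    have h1 := two_mul_integral_mul_le hu2 hd1 hδ
    have h2 := two_mul_integral_mul_le hu2 hd2 (r := 1 / 2) (by norm_num)
    have h3 : ∫ x, (psi (s * centredSum c S x) - a) ^ 2 ∂(Pn) ≤ 1 := by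
      refine (integral_mono hd2.integrable_sq (integrable_const (1 : ℝ)) fun x => ?_).trans
        (le_of_eq (by simp))
      simp only
      rw [sq_le_one_iff_abs_le_one, abs_le]
      constructor <;> linarith [psi_nonneg (s * centredSum c S x), psi_le_one (s * centredSum c S x)]
    have h4 : 1 / δ * ∫ x, (f S x - psi (s * centredSum c S x)) ^ 2 ∂(Pn) ≤ δ := by
      calc _ ≤ 1 / δ * δ ^ 2 := by
            have := hfδ S hS
            gcongr
        _ = δ := by field_simp
    change ∫ x, u x ^ 2 ∂(Pn) + τ ≤ 2 * ∫ x, u x * (f S x - a) ∂(Pn) at hle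
    rw [hsplit] at hle
    have hU0 : 0 ≤ ∫ x, u x ^ 2 ∂(Pn) := integral_nonneg fun _ => sq_nonneg _
    change 2 * ∫ x, u x * (f S x - psi (s * centredSum c S x)) ∂(Pn) ≤
      δ * ∫ x, u x ^ 2 ∂(Pn) + _ at h1
    change 2 * ∫ x, u x * (psi (s * centredSum c S x) - a) ∂(Pn) ≤
      1 / 2 * ∫ x, u x ^ 2 ∂(Pn) + _ at h2
    set U := ∫ x, u x ^ 2 ∂(Pn)
    have h5 : δ * U ≤ 1 / 4 * U := by gcongr
    -- The estimates give `U + τ ≤ δ U + δ + U / 2 + 2` with `δ ≤ 1/4`. Feeding `U ≤ 9` back costs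
    -- `10 δ ≤ τ / 2` in the correlation bound below.
    have hU9 : U ≤ 3 ^ 2 := by linarith
    refine ⟨hu2, hU9, ?_⟩
    have h6 : δ * U ≤ δ * 3 ^ 2 := by gcongr
    linarith
  obtain ⟨S₀, hS₀⟩ := hne
  rw [Finset.mem_filter] at hS₀
  obtain ⟨hu2, hU9, -⟩ := key S₀ hS₀.1 hS₀.2
  have hker : IsAngleKernel (Pn) (fun x => |u x|) 1 3 fun x θ => u x * anglePsi θ :=
    { measurable := ((hg.sub_const a).comp measurable_fst).mul
        (continuous_anglePsi.measurable.comp measurable_snd)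
      periodic := fun x θ => by simp only [anglePsi_periodic θ]
      memLp := hu2.abs
      L_nonneg := zero_le_one
      B_nonneg := by norm_num
      integral_sq_le := by simpa [sq_abs] using hU9
      abs_apply_le := fun x v => by
        rw [abs_mul, abs_of_nonneg (anglePsi_nonneg v)]
        exact mul_le_of_le_one_right (abs_nonneg _) (anglePsi_le_one v)
      lipschitz := fun x v w => by
        rw [← mul_sub, abs_mul, one_mul]
        exact mul_le_mul_of_nonneg_left (abs_anglePsi_sub_le v w) (abs_nonneg _) }
  refine card_deviating_le hρ (one_le_pi_div_two_mul hs) hker hM (ε := τ / 8) (by positivity)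
    (by rw [one_mul]; linarith) _ fun S hS => ?_
  rw [Finset.mem_filter] at hS
  obtain ⟨-, -, hlow⟩ := key S hS.1 hS.2
  have hmean : gridMean (Pn) M (fun x θ => u x * anglePsi θ) = ∫ x, u x * a ∂(Pn) := by
    rw [gridMean]
    refine integral_congr_ae (Filter.Eventually.of_forall fun x => ?_)
    simp only
    rw [← Finset.mul_sum, ha]
    ring
  have hψ := memLp_psi_centredSum (n := n) (D := D) (c := c) s S
  rw [hmean, ← integral_sub]
  · refine lt_of_lt_of_le ?_ (le_abs_self _)
    have h5 : ∫ x, (u x * anglePsi (Real.pi / 2 * s * centredSum c S x) - u x * a) ∂(Pn) =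
        ∫ x, u x * (psi (s * centredSum c S x) - a) ∂(Pn) := by
      refine integral_congr_ae (Filter.Eventually.of_forall fun x => ?_)
      simp only
      rw [anglePsi_mul]
      ring
    rw [h5]
    linarith
  · simp_rw [anglePsi_mul]
    exact hu2.integrable_mul hψ
  · exact (hu2.integrable (by norm_num)).mul_const a

/-- A square integrable function close to the periodic wave at a random sum has large variance. -/
lemma variance_ge_of_close_psi
    (hρ : ∀ κ : ℝ, 1 ≤ |κ| → ‖∫ x, Complex.exp ((κ * (x - c) : ℝ) * Complex.I) ∂D‖ ≤ ρ)
    {s : ℝ} (hs : 1 ≤ s) (S : Finset (Fin n)) (hS : 10 ^ 10 * ρ ^ S.card ≤ 1 / 2)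
    {f : (Fin n → ℝ) → ℝ} (hf : MemLp f 2 (Pn))
    (hfδ : ∫ x, (f x - psi (s * centredSum c S x)) ^ 2 ∂(Pn) ≤ 1 / 10 ^ 15) :
    1 / 10 ^ 15 ≤ variance f (Pn) := by
  have hψ := memLp_psi_centredSum (n := n) (D := D) (c := c) s S
  set ψ : (Fin n → ℝ) → ℝ := fun x => psi (s * centredSum c S x) with hψdef
  set e := ∫ x, ψ x ∂(Pn) with he
  have he0 : 0 ≤ e := integral_nonneg fun _ => psi_nonneg _
  have he1 : e ≤ 1 := by
    refine (integral_mono (hψ.integrable (by norm_num)) (integrable_const (1 : ℝ)) fun x =>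
      psi_le_one _).trans (le_of_eq (by simp))
  have h1 := integral_anglePsi_sub_sq_ge (n := n) hρ (one_le_pi_div_two_mul hs) S hS he0 he1
  simp_rw [anglePsi_mul] at h1
  have h2 : variance ψ (Pn) = ∫ x, (psi (s * centredSum c S x) - e) ^ 2 ∂(Pn) :=
    variance_eq_integral hψ.aestronglyMeasurable.aemeasurable
  rw [← h2] at h1
  set b := ∫ x, f x ∂(Pn) with hb
  have h3 : variance ψ (Pn) ≤ ∫ x, (ψ x - b) ^ 2 ∂(Pn) := by
    have h4 := variance_sub_const (μ := Pn) (X := ψ) hψ.aestronglyMeasurable b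
    have h5 := variance_le_expectation_sq (μ := Pn) (X := fun x => ψ x - b)
      (hψ.aestronglyMeasurable.sub aestronglyMeasurable_const)
    rw [h4] at h5
    simpa using h5
  have h6 : ∫ x, (ψ x - f x) ^ 2 ∂(Pn) ≤ 1 / 10 ^ 15 := by
    refine le_trans (le_of_eq (integral_congr_ae (Filter.Eventually.of_forall fun x => ?_))) hfδ
    simp only [hψdef]
    ring
  have h7 : ∫ x, (f x - b) ^ 2 ∂(Pn) = variance f (Pn) :=
    (variance_eq_integral hf.aestronglyMeasurable.aemeasurable).symm
  have h8 := integral_sq_sub_le_of_triangle hψ hf (memLp_const b) h6 h7.le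
  norm_num at h8 h1 ⊢
  linarith

end

end SQWave

namespace SQWave

/-! ### Choice of the parameters -/

lemma exists_numUnits_bound {a B : ℝ} (ha : 0 < a) (hB : 0 < B) :
    ∃ C X₀ : ℝ, 1 ≤ C ∧ 1 ≤ X₀ ∧ ∀ n : ℕ, 1 ≤ n → ∀ lam s : ℝ, 1 ≤ lam → 1 ≤ s →
      X₀ ≤ n * s * lam → ∃ m : ℕ,
        (Fintype.card (WaveUnit m) : ℝ) ≤ C * (s * √n * Real.log (lam * s * n)) ∧
        (Fintype.card (WaveUnit m) : ℝ) ≤ C * (n * s * lam) ^ 2 ∧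
        B * Real.exp (-(2 * m * (a / (s * √n)))) ≤ 1 / (n * s * lam) ^ 6 / 4 := by
  refine ⟨16 / a + 6, 3 + 4 * B, by have : 0 < 16 / a := by positivity
                                    linarith, by linarith, fun n hn lam s hlam hs hX => ?_⟩
  have hn' : (1 : ℝ) ≤ n := by exact_mod_cast hn
  have hcomm : lam * s * n = n * s * lam := by ring
  rw [hcomm]
  set X : ℝ := n * s * lam with hXdef
  have hX3 : 3 ≤ X := by linarith
  have hX0 : 0 < X := by linarith
  have hlog : 1 ≤ Real.log X := by
    rw [Real.le_log_iff_exp_le hX0]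
    exact (Real.exp_one_lt_d9.le.trans (by norm_num)).trans hX3
  have hsq : 1 ≤ √(n : ℝ) := Real.one_le_sqrt.2 hn'
  have hsn : 1 ≤ s * √n := one_le_mul_of_one_le_of_one_le hs hsq
  set Z : ℝ := s * √n * Real.log X with hZ
  have hZ1 : 1 ≤ Z := one_le_mul_of_one_le_of_one_le hsn hlog
  have hZX : Z ≤ X ^ 2 := by
    have h1 : s * √n ≤ X := by
      have : √(n : ℝ) ≤ n := by
        rw [Real.sqrt_le_left (by linarith)]
        nlinarith
      calc s * √n ≤ s * n := by gcongr
        _ = n * s * 1 := by ring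
        _ ≤ X := by rw [hXdef]; gcongr
    have h2 : Real.log X ≤ X := (Real.log_le_sub_one_of_pos hX0).trans (by linarith)
    calc Z ≤ X * X := mul_le_mul h1 h2 (by linarith) hX0.le
      _ = X ^ 2 := by ring
  have hC : 0 < 16 / a + 6 := by positivity
  have hcard : (Fintype.card (WaveUnit ⌈4 / a * Z⌉₊) : ℝ) ≤ (16 / a + 6) * Z := by
    rw [card_waveUnit]
    push_cast
    have := (Nat.ceil_lt_add_one (show 0 ≤ 4 / a * Z by positivity)).le
    have h16 : 4 * (4 / a * Z) = 16 / a * Z := by ring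
    linarith
  -- This `m` makes the exponent at least `8 log X`. Of the resulting `X⁻⁸`, two powers absorb the
  -- factor `B`.
  refine ⟨⌈4 / a * Z⌉₊, hcard, hcard.trans (by gcongr), ?_⟩
  have hm : 8 * Real.log X ≤ 2 * (⌈4 / a * Z⌉₊ : ℝ) * (a / (s * √n)) := by
    calc 8 * Real.log X = 2 * (4 / a * Z) * (a / (s * √n)) := by
          rw [hZ]; field_simp; ring
      _ ≤ _ := by
          have := Nat.le_ceil (4 / a * Z)
          gcongr
  have hexp : Real.exp (-(8 * Real.log X)) = 1 / X ^ 8 := by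
    rw [Real.exp_neg, one_div]
    congr 1
    have := Real.exp_nat_mul (Real.log X) 8
    rw [Real.exp_log hX0] at this
    exact_mod_cast this
  calc B * Real.exp (-(2 * (⌈4 / a * Z⌉₊ : ℝ) * (a / (s * √n))))
      ≤ B * Real.exp (-(8 * Real.log X)) := by gcongr
    _ = B * (1 / X ^ 8) := by rw [hexp]
    _ ≤ X ^ 2 / 4 * (1 / X ^ 8) := by
        have : B ≤ X ^ 2 / 4 := by nlinarith
        gcongr
    _ = 1 / X ^ 6 / 4 := by field_simp

lemma two_pow_div_le_card (n : ℕ) :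
    (2 : ℝ) ^ n / (n + 1) ≤
      (({S : Finset (Fin n) | S.card = n / 2} : Finset (Finset (Fin n))).card : ℝ) := by
  have h1 : ({S : Finset (Fin n) | S.card = n / 2} : Finset (Finset (Fin n))).card =
      n.choose (n / 2) := by
    have : ({S : Finset (Fin n) | S.card = n / 2} : Finset (Finset (Fin n))) =
        Finset.powersetCard (n / 2) Finset.univ := by
      ext S
      simp
    rw [this, Finset.card_powersetCard, Finset.card_univ, Fintype.card_fin]
  have h2 : 2 ^ n ≤ (n + 1) * n.choose (n / 2) := by
    rw [← Nat.sum_range_choose]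
    have := Finset.sum_le_card_nsmul (Finset.range (n + 1)) (fun r => n.choose r)
      (n.choose (n / 2)) fun r _ => Nat.choose_le_middle r n
    simpa using this
  rw [h1, div_le_iff₀ (by positivity), mul_comm]
  exact_mod_cast h2

/-- Let `Y = 2 ^ (c n)`. If `q < Y`, the right side carries seven factors of `Y`, one from `q + 1`
and six explicit. The 14 in the choice of `c₀` gives `Y ^ 14 ≤ (2 / (1 + ρ)) ^ n`, so seven more
factors remain to beat the polynomial in `n`. -/
lemma exists_growth_bound {ρ : ℝ} (hρ0 : 0 < ρ) (hρ1 : ρ < 1) :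
    ∃ c₀ : ℝ, 0 < c₀ ∧ ∀ c, 0 < c → c ≤ c₀ → ∀ B : ℝ, 0 < B → ∃ n₀ : ℕ, ∀ n, n₀ ≤ n → ∀ q : ℝ,
      (2 : ℝ) ^ n / (n + 1) / 2 ≤
        (q + 1) * (B * n ^ 6 * ((2 : ℝ) ^ (c * n)) ^ 6 * (1 + ρ) ^ n) →
      (2 : ℝ) ^ (c * n) ≤ q := by
  have h1 : 1 < 2 / (1 + ρ) := by rw [lt_div_iff₀ (by linarith)]; linarith
  refine ⟨Real.logb 2 (2 / (1 + ρ)) / 14, div_pos (Real.logb_pos (by norm_num) h1) (by norm_num),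
    fun c hc hc0 B hB => ?_⟩
  set r : ℝ := (2 : ℝ) ^ (-(7 * c)) with hr
  have hr0 : 0 < r := by positivity
  have hr1 : r < 1 := Real.rpow_lt_one_of_one_lt_of_neg (by norm_num) (by linarith)
  have htend := tendsto_pow_const_mul_const_pow_of_abs_lt_one 7
    (show |r| < 1 by rwa [abs_of_pos hr0])
  obtain ⟨N, hN⟩ := Filter.eventually_atTop.1
    (htend.eventually (gt_mem_nhds (show 0 < 1 / (8 * B) by positivity)))
  refine ⟨max N 1, fun n hn q hq => ?_⟩
  have hn1 : (1 : ℝ) ≤ n := by exact_mod_cast (le_max_right N 1).trans hn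
  have hNn := hN n ((le_max_left N 1).trans hn)
  set Y : ℝ := (2 : ℝ) ^ (c * n) with hY
  have hY1 : 1 ≤ Y := Real.one_le_rpow (by norm_num) (by positivity)
  by_contra! hlt
  have hY7 : r ^ n * Y ^ 7 = 1 := by
    rw [hr, hY, ← Real.rpow_natCast, ← Real.rpow_natCast, ← Real.rpow_mul (by norm_num),
      ← Real.rpow_mul (by norm_num), ← Real.rpow_add (by norm_num)]
    rw [show -(7 * c) * (n : ℝ) + c * n * ((7 : ℕ) : ℝ) = 0 by push_cast; ring, Real.rpow_zero]
  have hY14 : Y ^ 14 * (1 + ρ) ^ n ≤ 2 ^ n := by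
    have : Y ^ 14 ≤ (2 / (1 + ρ)) ^ n := by
      calc Y ^ 14 = ((2 : ℝ) ^ (14 * c)) ^ n := by
            rw [hY, ← Real.rpow_natCast, ← Real.rpow_natCast, ← Real.rpow_mul (by norm_num),
              ← Real.rpow_mul (by norm_num)]
            congr 1
            push_cast
            ring
        _ ≤ (2 / (1 + ρ)) ^ n := by
            refine pow_le_pow_left₀ (by positivity) ?_ n
            rw [← Real.le_logb_iff_rpow_le (by norm_num) (by positivity)]
            linarith
    rw [div_pow, le_div_iff₀ (by positivity)] at this
    exact this
  have hn6 : (0 : ℝ) < (n + 1) := by positivity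
  rw [div_div, div_le_iff₀ (by positivity)] at hq
  have hρn : 0 < (1 + ρ) ^ n := by positivity
  have h3 : Y ^ 14 * (1 + ρ) ^ n ≤
      (2 * Y) * (B * n ^ 6 * Y ^ 6 * (1 + ρ) ^ n) * (2 * n * 2) := by
    refine (hY14.trans hq).trans ?_
    gcongr <;> linarith
  have h4 : Y ^ 7 ≤ 8 * B * n ^ 7 := by
    have : Y ^ 7 * (Y ^ 7 * (1 + ρ) ^ n) ≤ 8 * B * n ^ 7 * (Y ^ 7 * (1 + ρ) ^ n) := by
      calc _ = Y ^ 14 * (1 + ρ) ^ n := by ring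
        _ ≤ _ := h3
        _ = _ := by ring
    exact le_of_mul_le_mul_right this (by positivity)
  rw [lt_div_iff₀ (by positivity)] at hNn
  have : 1 ≤ (n : ℝ) ^ 7 * r ^ n * (8 * B) := by
    calc 1 = r ^ n * Y ^ 7 := hY7.symm
      _ ≤ r ^ n * (8 * B * n ^ 7) := by gcongr
      _ = _ := by ring
  linarith

end SQWave

namespace SQWave

/-! ### The query lower bound for perturbed wave functions -/

variable {n : ℕ} {D : Measure ℝ} [IsProbabilityMeasure D]

local notation "Pn" => Measure.pi fun _ : Fin n => D

lemma integral_waveNet_sub_psi_sq_le (hv : variance (fun x => x) D = 1) {s η X : ℝ} (hs : 0 ≤ s)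
    (m : ℕ) (W : Matrix (WaveUnit m) (Fin n) ℝ) (S : Finset (Fin n))
    (hW : ∀ j i, |W j i - waveWeights m S j i| ≤ η)
    (hη : (Fintype.card (WaveUnit m) * s * η * n) ^ 2 ≤ 1 / X ^ 6 / 4)
    (hwave : ∫ x, (wave s m (centredSum (∫ y, y ∂D) S x) -
      psi (s * centredSum (∫ y, y ∂D) S x)) ^ 2 ∂(Pn) ≤ 1 / X ^ 6 / 4) :
    ∫ x, (waveNet s m W (fun i => x i - ∫ y, y ∂D) -
      psi (s * centredSum (∫ y, y ∂D) S x)) ^ 2 ∂(Pn) ≤ (1 / X ^ 3) ^ 2 := by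
  set c : ℝ := ∫ y, y ∂D with hc
  have hid := memLp_id_of_variance_eq_one hv
  have hi : Integrable (fun x => (x - c) ^ 2) D := (hid.sub (memLp_const c)).integrable_sq
  have hI : ∫ x, (x - c) ^ 2 ∂D = 1 := by
    rw [← hv, variance_eq_integral hid.aestronglyMeasurable.aemeasurable]
  have h1 := integral_waveNet_sub_sq_le hs hi hI m W (waveWeights m S) hW
  have h2 : ∫ x, (waveNet s m (waveWeights m S) (fun i => x i - c) -
      psi (s * centredSum c S x)) ^ 2 ∂(Pn) ≤ 1 / X ^ 6 / 4 := by
    simpa only [waveNet_waveWeights, sWave_sub] using hwave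
  refine (integral_sq_sub_le_of_triangle (memLp_waveNet s m W)
    (memLp_waveNet s m (waveWeights m S)) (memLp_psi_centredSum s S) (h1.trans hη) h2).trans
    (le_of_eq ?_)
  rw [div_pow, one_pow, ← pow_mul]
  ring

lemma abs_waveNet_sub_sWave_le {s η X R : ℝ} (hs : 0 ≤ s) (hη : 0 ≤ η) (m : ℕ)
    (W : Matrix (WaveUnit m) (Fin n) ℝ) (S : Finset (Fin n))
    (hW : ∀ j i, |W j i - waveWeights m S j i| ≤ η)
    (hR : Fintype.card (WaveUnit m) * s * η * n * X ≤ R) (x : Fin n → ℝ) (hx : ∀ i, |x i| ≤ X) :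
    |waveNet s m W x - sWave s m S x| ≤ R := by
  rw [← waveNet_waveWeights]
  refine (abs_waveNet_sub_le hs m W (waveWeights m S) hW x).trans (le_trans ?_ hR)
  have h1 : ∑ i, |x i| ≤ n * X := by
    have := Finset.sum_le_card_nsmul Finset.univ (fun i => |x i|) X fun i _ => hx i
    simpa using this
  calc (Fintype.card (WaveUnit m) : ℝ) * (s * (η * ∑ i, |x i|))
      ≤ Fintype.card (WaveUnit m) * (s * (η * (n * X))) := by gcongr
    _ = _ := by ring

lemma card_div_two_le_of_close_psi {c ρ : ℝ}
    (hρ : ∀ κ : ℝ, 1 ≤ |κ| → ‖∫ x, Complex.exp ((κ * (x - c) : ℝ) * Complex.I) ∂D‖ ≤ ρ)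
    (hn : 1 ≤ n) {s lam : ℝ} (hs : 1 ≤ s) (hlam : 1 ≤ lam) (hX : 1000 ≤ n * s * lam)
    (F : Finset (Finset (Fin n))) (f : Finset (Fin n) → (Fin n → ℝ) → ℝ)
    (hf : ∀ S ∈ F, MemLp (f S) 2 (Pn)) (hfm : ∀ S ∈ F, Measurable (f S))
    (hfδ : ∀ S ∈ F, ∫ x, (f S x - psi (s * centredSum c S x)) ^ 2 ∂(Pn) ≤
      (1 / (n * s * lam) ^ 3) ^ 2)
    (𝓕 : Set ((Fin n → ℝ) → ℝ)) (hF : ∀ S ∈ F, f S ∈ 𝓕)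
    {Ω : Type} [MeasurableSpace Ω] (ν : Measure Ω) [IsProbabilityMeasure ν] (A : Ω → Algo n lam)
    (q : ℕ) (hq : UsesAtMost (Pn) ⌈s ^ 2 * n⌉₊ 𝓕 A q) (hA : WeaklyLearns (Pn) ⌈s ^ 2 * n⌉₊ 𝓕 ν A) :
    (F.card : ℝ) / 2 ≤
      (q + 1) * (2304 * 400 ^ 4 * 2 ^ 6 * n ^ 6 * (lam * s ^ 2) ^ 6 * (1 + ρ) ^ n) := by
  have hρ0 : 0 ≤ ρ := (norm_nonneg _).trans (hρ 1 (by norm_num))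
  have hn' : (1 : ℝ) ≤ n := by exact_mod_cast hn
  have hs2 : 1 ≤ s ^ 2 := one_le_pow₀ hs
  have hsn : 1 ≤ s ^ 2 * n := one_le_mul_of_one_le_of_one_le hs2 hn'
  set t : ℕ := ⌈s ^ 2 * n⌉₊ with ht
  have ht1 : (1 : ℝ) ≤ t := hsn.trans (Nat.le_ceil _)
  have ht0 : 0 < t := by exact_mod_cast (zero_lt_one.trans_le ht1)
  have ht2 : (t : ℝ) ≤ 2 * (s ^ 2 * n) := by
    have := Nat.ceil_lt_add_one (show 0 ≤ s ^ 2 * n by linarith)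
    rw [← ht] at this
    linarith
  set l : ℕ := ⌈lam⌉₊ with hl
  have hl1 : lam ≤ l := Nat.le_ceil _
  have hl2 : (l : ℝ) ≤ 2 * lam := by
    have := Nat.ceil_lt_add_one (show 0 ≤ lam by linarith)
    rw [← hl] at this
    linarith
  have hl0 : 0 < l := by exact_mod_cast (show (0 : ℝ) < l by linarith)
  -- The queries require `√M ≥ 16 t l` and the hypotheses `√M ≥ 192 t`, with `π ≤ 4`. A perfect
  -- square keeps the root exact.
  set M : ℕ := (200 * t * l) ^ 2 with hM
  have hM0 : 0 < M := by positivity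
  have hMsq : √(M : ℝ) = 200 * t * l := by
    rw [hM]
    push_cast
    exact Real.sqrt_sq (by positivity)
  have hl' : (1 : ℝ) ≤ l := hlam.trans hl1
  have hMlam : lam * Real.pi / √(M : ℝ) ≤ 1 / (4 * t) := by
    rw [hMsq, div_le_div_iff₀ (by positivity) (by positivity)]
    calc lam * Real.pi * (4 * t) ≤ l * 4 * (4 * t) := by
          gcongr
          exact Real.pi_le_four
      _ = 16 * (t * l) := by ring
      _ ≤ 1 * (200 * t * l) := by nlinarith [mul_pos (zero_lt_one.trans_le ht1) (zero_lt_one.trans_le hl')]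
  have hsqt : 0 < √(t : ℝ) := Real.sqrt_pos.2 (by linarith)
  have hsqt' : √(t : ℝ) ≤ t := by
    rw [Real.sqrt_le_left (by linarith)]
    nlinarith
  have hMτ : 3 * Real.pi / √(M : ℝ) ≤ 1 / √(t : ℝ) / 16 := by
    rw [hMsq, div_div, div_le_div_iff₀ (by positivity) (by positivity)]
    calc 3 * Real.pi * (√(t : ℝ) * 16) ≤ 3 * 4 * (t * 16) := by
          gcongr
          exact Real.pi_le_four
      _ ≤ 1 * (200 * t * l) := by nlinarith
  set X : ℝ := n * s * lam with hXdef
  have hX0 : 0 < X := by linarith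
  have htX : (t : ℝ) * lam ≤ 2 * X ^ 2 := by
    calc (t : ℝ) * lam ≤ 2 * (s ^ 2 * n) * lam := by gcongr
      _ = 2 * (s ^ 2 * n * lam * 1) := by ring
      _ ≤ 2 * (s ^ 2 * n * lam * (n * lam)) := by
          have := one_le_mul_of_one_le_of_one_le hn' hlam
          gcongr
      _ = 2 * X ^ 2 := by rw [hXdef]; ring
  have htX' : (t : ℝ) ≤ 2 * X ^ 2 := (le_mul_of_one_le_right (by linarith) hlam).trans htX
  have hlamδ : lam * (1 / X ^ 3) ≤ 1 / (2 * t) := by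
    rw [mul_one_div, div_le_div_iff₀ (by positivity) (by positivity)]
    nlinarith [mul_le_mul_of_nonneg_right hX (sq_nonneg X)]
  have hδ4 : 1 / X ^ 3 ≤ 1 / 4 := by
    refine one_div_le_one_div_of_le (by norm_num) ?_
    have : 1 ≤ X ^ 2 := one_le_pow₀ (by linarith)
    nlinarith
  have hδτ : 1 / X ^ 3 ≤ 1 / √(t : ℝ) / 20 := by
    rw [div_div]
    refine one_div_le_one_div_of_le (by positivity) ?_
    nlinarith [mul_le_mul_of_nonneg_right hX (sq_nonneg X)]
  -- `2304 = 4 · 9 · 64` comes from the count for hypotheses and dominates the 16 from queries. The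
  -- rest bounds `M² t² = 200⁴ t⁶ l⁴` with `t ≤ 2 s² n` and `l ≤ 2 lam`.
  set β : ℝ := 2304 * 400 ^ 4 * 2 ^ 6 * n ^ 6 * (lam * s ^ 2) ^ 6 * (1 + ρ) ^ n with hβ
  have hMt : (M : ℝ) ^ 2 * t ^ 2 ≤ 400 ^ 4 * 2 ^ 6 * n ^ 6 * (lam * s ^ 2) ^ 6 := by
    calc (M : ℝ) ^ 2 * t ^ 2 = 200 ^ 4 * t ^ 6 * l ^ 4 := by rw [hM]; push_cast; ring
      _ ≤ 200 ^ 4 * (2 * (s ^ 2 * n)) ^ 6 * (2 * lam) ^ 4 := by gcongr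
      _ = 400 ^ 4 * 2 ^ 6 * n ^ 6 * (s ^ 2) ^ 6 * (lam ^ 4 * 1) := by ring
      _ ≤ 400 ^ 4 * 2 ^ 6 * n ^ 6 * (s ^ 2) ^ 6 * (lam ^ 4 * lam ^ 2) := by
          have : 1 ≤ lam ^ 2 := one_le_pow₀ hlam
          gcongr
      _ = _ := by ring
  have hρn : 0 ≤ (1 + ρ) ^ n := by positivity
  have hβ' : 2304 * ((M : ℝ) ^ 2 * t ^ 2) * (1 + ρ) ^ n ≤ β := by
    calc _ ≤ 2304 * (400 ^ 4 * 2 ^ 6 * n ^ 6 * (lam * s ^ 2) ^ 6) * (1 + ρ) ^ n := by gcongr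
      _ = β := by rw [hβ]; ring
  have hmain := card_div_two_le_of_weaklyLearns F (Pn) t 𝓕 f hF ν A q hq hA
    (fun h => gridMean (Pn) M fun x θ => h.toFun x (anglePsi θ)) (β := β) (γ := β)
    (by positivity)
    (fun h => (card_distinguished_le hρ hs (by linarith) (by positivity) ht0 hM0 hMlam hlamδ F f hf
      hfm hfδ h).trans ?_)
    (fun g hg => (card_beatsConstants_le hρ hs (by positivity) (by positivity) hM0 hMτ hδ4 hδτ F f
      hf hfm hfδ g hg).trans ?_)
  · linarith
  · refine le_trans ?_ hβ'
    have : 4 * (M : ℝ) ^ 2 * (1 + ρ) ^ n / (1 / (2 * t)) ^ 2 =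
        16 * ((M : ℝ) ^ 2 * t ^ 2) * (1 + ρ) ^ n := by field_simp; ring
    rw [this]
    gcongr
    norm_num
  · refine le_trans ?_ hβ'
    have : 4 * (M : ℝ) ^ 2 * 3 ^ 2 * (1 + ρ) ^ n / (1 / √(t : ℝ) / 8) ^ 2 =
        2304 * ((M : ℝ) ^ 2 * √(t : ℝ) ^ 2) * (1 + ρ) ^ n := by field_simp; ring
    rw [this, Real.sq_sqrt (by linarith)]
    gcongr
    nlinarith

end SQWave

/-! ### Choice of constants and assembly -/

theorem theorem1 :
    ∃ (c C : ℝ) (K n₀ : ℕ), 0 < c ∧ 0 < C ∧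
      ∀ n : ℕ, n₀ ≤ n → ∀ lam s : ℝ, 1 ≤ lam → 1 ≤ s →
        ∃ (m t : ℕ) (η : ℝ),
          -- number of units, oracle parameter, size of the admissible weight perturbations
          (Fintype.card (SQWave.WaveUnit m) : ℝ) ≤ C * (s * √n * Real.log (lam * s * n)) ∧
          c * (s ^ 2 * n) ≤ t ∧
          1 / (C * (n * s * lam) ^ K) ≤ η ∧ η ≤ 1 / (n * s * lam) ∧
          -- the wave functions: range, and representation by networks
          (∀ (S : Finset (Fin n)) (x : Fin n → ℝ),
            SQWave.sWave s m S x ∈ Set.Icc (-1 : ℝ) 1 ∧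
            SQWave.waveNet s m (SQWave.waveWeights m S) x = SQWave.sWave s m S x) ∧
          -- some admissible weight matrices are well conditioned
          (∃ W : Finset (Fin n) → Matrix (SQWave.WaveUnit m) (Fin n) ℝ,
            SQWave.IsPerturbation m η W ∧
            ∀ S : Finset (Fin n), S.card = n / 2 →
              SQWave.condNumber (W S) ≤ ENNReal.ofReal (C * (n * s * lam) ^ K)) ∧
          -- for all admissible weight matrices: range, variance, and the query lower bound
          ∀ W : Finset (Fin n) → Matrix (SQWave.WaveUnit m) (Fin n) ℝ,
            SQWave.IsPerturbation m η W →
              (∀ S : Finset (Fin n), S.card = n / 2 →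
                ∀ x : Fin n → ℝ, (∀ i, |x i| ≤ n * s * lam) →
                  SQWave.waveNet s m (W S) x ∈ Set.Icc (-1 : ℝ) 1) ∧
              ∀ D : MeasureTheory.Measure ℝ, MeasureTheory.IsProbabilityMeasure D →
                SQWave.IsLogConcave D → ProbabilityTheory.variance (fun x : ℝ => x) D = 1 →
                  (∀ f ∈ SQWave.waveFamily s m W (∫ x, x ∂D),
                    c ≤ ProbabilityTheory.variance f (MeasureTheory.Measure.pi fun _ => D)) ∧
                  ∀ (Ω : Type) (_ : MeasurableSpace Ω) (ρ : MeasureTheory.Measure Ω),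
                    MeasureTheory.IsProbabilityMeasure ρ →
                    ∀ (A : Ω → SQWave.Algo n lam) (q : ℕ),
                      SQWave.UsesAtMost (MeasureTheory.Measure.pi fun _ => D) t
                        (SQWave.waveFamily s m W (∫ x, x ∂D)) A q →
                      SQWave.WeaklyLearns (MeasureTheory.Measure.pi fun _ => D) t
                        (SQWave.waveFamily s m W (∫ x, x ∂D)) ρ A →
                      ⌊(2 : ℝ) ^ (c * n) / (lam * s ^ 2)⌋₊ ≤ q := by
  classical
  obtain ⟨ρ, hρ0, hρ1, hchar⟩ := SQWave.exists_charFun_bound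
  obtain ⟨Cw, a, hCw, ha, hwave⟩ := SQWave.exists_integral_wave_sub_psi_sq_le
  obtain ⟨C₂, X₀, hC₂, hX₀, hunits⟩ := SQWave.exists_numUnits_bound ha hCw
  obtain ⟨c₀, hc₀, hgrowth⟩ := SQWave.exists_growth_bound hρ0 hρ1
  -- One constant serves as exponent and as variance bound, which is why the growth bound admits
  -- every smaller exponent.
  set c : ℝ := min c₀ (1 / 10 ^ 15) with hc
  have hc0 : 0 < c := lt_min hc₀ (by norm_num)
  have hc15 : c ≤ 1 / 10 ^ 15 := min_le_right _ _
  obtain ⟨n₁, hn₁⟩ := hgrowth c hc0 (min_le_left _ _) (2304 * 400 ^ 4 * 2 ^ 6) (by norm_num)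
  -- For `n ≥ 2 k` the sets have at least `k` elements, so `ρ ^ |S|` meets the requirement of the
  -- variance bound.
  obtain ⟨k, hk⟩ := exists_pow_lt_of_lt_one (show (0 : ℝ) < 1 / (2 * 10 ^ 10) by norm_num) hρ1
  refine ⟨c, 4 * C₂, 11, max (max n₁ (2 * k)) (max ⌈X₀⌉₊ (1000 + ⌈10 * C₂⌉₊)), hc0, by linarith,
    fun n hn lam s hlam hs => ?_⟩
  have hnn₁ : n₁ ≤ n := (le_max_left _ _).trans ((le_max_left _ _).trans hn)
  have hnk : 2 * k ≤ n := (le_max_right _ _).trans ((le_max_left _ _).trans hn)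
  have hnX : ⌈X₀⌉₊ ≤ n := (le_max_left _ _).trans ((le_max_right _ _).trans hn)
  have hnC : 1000 + ⌈10 * C₂⌉₊ ≤ n := (le_max_right _ _).trans ((le_max_right _ _).trans hn)
  have hn1 : 1 ≤ n := by omega
  have hnR : (1 : ℝ) ≤ n := by exact_mod_cast hn1
  have hnX' : (n : ℝ) ≤ n * s * lam := by
    calc (n : ℝ) = n * 1 * 1 := by ring
      _ ≤ n * s * lam := by gcongr
  have hC : 10 * C₂ ≤ n * s * lam ∧ 1000 ≤ n * s * lam := by
    have h1 : (1000 : ℝ) + ⌈10 * C₂⌉₊ ≤ n := by exact_mod_cast hnC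
    have h2 := Nat.le_ceil (10 * C₂)
    have h3 : (0 : ℝ) ≤ ⌈10 * C₂⌉₊ := Nat.cast_nonneg _
    constructor <;> linarith
  obtain ⟨m, hm1, hm2, hm3⟩ := hunits n hn1 lam s hlam hs
    (((Nat.le_ceil X₀).trans (by exact_mod_cast hnX)).trans hnX')
  set X : ℝ := n * s * lam with hX
  obtain ⟨hXC, hX1⟩ := hC
  have hX0 : 0 < X := by linarith
  set N : ℝ := (Fintype.card (SQWave.WaveUnit m) : ℝ) with hN
  have hN0 : 0 ≤ N := Nat.cast_nonneg _
  have hs0 : s ≠ 0 := by positivity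
  have hη0 : (0 : ℝ) < 1 / X ^ 7 := by positivity
  have hη1 : 1 / X ^ 7 ≤ 1 / X :=
    one_div_le_one_div_of_le hX0 (le_self_pow₀ (by linarith) (by norm_num))
  have hns : s * n ≤ X := by
    calc s * n = n * s * 1 := by ring
      _ ≤ X := by rw [hX]; gcongr
  have hnX2 : (n : ℝ) ≤ X := hnX'
  have hdiff : N * s * (1 / X ^ 7) * n * X ≤ 1 / 10 := by
    calc N * s * (1 / X ^ 7) * n * X = N * (s * n) / X ^ 6 := by field_simp
      _ ≤ C₂ * X ^ 2 * X / X ^ 6 := by gcongr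
      _ = C₂ / X ^ 3 := by field_simp
      _ ≤ (X / 10) / X ^ 3 := by gcongr; linarith
      _ = 1 / 10 * (1 / X ^ 2) := by field_simp
      _ ≤ 1 / 10 * 1 := by
          gcongr
          rw [div_le_one (by positivity)]
          exact one_le_pow₀ (by linarith)
      _ = 1 / 10 := by ring
  have hdiff2 : (N * s * (1 / X ^ 7) * n) ^ 2 ≤ 1 / X ^ 6 / 4 := by
    have h1 : N * s * (1 / X ^ 7) * n ≤ 1 / (10 * X ^ 3) := by
      calc N * s * (1 / X ^ 7) * n = N * (s * n) / X ^ 7 := by field_simp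
        _ ≤ C₂ * X ^ 2 * X / X ^ 7 := by gcongr
        _ = C₂ / X ^ 4 := by field_simp
        _ ≤ (X / 10) / X ^ 4 := by gcongr; linarith
        _ = 1 / (10 * X ^ 3) := by field_simp
    calc (N * s * (1 / X ^ 7) * n) ^ 2 ≤ (1 / (10 * X ^ 3)) ^ 2 :=
          pow_le_pow_left₀ (by positivity) h1 2
      _ = 1 / X ^ 6 / 100 := by field_simp; norm_num
      _ ≤ 1 / X ^ 6 / 4 := by gcongr; norm_num
  -- As `N ≤ C₂ X²`, the perturbation `X⁻⁷` moves the network by at most `C₂ X⁻³` on the box and `C₂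
  -- X⁻⁴` in `L²`. The condition number is at most `4 N n² X⁷ ≤ 4 C₂ X¹¹`, which fixes the exponent
  -- 11.
  refine ⟨m, ⌈s ^ 2 * n⌉₊, 1 / X ^ 7, ?_, ?_, ?_, hη1, ?_, ?_, ?_⟩
  · have : 0 ≤ s * √n * Real.log (lam * s * n) := by
      by_contra! hneg
      nlinarith
    linarith [mul_nonneg (show (0 : ℝ) ≤ 3 * C₂ by linarith) this]
  · refine le_trans ?_ (Nat.le_ceil _)
    have : (0 : ℝ) ≤ s ^ 2 * n := by positivity
    nlinarith
  · refine one_div_le_one_div_of_le (by positivity) ?_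
    calc X ^ 7 ≤ X ^ 11 := pow_le_pow_right₀ (by linarith) (by norm_num)
      _ ≤ 4 * C₂ * X ^ 11 := le_mul_of_one_le_left (by positivity) (by linarith)
  · intro S x
    refine ⟨⟨?_, ?_⟩, SQWave.waveNet_waveWeights s m S x⟩
    · linarith [SQWave.wave_nonneg hs0 m (∑ i ∈ S, x i), show SQWave.sWave s m S x =
        SQWave.wave s m (∑ i ∈ S, x i) from rfl]
    · linarith [SQWave.wave_le hs0 m (∑ i ∈ S, x i), show SQWave.sWave s m S x =
        SQWave.wave s m (∑ i ∈ S, x i) from rfl]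
  · refine ⟨SQWave.diagWeights m (1 / X ^ 7),
      fun S _ => SQWave.abs_diagWeights_sub_le m hη0.le S, fun S _ => ?_⟩
    refine (SQWave.condNumber_diagWeights_le hn1 m hη0
      (hη1.trans (by rw [div_le_one hX0]; linarith)) S).trans (ENNReal.ofReal_le_ofReal ?_)
    calc 2 * (N * n) / (1 / X ^ 7 / (2 * n)) = 4 * N * n ^ 2 * X ^ 7 := by field_simp; ring
      _ ≤ 4 * (C₂ * X ^ 2) * X ^ 2 * X ^ 7 := by gcongr
      _ = 4 * C₂ * X ^ 11 := by ring
  intro W hW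
  refine ⟨fun S hS x hx => ?_, fun D hD hlc hv => ?_⟩
  · have h1 := abs_le.1 (SQWave.abs_waveNet_sub_sWave_le (by linarith) hη0.le m (W S) S (hW S hS)
      hdiff x hx)
    have h2 := SQWave.wave_nonneg hs0 m (∑ i ∈ S, x i)
    have h3 := SQWave.wave_le hs0 m (∑ i ∈ S, x i)
    rw [show SQWave.sWave s m S x = SQWave.wave s m (∑ i ∈ S, x i) from rfl] at h1
    constructor <;> linarith
  have hρD := fun κ => hchar D hD hlc hv κ (∫ y, y ∂D)
  have hclose : ∀ S : Finset (Fin n), S.card = n / 2 →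
      ∫ x, (SQWave.waveNet s m (W S) (fun i => x i - ∫ y, y ∂D) -
        SQWave.psi (s * SQWave.centredSum (∫ y, y ∂D) S x)) ^ 2
          ∂(MeasureTheory.Measure.pi fun _ : Fin n => D) ≤ (1 / X ^ 3) ^ 2 := fun S hS =>
    SQWave.integral_waveNet_sub_psi_sq_le hv (by linarith) m (W S) S (hW S hS) hdiff2
      ((hwave D hD hlc hv n hn1 s hs m S).trans hm3)
  refine ⟨?_, fun Ω _ ν hν A q hq hA => ?_⟩
  · rintro f ⟨S, hS, rfl⟩
    refine hc15.trans (SQWave.variance_ge_of_close_psi hρD hs S ?_ (SQWave.memLp_waveNet s m (W S))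
      ((hclose S hS).trans ?_))
    · have : ρ ^ S.card ≤ ρ ^ k := pow_le_pow_of_le_one hρ0.le hρ1.le (by omega)
      linarith
    · calc (1 / X ^ 3) ^ 2 ≤ (1 / 1000 ^ 3) ^ 2 := by gcongr
        _ ≤ 1 / 10 ^ 15 := by norm_num
  · have hlow := SQWave.card_div_two_le_of_close_psi hρD hn1 hs hlam hX1
      ({S : Finset (Fin n) | S.card = n / 2} : Finset (Finset (Fin n)))
      (fun S x => SQWave.waveNet s m (W S) fun i => x i - ∫ y, y ∂D)
      (fun S _ => SQWave.memLp_waveNet s m (W S))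
      (fun S _ => ((SQWave.continuous_waveNet s m (W S)).comp (by fun_prop)).measurable)
      (fun S hS => hclose S (by simpa using hS)) (SQWave.waveFamily s m W (∫ y, y ∂D))
      (fun S hS => ⟨S, by simpa using hS, rfl⟩) ν A q hq hA
    have hls : 1 ≤ lam * s ^ 2 := one_le_mul_of_one_le_of_one_le hlam (one_le_pow₀ hs)
    -- If `lam s²` exceeds `2 ^ (c n)` the floor is 0. Otherwise its sixth power is at most `(2 ^ (c
    -- n)) ^ 6`, as the growth bound allows.
    rcases lt_or_ge ((2 : ℝ) ^ (c * n)) (lam * s ^ 2) with hlt | hge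
    · rw [Nat.floor_eq_zero.2 ((div_lt_one (by linarith)).2 hlt)]
      exact Nat.zero_le q
    · refine Nat.floor_le_of_le ((div_le_self (by positivity) hls).trans
        (hn₁ n hnn₁ q (le_trans ?_ (hlow.trans ?_))))
      · have := SQWave.two_pow_div_le_card n
        linarith
      · gcongr
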